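/- Let $d\ge 2$, $0<T<\infty$ and $0\le\vartheta\le d+1$. Let $L^\infty_\vartheta$ be the space of measurable functions or vector fields $f$ on $\mathbb R^d$ with $\|f\|_{L^\infty_\vartheta}=\operatorname{ess\,sup}_{x}(1+|x|)^{\vartheta}|f(x)|<\infty$, and let $L^\infty([0,T];L^\infty_\vartheta)$ be the space of measurable $u$ on $[0,T]\times\mathbb R^d$ with $\operatorname{ess\,sup}_{t\in[0,T]}\|u(t)\|_{L^\infty_\vartheta}<\infty$. Let $a\in L^\infty_\vartheta$ be a divergence-free vector field on $\mathbb R^d$ and let $u\in L^\infty([0,T];L^\infty_\vartheta)$ be a mild solution on $[0,T]$ of the Navier–Stokes system $$\partial_t u-\Delta u+(u\cdot\nabla)u=-\nabla p,\qquad \operatorname{div}u=0,\qquad u(\cdot,0)=a,$$ that is, for $j=1,\dots,d$ and almost every $(x,t)\in\mathbb R^d\times(0,T)$, $$u_j(t)=e^{t\Delta}a_j-\sum_{h,k=1}^d\int_0^t F_{j;h,k}(t-s)*(u_hu_k)(s)\,ds,$$ where $e^{t\Delta}$ is the heat semigroup and $$F_{j;h,k}(x,t)=\int_{\mathbb R^d}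 i\,e^{-t|\xi|^2+ix\cdot\xi}\Bigl(\tfrac12[\xi_h\delta_{j,k}+\xi_k\delta_{j,h}]-\tfrac{\xi_j\xi_h\xi_k}{|\xi|^2}\Bigr)\frac{d\xi}{(2\pi)^d}$$ is the kernel of $e^{t\Delta}\mathbb P\operatorname{div}$, $\mathbb P$ being the projector onto divergence-free fields. All derivatives below are taken in the sense of distributions (on $\mathbb R^d$ for $a$, on $(0,T)\times\mathbb R^d$ for $u$). (i) If $\partial_i a\in L^\infty_\vartheta$ for some index $i\in\{1,\dots,d\}$, then, for that $i$, $\partial_i u\in L^\infty([0,T];L^\infty_\vartheta)$. (ii) If $\partial_i a\in L^\infty_\vartheta$ and $\partial_i\partial_j a\in L^\infty_\vartheta$ for all $i,j\in\{1,\dots,d\}$, then $$\partial_i\partial_j u\in L^\infty([0,T];L^\infty_\vartheta)\ \text{ for all } i,j,\qquad\text{and}\qquad t^{1/2}\,\partial_t u\in L^\infty([0,T];L^\infty_\vartheta).$$ -/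

import Mathlib

open MeasureTheory
open scoped ContDiff

noncomputable section

/-- The Euclidean space `ℝ^d`. -/
abbrev Vec (d : ℕ) : Type := EuclideanSpace ℝ (Fin d)

/-- The `i`-th vector of the standard basis of `ℝ^d`. -/
def stdVec (d : ℕ) (i : Fin d) : Vec d := EuclideanSpace.single i (1 : ℝ)

/-- Membership of a vector field in `L^∞_ϑ`:
`f` is measurable and `ess sup_x (1 + |x|)^ϑ |f x| < ∞`. -/
def MemWeighted {d : ℕ} (ϑ : ℝ) (f : Vec d → Vec d) : Prop :=
  AEStronglyMeasurable f volume ∧ ∃ C : ℝ, ∀ᵐ x : Vec d, (1 + ‖x‖) ^ ϑ * ‖f x‖ ≤ C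

/-- Membership of a time-dependent vector field in `L^∞([0,T]; L^∞_ϑ)`:
`u` is (jointly) measurable and the `L^∞_ϑ` norm of `u(t)` is essentially bounded on `[0,T]`. -/
def MemLinftyWeighted {d : ℕ} (T ϑ : ℝ) (u : ℝ → Vec d → Vec d) : Prop :=
  AEStronglyMeasurable (Function.uncurry u)
      ((volume.restrict (Set.Icc 0 T)).prod (volume : Measure (Vec d))) ∧
    ∃ C : ℝ, ∀ᵐ t ∂(volume.restrict (Set.Icc (0 : ℝ) T)), ∀ᵐ x : Vec d,
      (1 + ‖x‖) ^ ϑ * ‖u t x‖ ≤ C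

/-- `g` is the weak (distributional) derivative of `f` in the direction `v` on the set `Ω`
(used only for open `Ω`): `∫_Ω (∂_v φ) f = - ∫_Ω φ g` for all `φ ∈ C_c^∞(Ω)`. -/
def HasWeakDirDeriv {V W : Type*} [NormedAddCommGroup V] [NormedSpace ℝ V] [MeasureSpace V]
    [NormedAddCommGroup W] [NormedSpace ℝ W]
    (Ω : Set V) (v : V) (f g : V → W) : Prop :=
  LocallyIntegrableOn f Ω volume ∧ LocallyIntegrableOn g Ω volume ∧
    ∀ φ : V → ℝ, ContDiff ℝ ∞ φ → HasCompactSupport φ → tsupport φ ⊆ Ω →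
      ∫ z in Ω, (fderiv ℝ φ z v) • f z = - ∫ z in Ω, φ z • g z

/-- `b = ∂_i a` in the sense of distributions on `ℝ^d`. -/
def IsWeakPartial {d : ℕ} (i : Fin d) (a b : Vec d → Vec d) : Prop :=
  HasWeakDirDeriv Set.univ (stdVec d i) a b

/-- The open space-time cylinder `(0,T) × ℝ^d`. -/
def cylinder (d : ℕ) (T : ℝ) : Set (ℝ × Vec d) := Set.Ioo 0 T ×ˢ Set.univ

/-- `w = ∂_i u` (space derivative) in the sense of distributions on `(0,T) × ℝ^d`. -/
def IsWeakSpaceDeriv {d : ℕ} (T : ℝ) (i : Fin d) (u w : ℝ → Vec d → Vec d) : Prop :=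
  HasWeakDirDeriv (cylinder d T) ((0 : ℝ), stdVec d i) (Function.uncurry u) (Function.uncurry w)

/-- `w = ∂_t u` in the sense of distributions on `(0,T) × ℝ^d`. -/
def IsWeakTimeDeriv {d : ℕ} (T : ℝ) (u w : ℝ → Vec d → Vec d) : Prop :=
  HasWeakDirDeriv (cylinder d T) ((1 : ℝ), (0 : Vec d)) (Function.uncurry u) (Function.uncurry w)

/-- `div a = 0` in the sense of distributions on `ℝ^d`. -/
def IsWeaklyDivFree {d : ℕ} (a : Vec d → Vec d) : Prop :=
  ∀ φ : Vec d → ℝ, ContDiff ℝ ∞ φ → HasCompactSupport φ → ∫ x, fderiv ℝ φ x (a x) = 0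

/-- The heat flow `e^{tΔ} a (x) = (4πt)^{-d/2} ∫ e^{-|x-y|²/(4t)} a(y) dy`. -/
def heatFlow {d : ℕ} (t : ℝ) (a : Vec d → Vec d) (x : Vec d) : Vec d :=
  (4 * Real.pi * t) ^ (-(d : ℝ) / 2) • ∫ y, Real.exp (-‖x - y‖ ^ 2 / (4 * t)) • a y

/-- The Kronecker symbol. -/
def kron {d : ℕ} (i j : Fin d) : ℝ := if i = j then 1 else 0

/-- The kernel `F_{j;h,k}(x,t)` of the convolution operator `e^{tΔ} ℙ div`, where `ℙ` is the
Leray projector, as an inverse Fourier transform (the integral is a real number):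
`∫ i e^{-t|ξ|² + i x·ξ} (½ [ξ_h δ_{jk} + ξ_k δ_{jh}] - ξ_j ξ_h ξ_k / |ξ|²) dξ / (2π)^d`. -/
def oseenKernel {d : ℕ} (j h k : Fin d) (t : ℝ) (x : Vec d) : ℝ :=
  ((2 * Real.pi) ^ d)⁻¹ *
    (∫ ξ : Vec d, Complex.I *
      Complex.exp (-((t * ‖ξ‖ ^ 2 : ℝ) : ℂ) + Complex.I * ((inner ℝ x ξ : ℝ) : ℂ)) *
      (((ξ h * kron j k + ξ k * kron j h) / 2 - ξ j * ξ h * ξ k / ‖ξ‖ ^ 2 : ℝ) : ℂ)).re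

/-- The `j`-th component of the bilinear term `∫_0^t e^{(t-s)Δ} ℙ div (u ⊗ u)(s) ds`, i.e.
`∑_{h,k} ∫_0^t F_{j;h,k}(t-s) * (u_h u_k)(s) ds`. -/
def duhamelTerm {d : ℕ} (u : ℝ → Vec d → Vec d) (j : Fin d) (t : ℝ) (x : Vec d) : ℝ :=
  ∑ h : Fin d, ∑ k : Fin d,
    ∫ s in (0 : ℝ)..t, ∫ y : Vec d, oseenKernel j h k (t - s) (x - y) * (u s y h * u s y k)

/-- `u` is a mild solution on `[0,T]` of the Navier–Stokes system in `ℝ^d` with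
divergence-free Cauchy datum `a`:
`u(t) = e^{tΔ} a - ∫_0^t e^{(t-s)Δ} ℙ div (u ⊗ u)(s) ds` almost everywhere. -/
def IsMildSolution {d : ℕ} (T : ℝ) (a : Vec d → Vec d) (u : ℝ → Vec d → Vec d) : Prop :=
  IsWeaklyDivFree a ∧
    ∀ᵐ t ∂(volume.restrict (Set.Ioo (0 : ℝ) T)), ∀ᵐ x : Vec d, ∀ j : Fin d,
      u t x j = heatFlow t a x j - duhamelTerm u j t x

end

/-!
All derivatives are obtained from difference quotients. A bounded function whose difference
quotients in a direction are dominated by a positive continuous `ρ` has a weak derivative dominated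
by `ρ` (`exists_hasWeakDirDeriv_of_norm_sub_le`): divided by `ρ` and multiplied by a fixed `L²`
weight they are bounded in `L²`, so they have a weak limit along an ultrafilter. Hence it suffices
to bound increments of `u`, and these solve linear equations of Duhamel type.

The linear theory rests on one kernel estimate. Since `|ξ|⁻² e^{-t|ξ|²} = ∫_t^∞ e^{-s|ξ|²} ds`, the
Oseen kernel is an integral of Gaussian moments of homogeneous polynomials, and
`|F(x,t)| ≤ C (t + |x|²)^{-(d+1)/2}` (`exists_abs_oseenKernel_le`). As `ϑ ≤ d + 1`, convolution with
`F(t)` maps `L^∞_{2ϑ}` to `L^∞_ϑ` with norm `O(t^{-1/2})` (`exists_abs_integral_oseenKernel_mul_le`).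
The source `u ⊗ u` lies in `L^∞_{2ϑ}`, and its increments are at most a multiple of `(1 + |x|)^{-ϑ}` times
those of `u`. In a norm weighted in time by `e^{μt}`, or by `t^{-1/2} e^{μt}`, with `μ` large, the
operator `m ↦ ∫₀ᵗ (t-s)^{-1/2} m(s) ds` is a contraction; this gives the Gronwall-type estimate
`exists_gronwall_estimate`, which bounds an increment of `u` by the free part and by what remains of
the source.

After replacing `u` by the right-hand side of its integral equation, the equation holds at every
point (`exists_everywhere_mild_representative`) and is translation invariant. Increments of `u` in
space are then controlled by those of `a` (`exists_norm_increment_le`), and second increments by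
second increments of `a` and products of first ones (`exists_norm_second_increment_le`). A shift in
time adds the contribution of a short initial time interval to the Duhamel term, of size
`h t^{-1/2}`, as is the increment of the heat flow of a Lipschitz datum
(`exists_norm_time_increment_le`). Increments of `a` are integrals of its weak derivatives
(`sub_eq_integral_of_hasWeakDirDeriv`). For second derivatives, the weak derivative of an increment
of `u` is the increment of the weak derivative (`weakDirDeriv_increment_ae_eq`), so that the bound
on second increments makes `∂_j u` Lipschitz.
-/

noncomputable section

open Filter Topology
open scoped SchwartzMap FourierTransform

/-! ### Gaussian integrals of homogeneous symbols -/

/-- The Gaussian `e^{-|x|²}` as a Schwartz function. -/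
def gaussianSchwartz (d : ℕ) : 𝓢(Vec d, ℝ) where
  toFun x := Real.exp (-‖x‖ ^ 2)
  smooth' := Real.contDiff_exp.comp (contDiff_norm_sq ℝ).neg
  decay' := by
    intro k n
    have hf : Function.HasTemperateGrowth (fun x : Vec d => -‖x‖ ^ 2) :=
      (Function.hasTemperateGrowth_norm_sq (H := Vec d)).neg
    obtain ⟨l, C, hC, hl⟩ := hf.norm_iteratedFDeriv_le_uniform n
    -- every power of `1 + ‖x‖` is absorbed by the Gaussian
    obtain ⟨B, hB⟩ : ∃ B : ℝ, ∀ r : ℝ, 0 ≤ r → (1 + r) ^ (k + l * n) * Real.exp (-r ^ 2) ≤ B := by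
      refine ⟨(k + l * n).factorial * Real.exp 2, fun r hr => ?_⟩
      have h1 : (1 + r) ^ (k + l * n) / (k + l * n).factorial ≤ Real.exp (1 + r) :=
        Real.pow_div_factorial_le_exp _ (by linarith) _
      have h2 : (0 : ℝ) < (k + l * n).factorial := by positivity
      rw [div_le_iff₀ h2] at h1
      calc (1 + r) ^ (k + l * n) * Real.exp (-r ^ 2)
          ≤ Real.exp (1 + r) * (k + l * n).factorial * Real.exp (-r ^ 2) := by gcongr
        _ = (k + l * n).factorial * Real.exp (1 + r + -r ^ 2) := by
            rw [Real.exp_add (1 + r)]; ring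
        _ ≤ _ := by gcongr; nlinarith [sq_nonneg (r - 1 / 2)]
    refine ⟨n.factorial * (1 + C) ^ n * B, fun x => ?_⟩
    have h1 : ‖iteratedFDeriv ℝ n (Real.exp ∘ fun x : Vec d => -‖x‖ ^ 2) x‖ ≤
        n.factorial * Real.exp (-‖x‖ ^ 2) * ((1 + C) * (1 + ‖x‖) ^ l) ^ n := by
      refine norm_iteratedFDeriv_comp_le (N := ∞) Real.contDiff_exp (contDiff_norm_sq ℝ).neg
        (by exact_mod_cast le_top) x ?_ ?_
      · intro i _
        rw [norm_iteratedFDeriv_eq_norm_iteratedDeriv, iteratedDeriv_eq_iterate,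
          Real.iter_deriv_exp]
        simp
      · intro i hi hin
        have h2 : (1 : ℝ) ≤ (1 + C) * (1 + ‖x‖) ^ l := by
          have := one_le_pow₀ (n := l) (by linarith [norm_nonneg x] : (1 : ℝ) ≤ 1 + ‖x‖)
          nlinarith
        calc _ ≤ C * (1 + ‖x‖) ^ l := hl i hin x
          _ ≤ (1 + C) * (1 + ‖x‖) ^ l := by gcongr; linarith
          _ ≤ _ := le_self_pow₀ h2 (by omega)
    calc _ ≤ ‖x‖ ^ k * (n.factorial * Real.exp (-‖x‖ ^ 2) * ((1 + C) * (1 + ‖x‖) ^ l) ^ n) := by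
          gcongr; exact h1
      _ ≤ (1 + ‖x‖) ^ k * (n.factorial * Real.exp (-‖x‖ ^ 2) * ((1 + C) * (1 + ‖x‖) ^ l) ^ n) := by
          gcongr; linarith
      _ = n.factorial * (1 + C) ^ n * ((1 + ‖x‖) ^ (k + l * n) * Real.exp (-‖x‖ ^ 2)) := by
          rw [mul_pow, ← pow_mul, pow_add]; ring
      _ ≤ _ := by gcongr; exact hB _ (norm_nonneg x)

/-- The oscillating Gaussian `e^{-s|ξ|² + i x·ξ}`. -/
def waveGauss {d : ℕ} (x : Vec d) (s : ℝ) (ξ : Vec d) : ℂ :=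
  Complex.exp (-((s * ‖ξ‖ ^ 2 : ℝ) : ℂ) + Complex.I * ((inner ℝ x ξ : ℝ) : ℂ))

lemma norm_waveGauss {d : ℕ} (x : Vec d) (s : ℝ) (ξ : Vec d) :
    ‖waveGauss x s ξ‖ = Real.exp (-(s * ‖ξ‖ ^ 2)) := by
  rw [waveGauss, Complex.norm_exp]
  simp [-Complex.ofReal_pow]

lemma waveGauss_eq {d : ℕ} (x : Vec d) (s : ℝ) (ξ : Vec d) :
    waveGauss x s ξ = Real.exp (-‖ξ‖ ^ 2 * s) • waveGauss x 0 ξ := by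
  simp only [waveGauss, Complex.real_smul, Complex.ofReal_exp, ← Complex.exp_add]
  congr 1; push_cast; ring

lemma continuous_waveGauss {d : ℕ} :
    Continuous fun q : Vec d × ℝ × Vec d => waveGauss q.1 q.2.1 q.2.2 := by
  unfold waveGauss; fun_prop

/-- The Fourier-type integral `∫ e^{-s|ξ|² + i x·ξ} p(ξ) dξ` of a symbol `p` against a Gaussian. -/
def gaussianMoment {d : ℕ} (p : Vec d → ℝ) (s : ℝ) (x : Vec d) : ℂ :=
  ∫ ξ : Vec d, waveGauss x s ξ * (p ξ : ℂ)

lemma exists_schwartz_gaussian_mul {d : ℕ} {p : Vec d → ℝ} (hp : p.HasTemperateGrowth) :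
    ∃ f : 𝓢(Vec d, ℂ), ∀ ξ, f ξ = ((Real.exp (-‖ξ‖ ^ 2) * p ξ : ℝ) : ℂ) := by
  have hp' : Function.HasTemperateGrowth (fun ξ => ((p ξ : ℝ) : ℂ)) :=
    Function.Complex.hasTemperateGrowth_ofReal.comp hp
  refine ⟨SchwartzMap.bilinLeftCLM (ContinuousLinearMap.lsmul ℝ ℝ : ℝ →L[ℝ] ℂ →L[ℝ] ℂ) hp'
    (gaussianSchwartz d), fun ξ => ?_⟩
  rw [SchwartzMap.bilinLeftCLM_apply]
  change Real.exp (-‖ξ‖ ^ 2) • (p ξ : ℂ) = _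
  simp

lemma integrable_gaussian_mul {d : ℕ} {p : Vec d → ℝ} (hp : p.HasTemperateGrowth) :
    Integrable (fun ξ : Vec d => Real.exp (-‖ξ‖ ^ 2) * p ξ) := by
  obtain ⟨f, hf⟩ := exists_schwartz_gaussian_mul hp
  have := f.integrable (μ := volume)
  simp_rw [funext hf] at this
  exact this.re

/-- At `s = 1` the moment is the Fourier transform of a Schwartz function, hence decays rapidly. -/
lemma exists_norm_gaussianMoment_one_le {d : ℕ} {p : Vec d → ℝ} (hp : p.HasTemperateGrowth)
    (N : ℝ) : ∃ C, 0 ≤ C ∧ ∀ x, ‖gaussianMoment p 1 x‖ ≤ C * (1 + ‖x‖ ^ 2) ^ (-N) := by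
  obtain ⟨f, hf⟩ := exists_schwartz_gaussian_mul hp
  obtain ⟨k, hk⟩ := exists_nat_ge (2 * |N|)
  set B := 2 ^ k * ((Finset.Iic (k, 0)).sup fun m => SchwartzMap.seminorm ℝ m.1 m.2) (𝓕 f)
  have hB : ∀ y, (1 + ‖y‖) ^ k * ‖(𝓕 f) y‖ ≤ B := fun y => by
    simpa using SchwartzMap.one_add_le_sup_seminorm_apply (𝕜 := ℝ) (m := (k, 0)) le_rfl le_rfl (𝓕 f) y
  have hB0 : 0 ≤ B := le_trans (by positivity) (hB 0)
  refine ⟨B * (2 * Real.pi) ^ k, by positivity, fun x => ?_⟩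
  have key : gaussianMoment p 1 x = (𝓕 f) (-(2 * Real.pi)⁻¹ • x) := by
    rw [SchwartzMap.fourier_coe, Real.fourier_eq', gaussianMoment]
    refine integral_congr_ae (Filter.Eventually.of_forall fun ξ => ?_)
    simp only [waveGauss, hf, smul_eq_mul, inner_smul_right, Complex.ofReal_mul, Complex.ofReal_exp]
    rw [← mul_assoc, ← Complex.exp_add]
    congr 2
    rw [real_inner_comm]
    have : (Real.pi : ℂ) ≠ 0 := by exact_mod_cast Real.pi_ne_zero
    push_cast
    field_simp
    ring
  have h1 := hB (-(2 * Real.pi)⁻¹ • x)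
  rw [← key] at h1
  have hpi : 1 ≤ 2 * Real.pi := by linarith [Real.pi_gt_three]
  have h2 : (1 + ‖x‖ ^ 2) ^ N ≤ (2 * Real.pi) ^ k * (1 + ‖-(2 * Real.pi)⁻¹ • x‖) ^ k := by
    rw [← mul_pow, norm_smul, Real.norm_eq_abs, abs_neg, abs_of_pos (by positivity)]
    have h3 : 2 * Real.pi * (1 + (2 * Real.pi)⁻¹ * ‖x‖) = 2 * Real.pi + ‖x‖ := by
      field_simp
    rw [h3]
    calc (1 + ‖x‖ ^ 2) ^ N ≤ ((1 + ‖x‖) ^ 2) ^ |N| := by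
          calc _ ≤ (1 + ‖x‖ ^ 2) ^ |N| := by
                gcongr
                · nlinarith [sq_nonneg ‖x‖]
                · exact le_abs_self N
            _ ≤ _ := by gcongr; nlinarith [norm_nonneg x]
      _ = (1 + ‖x‖) ^ (2 * |N|) := by
          rw [← Real.rpow_natCast, ← Real.rpow_mul (by positivity)]; simp
      _ ≤ (1 + ‖x‖) ^ (k : ℝ) := by
          gcongr; linarith [norm_nonneg x]
      _ ≤ _ := by rw [Real.rpow_natCast]; gcongr
  rw [Real.rpow_neg (by positivity), ← div_eq_mul_inv, le_div_iff₀ (by positivity)]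
  calc _ ≤ ‖gaussianMoment p 1 x‖ * ((2 * Real.pi) ^ k * (1 + ‖-(2 * Real.pi)⁻¹ • x‖) ^ k) := by gcongr
    _ = ((1 + ‖-(2 * Real.pi)⁻¹ • x‖) ^ k * ‖gaussianMoment p 1 x‖) * (2 * Real.pi) ^ k := by ring
    _ ≤ _ := by gcongr

/-- Parabolic scaling for symbols homogeneous of degree `m`. -/
lemma gaussianMoment_scaling {d : ℕ} {p : Vec d → ℝ} {m : ℝ}
    (hm : ∀ r : ℝ, 0 < r → ∀ ξ, p (r • ξ) = r ^ m * p ξ) {s : ℝ} (hs : 0 < s) (x : Vec d) :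
    gaussianMoment p s x = ((s ^ (-((d + m) / 2)) : ℝ) : ℂ) * gaussianMoment p 1 ((√s)⁻¹ • x) := by
  have hs' : 0 < √s := Real.sqrt_pos.2 hs
  have h1 := Measure.integral_comp_smul (volume : Measure (Vec d)) (fun ξ : Vec d =>
    waveGauss ((√s)⁻¹ • x) 1 ξ * (p ξ : ℂ)) (√s)
  have h2 : ∀ ξ : Vec d, waveGauss ((√s)⁻¹ • x) 1 (√s • ξ) * (p (√s • ξ) : ℂ) =
      ((√s ^ m : ℝ) : ℂ) * (waveGauss x s ξ * (p ξ : ℂ)) := by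
    intro ξ
    rw [waveGauss, waveGauss, hm _ hs', inner_smul_left, inner_smul_right, norm_smul,
      Real.norm_of_nonneg hs'.le, mul_pow,
      Real.sq_sqrt hs.le, ← mul_assoc (starRingEnd ℝ _)]
    simp only [conj_trivial, inv_mul_cancel₀ hs'.ne', one_mul]
    push_cast; ring
  simp_rw [h2] at h1
  rw [integral_const_mul] at h1
  have h3 : (√s ^ m)⁻¹ * |(√s ^ Module.finrank ℝ (Vec d))⁻¹| = s ^ (-((d + m) / 2)) := by
    rw [abs_of_pos (by positivity), finrank_euclideanSpace_fin, ← Real.rpow_natCast,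
      Real.sqrt_eq_rpow, ← Real.rpow_mul hs.le, ← Real.rpow_mul hs.le, ← Real.rpow_neg hs.le,
      ← Real.rpow_neg hs.le, ← Real.rpow_add hs]
    congr 1; ring
  rw [← h3]
  have h4 : ((√s ^ m : ℝ) : ℂ) ≠ 0 := by
    exact_mod_cast (Real.rpow_pos_of_pos hs' m).ne'
  rw [gaussianMoment, gaussianMoment, ← mul_right_inj' h4, h1, Complex.real_smul]
  push_cast
  field_simp

lemma exists_norm_gaussianMoment_le {d : ℕ} {p : Vec d → ℝ} (hp : p.HasTemperateGrowth) {m : ℝ}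
    (hm : ∀ r : ℝ, 0 < r → ∀ ξ, p (r • ξ) = r ^ m * p ξ) :
    ∃ C, 0 ≤ C ∧ ∀ s > 0, ∀ x, ‖gaussianMoment p s x‖ ≤ C * (s + ‖x‖ ^ 2) ^ (-((d + m) / 2)) := by
  obtain ⟨C, hC, h⟩ := exists_norm_gaussianMoment_one_le hp ((d + m) / 2)
  refine ⟨C, hC, fun s hs x => ?_⟩
  rw [gaussianMoment_scaling hm hs, norm_mul, Complex.norm_real, Real.norm_of_nonneg (by positivity)]
  calc _ ≤ s ^ (-((d + m) / 2)) * (C * (1 + ‖(√s)⁻¹ • x‖ ^ 2) ^ (-((d + m) / 2))) := by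
        gcongr; exact h _
    _ = C * (s ^ (-((d + m) / 2)) * (1 + ‖(√s)⁻¹ • x‖ ^ 2) ^ (-((d + m) / 2))) := by ring
    _ = _ := by
        rw [← Real.mul_rpow hs.le (by positivity), norm_smul, mul_pow, norm_inv,
          Real.norm_of_nonneg (Real.sqrt_nonneg s), inv_pow, Real.sq_sqrt hs.le]
        congr 2
        field_simp

/-! ### Pointwise decay of the Oseen kernel -/

lemma integrable_exp_neg_mul {d : ℕ} {p : Vec d → ℝ} (hp : p.HasTemperateGrowth) {m : ℝ}
    (hm : ∀ r : ℝ, 0 < r → ∀ ξ, p (r • ξ) = r ^ m * p ξ) {s : ℝ} (hs : 0 < s) :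
    Integrable (fun ξ : Vec d => Real.exp (-(s * ‖ξ‖ ^ 2)) * p ξ) := by
  have hs' : 0 < √s := Real.sqrt_pos.2 hs
  have h := ((integrable_gaussian_mul hp).comp_smul hs'.ne').const_mul ((√s ^ m)⁻¹)
  refine h.congr (Filter.Eventually.of_forall fun ξ => ?_)
  have : √s ^ m ≠ 0 := (Real.rpow_pos_of_pos hs' m).ne'
  simp only [norm_smul, Real.norm_of_nonneg hs'.le, mul_pow, Real.sq_sqrt hs.le, hm _ hs']
  field_simp

lemma integrable_waveGauss_mul {d : ℕ} {p : Vec d → ℝ} (hp : p.HasTemperateGrowth) {m : ℝ}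
    (hm : ∀ r : ℝ, 0 < r → ∀ ξ, p (r • ξ) = r ^ m * p ξ) {s : ℝ} (hs : 0 < s) (x : Vec d) :
    Integrable (fun ξ : Vec d => waveGauss x s ξ * (p ξ : ℂ)) := by
  have hc : Continuous fun ξ : Vec d => waveGauss x s ξ :=
    continuous_waveGauss.comp (f := fun ξ => (x, s, ξ)) (by fun_prop)
  refine (integrable_exp_neg_mul hp hm hs).mono ?_ (Filter.Eventually.of_forall fun ξ => ?_)
  · exact (hc.mul (Complex.continuous_ofReal.comp hp.1.continuous)).aestronglyMeasurable
  · rw [norm_mul, norm_mul, norm_waveGauss, Complex.norm_real, Real.norm_of_nonneg (Real.exp_nonneg _)]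

lemma temperate_coord {d : ℕ} (k : Fin d) : Function.HasTemperateGrowth (fun ξ : Vec d => ξ k) :=
  (EuclideanSpace.proj k : Vec d →L[ℝ] ℝ).hasTemperateGrowth

lemma coord_le_norm {d : ℕ} (k : Fin d) (ξ : Vec d) : |ξ k| ≤ ‖ξ‖ := by
  simpa using PiLp.norm_apply_le ξ k

lemma abs_cubic_div_sq_le {d : ℕ} (j h k : Fin d) (ξ : Vec d) :
    |ξ j * ξ h * ξ k| / ‖ξ‖ ^ 2 ≤ |ξ k| := by
  rcases eq_or_ne ξ 0 with rfl | h0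
  · simp
  · have : 0 < ‖ξ‖ := norm_pos_iff.2 h0
    rw [div_le_iff₀ (by positivity), abs_mul, abs_mul, mul_comm, sq]
    gcongr <;> exact coord_le_norm _ _

/-- The singular symbol `ξ_j ξ_h ξ_k / |ξ|²` is resolved by `|ξ|⁻² e^{-t|ξ|²} = ∫_t^∞ e^{-s|ξ|²} ds`. -/
lemma integral_waveGauss_cubic {d : ℕ} (j h k : Fin d) {t : ℝ} (ht : 0 < t) (x : Vec d) :
    Integrable (fun ξ : Vec d => waveGauss x t ξ * ((ξ j * ξ h * ξ k / ‖ξ‖ ^ 2 : ℝ) : ℂ)) ∧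
    ∫ ξ : Vec d, waveGauss x t ξ * ((ξ j * ξ h * ξ k / ‖ξ‖ ^ 2 : ℝ) : ℂ) =
      ∫ s in Set.Ioi t, gaussianMoment (fun ξ : Vec d => ξ j * ξ h * ξ k) s x := by
  set p : Vec d → ℝ := fun ξ => ξ j * ξ h * ξ k with hpdef
  have hp : p.HasTemperateGrowth := ((temperate_coord j).mul (temperate_coord h)).mul (temperate_coord k)
  have hm : ∀ r : ℝ, 0 < r → ∀ ξ, p (r • ξ) = r ^ (3 : ℝ) * p ξ := by
    intro r _ ξ
    have h3 : r ^ (3 : ℝ) = r ^ 3 := by exact_mod_cast Real.rpow_natCast r 3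
    simp only [hpdef, h3, PiLp.smul_apply, smul_eq_mul]; ring
  have hcoord : Integrable (fun ξ : Vec d => Real.exp (-(t * ‖ξ‖ ^ 2)) * ξ k) :=
    integrable_exp_neg_mul (temperate_coord k) (m := 1) (by simp) ht
  have hpc : Continuous p := hp.1.continuous
  have hwx : Continuous fun q : ℝ × Vec d => waveGauss x q.1 q.2 :=
    continuous_waveGauss.comp (f := fun q : ℝ × Vec d => (x, q.1, q.2)) (by fun_prop)
  have hbound : ∀ ξ : Vec d, Real.exp (-(t * ‖ξ‖ ^ 2)) * (|p ξ| / ‖ξ‖ ^ 2) ≤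
      ‖Real.exp (-(t * ‖ξ‖ ^ 2)) * ξ k‖ := fun ξ => by
    rw [norm_mul, Real.norm_of_nonneg (Real.exp_nonneg _)]
    gcongr
    exact abs_cubic_div_sq_le j h k ξ
  have hexp : ∀ ξ : Vec d, ξ ≠ 0 → IntegrableOn (fun s => Real.exp (-‖ξ‖ ^ 2 * s)) (Set.Ioi t) ∧
      ∫ s in Set.Ioi t, Real.exp (-‖ξ‖ ^ 2 * s) = Real.exp (-(t * ‖ξ‖ ^ 2)) / ‖ξ‖ ^ 2 := by
    intro ξ hξ
    have hn : -‖ξ‖ ^ 2 < 0 := by have := norm_pos_iff.2 hξ; nlinarith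
    refine ⟨integrableOn_exp_mul_Ioi hn t, ?_⟩
    rw [integral_exp_mul_Ioi hn, neg_div_neg_eq]
    congr 2; ring
  have hzero : p 0 = 0 := by simp [hpdef]
  have hprod : Integrable (fun q : ℝ × Vec d => waveGauss x q.1 q.2 * (p q.2 : ℂ))
      ((volume.restrict (Set.Ioi t)).prod volume) := by
    have hmeas : AEStronglyMeasurable (fun q : ℝ × Vec d => waveGauss x q.1 q.2 * (p q.2 : ℂ))
      ((volume.restrict (Set.Ioi t)).prod volume) :=
      (hwx.mul (Complex.continuous_ofReal.comp (hpc.comp continuous_snd))).aestronglyMeasurable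
    rw [integrable_prod_iff' hmeas]
    have hnorm : ∀ ξ : Vec d, (fun s => ‖waveGauss x s ξ * (p ξ : ℂ)‖) =
        fun s => Real.exp (-‖ξ‖ ^ 2 * s) * |p ξ| := fun ξ => by
      ext s
      rw [norm_mul, norm_waveGauss, Complex.norm_real, Real.norm_eq_abs]; congr 2; ring
    refine ⟨Filter.Eventually.of_forall fun ξ => ?_, ?_⟩
    · rcases eq_or_ne ξ 0 with rfl | h0
      · simp [hzero]
      · have := (hexp ξ h0).1.mul_const |p ξ|
        rw [← hnorm ξ] at this
        refine (integrable_norm_iff ?_).1 this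
        have hc : Continuous fun s : ℝ => waveGauss x s ξ * (p ξ : ℂ) :=
          (hwx.comp (f := fun s => (s, ξ)) (by fun_prop)).mul continuous_const
        exact hc.aestronglyMeasurable
    · refine hcoord.mono hmeas.norm.prod_swap.integral_prod_right'
        (Filter.Eventually.of_forall fun ξ => ?_)
      refine le_trans ?_ (hbound ξ)
      simp only [hnorm]
      rw [integral_mul_const]
      rcases eq_or_ne ξ 0 with rfl | h0
      · simp [hzero]
      · rw [(hexp ξ h0).2, Real.norm_of_nonneg (by positivity)]
        exact le_of_eq (by ring)
  constructor
  · refine hcoord.mono ?_ (Filter.Eventually.of_forall fun ξ => ?_)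
    · refine Measurable.aestronglyMeasurable ?_
      refine ((hwx.comp (f := fun ξ => (t, ξ)) (by fun_prop)).measurable).mul ?_
      exact Complex.measurable_ofReal.comp (hpc.measurable.div (by fun_prop))
    · refine le_trans (le_of_eq ?_) (hbound ξ)
      rw [norm_mul, norm_waveGauss, Complex.norm_real, Real.norm_eq_abs, abs_div,
        abs_of_nonneg (sq_nonneg ‖ξ‖)]
  · calc _ = ∫ ξ : Vec d, ∫ s in Set.Ioi t, waveGauss x s ξ * (p ξ : ℂ) := by
          refine integral_congr_ae (Filter.Eventually.of_forall fun ξ => ?_)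
          have e : ∀ s, waveGauss x s ξ * (p ξ : ℂ) =
              Real.exp (-‖ξ‖ ^ 2 * s) • (waveGauss x 0 ξ * (p ξ : ℂ)) := fun s => by
            rw [waveGauss_eq, smul_mul_assoc]
          simp only
          rw [integral_congr_ae (Filter.Eventually.of_forall e), integral_smul_const,
            waveGauss_eq x t ξ]
          rcases eq_or_ne ξ 0 with rfl | h0
          · simp [hzero]
          · rw [(hexp ξ h0).2]
            simp only [Complex.real_smul]
            push_cast
            rw [show -(t * (‖ξ‖ : ℂ) ^ 2) = -(‖ξ‖ : ℂ) ^ 2 * t by ring]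
            simp only [hpdef]; push_cast
            ring
      _ = ∫ s in Set.Ioi t, ∫ ξ : Vec d, waveGauss x s ξ * (p ξ : ℂ) :=
          (integral_integral_swap hprod).symm
      _ = _ := rfl

/-- Pointwise decay of the Oseen kernel. -/
theorem exists_abs_oseenKernel_le {d : ℕ} (j h k : Fin d) :
    ∃ C, 0 ≤ C ∧ ∀ t > 0, ∀ x, |oseenKernel j h k t x| ≤ C * (t + ‖x‖ ^ 2) ^ (-(((d : ℝ) + 1) / 2)) := by
  have hlin : ∀ l : Fin d, ∀ r : ℝ, 0 < r → ∀ ξ : Vec d, (r • ξ) l = r ^ (1 : ℝ) * ξ l := by simp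
  have hp : Function.HasTemperateGrowth (fun ξ : Vec d => ξ j * ξ h * ξ k) :=
    ((temperate_coord j).mul (temperate_coord h)).mul (temperate_coord k)
  have hm : ∀ r : ℝ, 0 < r → ∀ ξ : Vec d,
      (r • ξ) j * (r • ξ) h * (r • ξ) k = r ^ (3 : ℝ) * (ξ j * ξ h * ξ k) := by
    intro r _ ξ
    have h3 : r ^ (3 : ℝ) = r ^ 3 := by exact_mod_cast Real.rpow_natCast r 3
    simp only [h3, PiLp.smul_apply, smul_eq_mul]; ring
  obtain ⟨C₁, hC₁, h₁⟩ := exists_norm_gaussianMoment_le (temperate_coord h) (hlin h)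
  obtain ⟨C₂, hC₂, h₂⟩ := exists_norm_gaussianMoment_le (temperate_coord k) (hlin k)
  obtain ⟨C₃, hC₃, h₃⟩ := exists_norm_gaussianMoment_le hp hm
  refine ⟨((2 * Real.pi) ^ d)⁻¹ * (C₁ + C₂ + C₃ * (2 / (d + 1))), by positivity, fun t ht x => ?_⟩
  have hkron : ∀ a b : Fin d, |kron a b / 2| ≤ 1 := fun a b => by
    unfold kron; split_ifs <;> norm_num
  set K := (t + ‖x‖ ^ 2) ^ (-(((d : ℝ) + 1) / 2)) with hK
  have hK0 : 0 ≤ K := by positivity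
  obtain ⟨hi3, he3⟩ := integral_waveGauss_cubic j h k ht x
  have hi1 := integrable_waveGauss_mul (temperate_coord h) (hlin h) ht x
  have hi2 := integrable_waveGauss_mul (temperate_coord k) (hlin k) ht x
  have hbd3 : ‖∫ s in Set.Ioi t, gaussianMoment (fun ξ : Vec d => ξ j * ξ h * ξ k) s x‖ ≤
      C₃ * (2 / (d + 1)) * K := by
    have hlt : -(((d : ℝ) + 3) / 2) < -1 := by
      have : (0 : ℝ) ≤ d := by positivity
      linarith
    have hcm : -‖x‖ ^ 2 < t := by nlinarith [sq_nonneg ‖x‖]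
    have hint : IntegrableOn (fun s : ℝ => C₃ * (s + ‖x‖ ^ 2) ^ (-(((d : ℝ) + 3) / 2))) (Set.Ioi t) :=
      (integrableOn_add_rpow_Ioi_of_lt hlt hcm).const_mul _
    refine (norm_integral_le_of_norm_le hint ?_).trans (le_of_eq ?_)
    · filter_upwards [ae_restrict_mem measurableSet_Ioi] with s hs
      exact h₃ s (ht.trans hs) x
    · rw [integral_const_mul]
      have := (measurePreserving_add_right volume (‖x‖ ^ 2)).setIntegral_preimage_emb
        (measurableEmbedding_addRight _) (fun s : ℝ => s ^ (-(((d : ℝ) + 3) / 2)))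
        (Set.Ioi (t + ‖x‖ ^ 2))
      simp only [Set.preimage_add_const_Ioi, add_sub_cancel_right] at this
      rw [this, integral_Ioi_rpow_of_lt hlt (by positivity), hK,
        show -(((d : ℝ) + 3) / 2) + 1 = -((d + 1) / 2) by ring]
      have : (d : ℝ) + 1 ≠ 0 := by positivity
      field_simp
  have hsplit : (∫ ξ : Vec d, Complex.I *
      Complex.exp (-((t * ‖ξ‖ ^ 2 : ℝ) : ℂ) + Complex.I * ((inner ℝ x ξ : ℝ) : ℂ)) *
      (((ξ h * kron j k + ξ k * kron j h) / 2 - ξ j * ξ h * ξ k / ‖ξ‖ ^ 2 : ℝ) : ℂ)) =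
      Complex.I * (((kron j k / 2 : ℝ) : ℂ) * gaussianMoment (fun ξ : Vec d => ξ h) t x +
        ((kron j h / 2 : ℝ) : ℂ) * gaussianMoment (fun ξ : Vec d => ξ k) t x -
        ∫ s in Set.Ioi t, gaussianMoment (fun ξ : Vec d => ξ j * ξ h * ξ k) s x) := by
    rw [← he3, gaussianMoment, gaussianMoment, ← integral_const_mul, ← integral_const_mul]
    have hadd : Integrable fun ξ : Vec d =>
        ((kron j k / 2 : ℝ) : ℂ) * (waveGauss x t ξ * (ξ h : ℂ)) +
          ((kron j h / 2 : ℝ) : ℂ) * (waveGauss x t ξ * (ξ k : ℂ)) :=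
      (hi1.const_mul _).add (hi2.const_mul _)
    rw [← integral_add (hi1.const_mul _) (hi2.const_mul _), ← integral_sub hadd hi3, ← integral_const_mul]
    refine integral_congr_ae (Filter.Eventually.of_forall fun ξ => ?_)
    simp only [waveGauss]
    push_cast
    ring
  rw [oseenKernel, hsplit, abs_mul, abs_of_nonneg (by positivity), mul_assoc]
  gcongr
  refine (Complex.abs_re_le_norm _).trans ?_
  rw [norm_mul, Complex.norm_I, one_mul]
  refine (norm_sub_le _ _).trans ?_
  rw [add_mul]
  refine add_le_add ((norm_add_le _ _).trans ?_) hbd3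
  rw [add_mul]
  refine add_le_add ?_ ?_ <;> rw [norm_mul, Complex.norm_real, Real.norm_eq_abs]
  · calc _ ≤ 1 * (C₁ * K) := by gcongr; exacts [hkron _ _, h₁ t ht x]
      _ = _ := one_mul _
  · calc _ ≤ 1 * (C₂ * K) := by gcongr; exacts [hkron _ _, h₂ t ht x]
      _ = _ := one_mul _

lemma measurable_oseenKernel {d : ℕ} (j h k : Fin d) :
    Measurable fun q : ℝ × Vec d => oseenKernel j h k q.1 q.2 := by
  unfold oseenKernel
  refine Measurable.const_mul (Complex.measurable_re.comp ?_) _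
  have hm : Measurable (fun z : (ℝ × Vec d) × Vec d => Complex.I *
      Complex.exp (-((z.1.1 * ‖z.2‖ ^ 2 : ℝ) : ℂ) + Complex.I * ((inner ℝ z.1.2 z.2 : ℝ) : ℂ)) *
      (((z.2 h * kron j k + z.2 k * kron j h) / 2 - z.2 j * z.2 h * z.2 k / ‖z.2‖ ^ 2 : ℝ) : ℂ)) := by
    have h1 : Continuous fun z : (ℝ × Vec d) × Vec d => Complex.I *
      Complex.exp (-((z.1.1 * ‖z.2‖ ^ 2 : ℝ) : ℂ) + Complex.I * ((inner ℝ z.1.2 z.2 : ℝ) : ℂ)) := by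
      fun_prop
    refine h1.measurable.mul (Complex.measurable_ofReal.comp ?_)
    have h2 : ∀ l : Fin d, Measurable fun z : (ℝ × Vec d) × Vec d => z.2 l := fun l => by fun_prop
    have h3 : Measurable fun z : (ℝ × Vec d) × Vec d => ‖z.2‖ ^ 2 := by fun_prop
    exact ((((h2 h).mul_const _).add ((h2 k).mul_const _)).div_const _).sub
      ((((h2 j).mul (h2 h)).mul (h2 k)).div h3)
  exact (hm.stronglyMeasurable.integral_prod_right' (ν := (volume : Measure (Vec d)))).measurable

/-! ### Weighted bounds for the Oseen kernel -/

/-- The weight `(1 + |x|)^{-ϑ}`. -/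
def wt {d : ℕ} (ϑ : ℝ) (x : Vec d) : ℝ := (1 + ‖x‖) ^ (-ϑ)

lemma wt_pos {d : ℕ} (ϑ : ℝ) (x : Vec d) : 0 < wt ϑ x := by unfold wt; positivity

lemma wt_le_one {d : ℕ} {ϑ : ℝ} (hϑ : 0 ≤ ϑ) (x : Vec d) : wt ϑ x ≤ 1 :=
  Real.rpow_le_one_of_one_le_of_nonpos (by linarith [norm_nonneg x]) (by linarith)

lemma measurable_wt {d : ℕ} (ϑ : ℝ) : Measurable (wt ϑ : Vec d → ℝ) := by
  unfold wt; fun_prop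

lemma continuous_wt {d : ℕ} (ϑ : ℝ) : Continuous (wt ϑ : Vec d → ℝ) := by
  unfold wt
  exact (continuous_const.add continuous_norm).rpow_const fun x =>
    Or.inl (by linarith [norm_nonneg x] : (0 : ℝ) < 1 + ‖x‖).ne'

lemma weight_mul_le_iff {d : ℕ} {ϑ : ℝ} {x : Vec d} {r C : ℝ} :
    (1 + ‖x‖) ^ ϑ * r ≤ C ↔ r ≤ C * wt ϑ x := by
  rw [wt, Real.rpow_neg (by positivity), ← div_eq_mul_inv, le_div_iff₀ (by positivity), mul_comm]

/-- Peetre's inequality for the weight. -/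
lemma wt_add_le {d : ℕ} {ϑ : ℝ} (hϑ : 0 ≤ ϑ) (x v : Vec d) :
    wt ϑ (x + v) ≤ (1 + ‖v‖) ^ ϑ * wt ϑ x := by
  unfold wt
  rw [Real.rpow_neg (by positivity), Real.rpow_neg (by positivity), ← div_eq_mul_inv,
    le_div_iff₀ (by positivity), ← div_eq_inv_mul, div_le_iff₀ (by positivity),
    ← Real.mul_rpow (by positivity) (by positivity)]
  refine Real.rpow_le_rpow (by positivity) ?_ hϑ
  have h1 : ‖x‖ ≤ ‖x + v‖ + ‖v‖ := by
    calc ‖x‖ = ‖(x + v) - v‖ := by simp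
      _ ≤ _ := norm_sub_le _ _
  nlinarith [norm_nonneg v, norm_nonneg (x + v)]

/-- The majorant `(t + |x|²)^{-(d+1)/2}` of the Oseen kernel. -/
def oseenMajorant {d : ℕ} (t : ℝ) (x : Vec d) : ℝ := (t + ‖x‖ ^ 2) ^ (-(((d : ℝ) + 1) / 2))

lemma oseenMajorant_scaling {d : ℕ} {t : ℝ} (ht : 0 < t) (x : Vec d) :
    oseenMajorant t (√t • x) = t ^ (-(((d : ℝ) + 1) / 2)) * oseenMajorant 1 x := by
  unfold oseenMajorant
  rw [norm_smul, mul_pow, Real.norm_of_nonneg (Real.sqrt_nonneg t), Real.sq_sqrt ht.le,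
    ← Real.mul_rpow ht.le (by positivity)]
  congr 1; ring

lemma integrable_oseenMajorant_one {d : ℕ} : Integrable (oseenMajorant 1 : Vec d → ℝ) := by
  have := integrable_rpow_neg_one_add_norm_sq (E := Vec d) (μ := volume) (r := d + 1) (by simp)
  refine this.congr (Filter.Eventually.of_forall fun x => ?_)
  simp only [oseenMajorant, neg_div]

lemma integrable_oseenMajorant {d : ℕ} {t : ℝ} (ht : 0 < t) :
    Integrable (oseenMajorant t : Vec d → ℝ) := by
  rw [← integrable_comp_smul_iff volume _ (Real.sqrt_pos.2 ht).ne']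
  simp_rw [oseenMajorant_scaling ht]
  exact integrable_oseenMajorant_one.const_mul _

lemma integral_oseenMajorant {d : ℕ} {t : ℝ} (ht : 0 < t) :
    ∫ x : Vec d, oseenMajorant t x = t ^ (-(1 / 2) : ℝ) * ∫ x : Vec d, oseenMajorant 1 x := by
  have hs := Real.sqrt_pos.2 ht
  have h := Measure.integral_comp_smul (volume : Measure (Vec d)) (oseenMajorant t) √t
  simp_rw [oseenMajorant_scaling ht] at h
  rw [integral_const_mul, finrank_euclideanSpace_fin, abs_of_pos (by positivity), smul_eq_mul,
    inv_mul_eq_div, eq_div_iff (by positivity)] at h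
  rw [← h, ← Real.rpow_natCast, Real.sqrt_eq_rpow, ← Real.rpow_mul ht.le, mul_right_comm,
    ← Real.rpow_add ht]
  congr 2; ring

lemma oseenMajorant_nonneg {d : ℕ} {t : ℝ} (ht : 0 < t) (x : Vec d) : 0 ≤ oseenMajorant t x := by
  unfold oseenMajorant; positivity

lemma integrable_oseenMajorant_sub {d : ℕ} {t : ℝ} (ht : 0 < t) (x : Vec d) :
    Integrable fun y : Vec d => oseenMajorant t (x - y) :=
  (integrable_oseenMajorant ht).comp_sub_left x

/-- The squared weight gains enough decay to survive convolution with the Oseen kernel: either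
`|x - y| ≤ 1 + |y|` and the weights at `x` and `y` are comparable, or the decay `|x - y|^{-(d+1)}` of
the kernel pays for the weight at `x`. This is where `ϑ ≤ d + 1` enters. -/
lemma oseenMajorant_mul_wt_sq_le {d : ℕ} {ϑ : ℝ} (hϑ₀ : 0 ≤ ϑ) (hϑ₁ : ϑ ≤ (d : ℝ) + 1) {t : ℝ}
    (ht : 0 < t) (x y : Vec d) :
    oseenMajorant t (x - y) * wt ϑ y ^ 2 ≤
      2 ^ ϑ * (oseenMajorant t (x - y) + (1 + ‖y‖) ^ (-((d : ℝ) + 1))) * wt ϑ x := by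
  have hx : ‖x‖ ≤ ‖x - y‖ + ‖y‖ := by
    calc ‖x‖ = ‖(x - y) + y‖ := by simp
      _ ≤ _ := norm_add_le _ _
  have hK := oseenMajorant_nonneg ht (x - y)
  have hY : (1 : ℝ) ≤ 1 + ‖y‖ := by linarith [norm_nonneg y]
  rw [← weight_mul_le_iff]
  have hw : wt ϑ y ^ 2 = (1 + ‖y‖) ^ (-ϑ) * (1 + ‖y‖) ^ (-ϑ) := by rw [wt, sq]
  have hw1 : wt ϑ y ≤ 1 := wt_le_one hϑ₀ y
  have hY0 : 0 ≤ (1 + ‖y‖) ^ (-((d : ℝ) + 1)) := by positivity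
  rcases le_total ‖x - y‖ (1 + ‖y‖) with hle | hle
  · have h1 : (1 + ‖x‖) ^ ϑ ≤ 2 ^ ϑ * (1 + ‖y‖) ^ ϑ := by
      rw [← Real.mul_rpow (by norm_num) (by positivity)]
      exact Real.rpow_le_rpow (by positivity) (by linarith) hϑ₀
    calc (1 + ‖x‖) ^ ϑ * (oseenMajorant t (x - y) * wt ϑ y ^ 2)
        ≤ (2 ^ ϑ * (1 + ‖y‖) ^ ϑ) * (oseenMajorant t (x - y) * wt ϑ y ^ 2) := by gcongr
      _ = 2 ^ ϑ * oseenMajorant t (x - y) * (((1 + ‖y‖) ^ ϑ * (1 + ‖y‖) ^ (-ϑ)) * wt ϑ y) := by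
          rw [sq]; simp only [wt]; ring
      _ = 2 ^ ϑ * oseenMajorant t (x - y) * wt ϑ y := by
          rw [← Real.rpow_add (by positivity)]; simp
      _ ≤ 2 ^ ϑ * oseenMajorant t (x - y) * 1 := by gcongr
      _ ≤ _ := by rw [mul_one]; gcongr; linarith
  · have hz : 0 < ‖x - y‖ := by linarith
    have h1 : (1 + ‖x‖) ^ ϑ ≤ 2 ^ ϑ * ‖x - y‖ ^ ϑ := by
      rw [← Real.mul_rpow (by norm_num) (by positivity)]
      exact Real.rpow_le_rpow (by positivity) (by linarith) hϑ₀
    have h2 : oseenMajorant t (x - y) ≤ ‖x - y‖ ^ (-((d : ℝ) + 1)) := by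
      calc _ ≤ (‖x - y‖ ^ 2) ^ (-(((d : ℝ) + 1) / 2)) := by
            unfold oseenMajorant
            have : (0 : ℝ) ≤ d := by positivity
            exact Real.rpow_le_rpow_of_nonpos (by positivity) (by linarith) (by linarith)
        _ = _ := by
            rw [← Real.rpow_natCast, ← Real.rpow_mul hz.le]; congr 1; push_cast; ring
    calc (1 + ‖x‖) ^ ϑ * (oseenMajorant t (x - y) * wt ϑ y ^ 2)
        ≤ (2 ^ ϑ * ‖x - y‖ ^ ϑ) * (‖x - y‖ ^ (-((d : ℝ) + 1)) * wt ϑ y ^ 2) := by gcongr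
      _ = 2 ^ ϑ * ‖x - y‖ ^ (ϑ - (d + 1)) * wt ϑ y ^ 2 := by
          rw [show ϑ - ((d : ℝ) + 1) = ϑ + -((d : ℝ) + 1) by ring, Real.rpow_add hz]; ring
      _ ≤ 2 ^ ϑ * (1 + ‖y‖) ^ (ϑ - (d + 1)) * wt ϑ y ^ 2 := by
          gcongr 2 ^ ϑ * ?_ * wt ϑ y ^ 2
          exact Real.rpow_le_rpow_of_nonpos (by positivity) hle (by linarith)
      _ = 2 ^ ϑ * ((1 + ‖y‖) ^ (-((d : ℝ) + 1)) * ((1 + ‖y‖) ^ ϑ * (1 + ‖y‖) ^ (-ϑ)) * wt ϑ y) := by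
          rw [show ϑ - ((d : ℝ) + 1) = ϑ + -((d : ℝ) + 1) by ring, Real.rpow_add (by positivity), sq]
          simp only [wt]; ring
      _ = 2 ^ ϑ * ((1 + ‖y‖) ^ (-((d : ℝ) + 1)) * wt ϑ y) := by
          rw [← Real.rpow_add (by positivity) ϑ]; simp
      _ ≤ 2 ^ ϑ * ((1 + ‖y‖) ^ (-((d : ℝ) + 1)) * 1) := by gcongr
      _ ≤ _ := by rw [mul_one]; gcongr; linarith

lemma exists_integral_oseenMajorant_mul_wt_sq_le {d : ℕ} {ϑ : ℝ} (hϑ₀ : 0 ≤ ϑ)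
    (hϑ₁ : ϑ ≤ (d : ℝ) + 1) (T : ℝ) :
    ∃ C, 0 ≤ C ∧ ∀ t, 0 < t → t ≤ T → ∀ x : Vec d,
      ∫ y, oseenMajorant t (x - y) * wt ϑ y ^ 2 ≤ C * t ^ (-(1 / 2) : ℝ) * wt ϑ x := by
  have hJ : Integrable fun y : Vec d => (1 + ‖y‖) ^ (-((d : ℝ) + 1)) :=
    integrable_one_add_norm (by simp)
  set A := ∫ x : Vec d, oseenMajorant 1 x
  set B := ∫ y : Vec d, (1 + ‖y‖) ^ (-((d : ℝ) + 1))
  have hA : 0 ≤ A := integral_nonneg fun x => oseenMajorant_nonneg one_pos x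
  have hB : 0 ≤ B := integral_nonneg fun y => by positivity
  refine ⟨2 ^ ϑ * (A + B * √T), by positivity, fun t ht htT x => ?_⟩
  have hi := integrable_oseenMajorant_sub ht x
  calc ∫ y, oseenMajorant t (x - y) * wt ϑ y ^ 2
      ≤ ∫ y, 2 ^ ϑ * (oseenMajorant t (x - y) + (1 + ‖y‖) ^ (-((d : ℝ) + 1))) * wt ϑ x := by
        refine integral_mono_of_nonneg (Filter.Eventually.of_forall fun y => ?_)
          (((hi.add hJ).const_mul _).mul_const _)
          (Filter.Eventually.of_forall fun y => oseenMajorant_mul_wt_sq_le hϑ₀ hϑ₁ ht x y)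
        exact mul_nonneg (oseenMajorant_nonneg ht _) (sq_nonneg _)
    _ = 2 ^ ϑ * (t ^ (-(1 / 2) : ℝ) * A + B) * wt ϑ x := by
        rw [integral_mul_const, integral_const_mul, integral_add hi hJ,
          integral_sub_left_eq_self (oseenMajorant t) volume x, integral_oseenMajorant ht]
    _ ≤ 2 ^ ϑ * (A + B * √T) * t ^ (-(1 / 2) : ℝ) * wt ϑ x := by
        have h1 : 1 ≤ √T * t ^ (-(1 / 2) : ℝ) := by
          rw [Real.rpow_neg ht.le, ← Real.sqrt_eq_rpow, ← div_eq_mul_inv,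
            one_le_div (Real.sqrt_pos.2 ht)]
          exact Real.sqrt_le_sqrt htT
        have h2 : t ^ (-(1 / 2) : ℝ) * A + B ≤ (A + B * √T) * t ^ (-(1 / 2) : ℝ) := by
          nlinarith
        have := (wt_pos ϑ x).le
        rw [mul_assoc (2 ^ ϑ) (A + B * √T)]
        exact mul_le_mul_of_nonneg_right (mul_le_mul_of_nonneg_left h2 (by positivity)) this

lemma integrable_oseenMajorant_mul_wt_sq {d : ℕ} {ϑ : ℝ} (hϑ₀ : 0 ≤ ϑ) {t : ℝ} (ht : 0 < t)
    (x : Vec d) : Integrable fun y => oseenMajorant t (x - y) * wt ϑ y ^ 2 := by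
  refine (integrable_oseenMajorant_sub ht x).mul_bdd (c := 1)
    ((measurable_wt ϑ).pow_const 2).aestronglyMeasurable (Filter.Eventually.of_forall fun y => ?_)
  rw [Real.norm_of_nonneg (sq_nonneg _)]
  exact pow_le_one₀ (wt_pos ϑ y).le (wt_le_one hϑ₀ y)

/-- Convolution with the Oseen kernel at time `t` maps `L^∞_{2ϑ}` to `L^∞_ϑ` with norm
`O(t^{-1/2})`. -/
theorem exists_abs_integral_oseenKernel_mul_le {d : ℕ} {ϑ : ℝ} (hϑ₀ : 0 ≤ ϑ)
    (hϑ₁ : ϑ ≤ (d : ℝ) + 1) (T : ℝ) :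
    ∃ C, 0 ≤ C ∧ ∀ j h k : Fin d, ∀ t, 0 < t → t ≤ T → ∀ (x : Vec d) (g : Vec d → ℝ) (m : ℝ),
      (∀ᵐ y, |g y| ≤ m * wt ϑ y ^ 2) →
      |∫ y, oseenKernel j h k t (x - y) * g y| ≤ C * (t ^ (-(1 / 2) : ℝ) * m) * wt ϑ x := by
  choose F hF0 hF using fun q : Fin d × Fin d × Fin d => exists_abs_oseenKernel_le q.1 q.2.1 q.2.2
  obtain ⟨C, hC0, hC⟩ := exists_integral_oseenMajorant_mul_wt_sq_le hϑ₀ hϑ₁ T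
  refine ⟨(∑ q, F q) * C, mul_nonneg (Finset.sum_nonneg fun q _ => hF0 q) hC0,
    fun j h k t ht htT x g m hg => ?_⟩
  have hFle : F (j, h, k) ≤ ∑ q, F q :=
    Finset.single_le_sum (f := F) (fun q _ => hF0 q) (Finset.mem_univ _)
  have hm : 0 ≤ m := by
    obtain ⟨y, hy⟩ := hg.exists
    have := (abs_nonneg _).trans hy
    exact nonneg_of_mul_nonneg_left this (pow_pos (wt_pos ϑ y) 2)
  calc |∫ y, oseenKernel j h k t (x - y) * g y|
      ≤ ∫ y, (∑ q, F q) * m * (oseenMajorant t (x - y) * wt ϑ y ^ 2) := by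
        rw [← Real.norm_eq_abs]
        refine norm_integral_le_of_norm_le
          ((integrable_oseenMajorant_mul_wt_sq hϑ₀ ht x).const_mul _) ?_
        filter_upwards [hg] with y hy
        have hK := oseenMajorant_nonneg ht (x - y)
        calc _ = |oseenKernel j h k t (x - y)| * |g y| := norm_mul _ _
          _ ≤ (F (j, h, k) * oseenMajorant t (x - y)) * (m * wt ϑ y ^ 2) := by
              gcongr
              · exact mul_nonneg (hF0 _) hK
              · exact hF (j, h, k) t ht (x - y)
          _ ≤ ((∑ q, F q) * oseenMajorant t (x - y)) * (m * wt ϑ y ^ 2) := by gcongr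
          _ = _ := by ring
    _ = (∑ q, F q) * m * ∫ y, oseenMajorant t (x - y) * wt ϑ y ^ 2 := integral_const_mul _ _
    _ ≤ (∑ q, F q) * m * (C * t ^ (-(1 / 2) : ℝ) * wt ϑ x) := by
        have : 0 ≤ (∑ q, F q) := Finset.sum_nonneg fun q _ => hF0 q
        gcongr
        exact hC t ht htT x
    _ = _ := by ring

lemma integrable_oseenKernel_mul {d : ℕ} (j h k : Fin d) {t : ℝ} (ht : 0 < t) (x : Vec d)
    {g : Vec d → ℝ} (hg : AEStronglyMeasurable g volume) {M : ℝ} (hM : ∀ᵐ y, |g y| ≤ M) :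
    Integrable fun y => oseenKernel j h k t (x - y) * g y := by
  obtain ⟨C, hC0, hC⟩ := exists_abs_oseenKernel_le j h k
  have hm : Measurable fun y : Vec d => oseenKernel j h k t (x - y) :=
    (measurable_oseenKernel j h k).comp (f := fun y : Vec d => (t, x - y)) (by fun_prop)
  refine Integrable.mul_bdd ?_ hg (c := M) hM
  refine ((integrable_oseenMajorant_sub ht x).const_mul C).mono' hm.aestronglyMeasurable
    (Filter.Eventually.of_forall fun y => hC t ht _)

lemma intervalIntegrable_sub_rpow (t a b : ℝ) :
    IntervalIntegrable (fun s => (t - s) ^ (-(1 / 2) : ℝ)) volume a b := by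
  have := (intervalIntegral.intervalIntegrable_rpow' (a := t - a) (b := t - b)
    (r := -(1 / 2)) (by norm_num)).comp_sub_left t
  simpa using this

/-- A weighted bound for one component of the Duhamel integral, on a part `[a, b]` of the time
interval; `m s` measures the size of the source in `L^∞_{2ϑ}` at time `s`. -/
theorem exists_abs_duhamel_le {d : ℕ} {ϑ : ℝ} (hϑ₀ : 0 ≤ ϑ) (hϑ₁ : ϑ ≤ (d : ℝ) + 1) (T : ℝ) :
    ∃ C, 0 ≤ C ∧ ∀ (j h k : Fin d) (t a b : ℝ), a ≤ b → b ≤ t → t - a ≤ T →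
      ∀ (P : ℝ → Vec d → ℝ) (m : ℝ → ℝ),
      (∀ s ∈ Set.Ioo a b, ∀ᵐ y, |P s y| ≤ m s * wt ϑ y ^ 2) →
      IntervalIntegrable (fun s => (t - s) ^ (-(1 / 2) : ℝ) * m s) volume a b → ∀ x : Vec d,
      |∫ s in a..b, ∫ y, oseenKernel j h k (t - s) (x - y) * P s y| ≤
        C * (∫ s in a..b, (t - s) ^ (-(1 / 2) : ℝ) * m s) * wt ϑ x := by
  obtain ⟨C, hC0, hC⟩ := exists_abs_integral_oseenKernel_mul_le (d := d) hϑ₀ hϑ₁ T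
  refine ⟨C, hC0, fun j h k t a b hab hbt hT P m hP hm x => ?_⟩
  rw [mul_assoc, mul_comm C, mul_assoc, ← intervalIntegral.integral_mul_const, ← Real.norm_eq_abs]
  refine intervalIntegral.norm_integral_le_of_norm_le hab ?_ (hm.mul_const _)
  filter_upwards [Measure.ae_ne volume b] with s hsb hs
  have hs' : s ∈ Set.Ioo a b := ⟨hs.1, lt_of_le_of_ne hs.2 hsb⟩
  exact (hC j h k (t - s) (by linarith [hs'.2]) (by linarith [hs'.1]) x (P s) (m s) (hP s hs')).trans
    (le_of_eq (by ring))

lemma measurable_integral_oseenKernel_mul {d : ℕ} (j h k : Fin d) {P : ℝ → Vec d → ℝ}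
    (hP : Measurable (Function.uncurry P)) :
    Measurable fun q : (ℝ × Vec d) × ℝ =>
      ∫ y, oseenKernel j h k (q.1.1 - q.2) (q.1.2 - y) * P q.2 y := by
  have h1 : Measurable fun z : ((ℝ × Vec d) × ℝ) × Vec d =>
      oseenKernel j h k (z.1.1.1 - z.1.2) (z.1.1.2 - z.2) * P z.1.2 z.2 :=
    ((measurable_oseenKernel j h k).comp
      (f := fun z : ((ℝ × Vec d) × ℝ) × Vec d => (z.1.1.1 - z.1.2, z.1.1.2 - z.2)) (by fun_prop)).mul
    (hP.comp (f := fun z : ((ℝ × Vec d) × ℝ) × Vec d => (z.1.2, z.2)) (by fun_prop))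
  exact h1.stronglyMeasurable.integral_prod_right'.measurable

lemma intervalIntegrable_integral_oseenKernel_mul {d : ℕ} {ϑ : ℝ} (hϑ₀ : 0 ≤ ϑ)
    (hϑ₁ : ϑ ≤ (d : ℝ) + 1) (j h k : Fin d) {t a b : ℝ} (hab : a ≤ b) (hbt : b ≤ t)
    {P : ℝ → Vec d → ℝ} (hP : Measurable (Function.uncurry P)) {M : ℝ}
    (hM : ∀ s ∈ Set.Ioo a b, ∀ y, |P s y| ≤ M * wt ϑ y ^ 2) (x : Vec d) :
    IntervalIntegrable (fun s => ∫ y, oseenKernel j h k (t - s) (x - y) * P s y) volume a b := by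
  obtain ⟨C, hC0, hC⟩ := exists_abs_integral_oseenKernel_mul_le (d := d) hϑ₀ hϑ₁ (t - a)
  have hm := (measurable_integral_oseenKernel_mul j h k hP).comp
    (f := fun s : ℝ => ((t, x), s)) (by fun_prop)
  refine (((intervalIntegrable_sub_rpow t a b).mul_const M).const_mul C |>.mul_const (wt ϑ x)).mono_fun'
    hm.aestronglyMeasurable ?_
  rw [Set.uIoc_of_le hab]
  filter_upwards [ae_restrict_mem measurableSet_Ioc, Measure.ae_ne (volume.restrict _) b] with s hs hsb
  have hs' : s ∈ Set.Ioo a b := ⟨hs.1, lt_of_le_of_ne hs.2 hsb⟩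
  exact hC j h k (t - s) (by linarith [hs'.2]) (by linarith [hs'.1]) x (P s) M
    (Filter.Eventually.of_forall (hM s hs'))

/-! ### The heat flow on weighted spaces -/

lemma integrable_gaussian_mul_one_add_norm_rpow {d : ℕ} (r : ℝ) :
    Integrable fun z : Vec d => Real.exp (-‖z‖ ^ 2 / 4) * (1 + ‖z‖) ^ r := by
  obtain ⟨N, hN⟩ := exists_nat_ge r
  have hval : ∀ z : Vec d, gaussianSchwartz d ((1 / 2 : ℝ) • z) = Real.exp (-‖z‖ ^ 2 / 4) := by
    intro z
    change Real.exp (-‖(1 / 2 : ℝ) • z‖ ^ 2) = _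
    rw [norm_smul]; norm_num; ring
  have key : ∀ k : ℕ, Integrable fun z : Vec d => Real.exp (-‖z‖ ^ 2 / 4) * ‖z‖ ^ k := by
    intro k
    have h := (((gaussianSchwartz d).integrable_pow_mul volume k).comp_smul
      (R := (1 / 2 : ℝ)) (by norm_num)).const_mul (2 ^ k)
    refine h.congr (Filter.Eventually.of_forall fun z => ?_)
    simp only [hval, norm_smul, mul_pow, Real.norm_of_nonneg (Real.exp_nonneg _)]
    have e : (2 : ℝ) ^ k * (1 / 2) ^ k = 1 := by rw [← mul_pow]; norm_num
    rw [show ‖(1 / 2 : ℝ)‖ = 1 / 2 by norm_num]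
    linear_combination (Real.exp (-‖z‖ ^ 2 / 4) * ‖z‖ ^ k) * e
  refine (((key 0).add (key N)).const_mul (2 ^ N)).mono' ?_ (Filter.Eventually.of_forall fun z => ?_)
  · exact Measurable.aestronglyMeasurable (by fun_prop)
  · rw [Real.norm_of_nonneg (by positivity)]
    have h1 : (1 + ‖z‖) ^ r ≤ 2 ^ N * (1 + ‖z‖ ^ N) := by
      calc (1 + ‖z‖) ^ r ≤ (1 + ‖z‖) ^ (N : ℝ) := by gcongr; linarith [norm_nonneg z]
        _ = (1 + ‖z‖) ^ N := Real.rpow_natCast _ _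
        _ ≤ (2 * max 1 ‖z‖) ^ N := by
            gcongr; linarith [le_max_left 1 ‖z‖, le_max_right 1 ‖z‖]
        _ = 2 ^ N * (max 1 ‖z‖) ^ N := mul_pow _ _ _
        _ ≤ _ := by
            gcongr
            rcases le_total 1 ‖z‖ with h | h
            · rw [max_eq_right h]; linarith
            · rw [max_eq_left h]; simp
    calc _ ≤ Real.exp (-‖z‖ ^ 2 / 4) * (2 ^ N * (1 + ‖z‖ ^ N)) := by gcongr
      _ = _ := by simp only [Pi.add_apply]; ring

/-- The heat flow after the substitution `y = x - √t z`, which moves all dependence on `t` into the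
argument of the datum. -/
lemma heatFlow_eq {d : ℕ} {t : ℝ} (ht : 0 < t) (a : Vec d → Vec d) (x : Vec d) :
    heatFlow t a x =
      (4 * Real.pi) ^ (-(d : ℝ) / 2) • ∫ z : Vec d, Real.exp (-‖z‖ ^ 2 / 4) • a (x - √t • z) := by
  have hs := Real.sqrt_pos.2 ht
  have h1 : ∫ y, Real.exp (-‖x - y‖ ^ 2 / (4 * t)) • a y =
      ∫ w, Real.exp (-‖w‖ ^ 2 / (4 * t)) • a (x - w) := by
    have := integral_sub_left_eq_self
      (fun w : Vec d => Real.exp (-‖w‖ ^ 2 / (4 * t)) • a (x - w)) volume x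
    simpa using this
  have h2 := Measure.integral_comp_smul (volume : Measure (Vec d))
    (fun w : Vec d => Real.exp (-‖w‖ ^ 2 / (4 * t)) • a (x - w)) √t
  have h3 : ∀ z : Vec d, -‖√t • z‖ ^ 2 / (4 * t) = -‖z‖ ^ 2 / 4 := fun z => by
    rw [norm_smul, mul_pow, Real.norm_of_nonneg hs.le, Real.sq_sqrt ht.le]; field_simp
  simp_rw [h3] at h2
  rw [heatFlow, h1, h2, smul_smul, abs_of_pos (by positivity), finrank_euclideanSpace_fin,
    Real.mul_rpow (by positivity) ht.le, ← Real.rpow_natCast √t, Real.sqrt_eq_rpow,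
    ← Real.rpow_mul ht.le, ← Real.rpow_neg ht.le]
  congr 2
  ring_nf

lemma heatFlow_comp_add {d : ℕ} {t : ℝ} (ht : 0 < t) (a : Vec d → Vec d) (x v : Vec d) :
    heatFlow t a (x + v) = heatFlow t (fun y => a (y + v)) x := by
  rw [heatFlow_eq ht, heatFlow_eq ht]
  simp_rw [add_sub_right_comm]

lemma heatFlow_congr_ae {d : ℕ} (t : ℝ) {a a' : Vec d → Vec d} (h : a =ᵐ[volume] a') :
    heatFlow t a = heatFlow t a' := by
  ext1 x
  unfold heatFlow
  congr 1
  exact integral_congr_ae (h.mono fun y hy => by simp only [hy])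

lemma quasiMeasurePreserving_sub_sqrt_smul {d : ℕ} {t : ℝ} (ht : 0 < t) (x : Vec d) :
    Measure.QuasiMeasurePreserving (fun z : Vec d => x - √t • z) volume volume := by
  have h1 : Measure.QuasiMeasurePreserving (fun z : Vec d => √t • z) volume volume :=
    ⟨by fun_prop, by
      rw [Measure.map_addHaar_smul _ (Real.sqrt_pos.2 ht).ne']
      exact Measure.smul_absolutelyContinuous⟩
  exact (quasiMeasurePreserving_sub_left volume x).comp h1

lemma integrable_heat_integrand {d : ℕ} {t : ℝ} (ht : 0 < t) {a : Vec d → Vec d}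
    (ha : Measurable a) {M : ℝ} (hM : ∀ᵐ y, ‖a y‖ ≤ M) (x : Vec d) :
    Integrable fun z : Vec d => Real.exp (-‖z‖ ^ 2 / 4) • a (x - √t • z) := by
  have h0 : Integrable fun z : Vec d => Real.exp (-‖z‖ ^ 2 / 4) := by
    simpa using integrable_gaussian_mul_one_add_norm_rpow (d := d) 0
  have hq := quasiMeasurePreserving_sub_sqrt_smul ht x
  have hm : Measurable fun z : Vec d => a (x - √t • z) := ha.comp hq.measurable
  exact h0.smul_bdd M hm.aestronglyMeasurable (hq.ae hM)

lemma heatFlow_sub {d : ℕ} {t : ℝ} (ht : 0 < t) {a b : Vec d → Vec d} (ha : Measurable a)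
    (hb : Measurable b) {M : ℝ} (hMa : ∀ᵐ y, ‖a y‖ ≤ M) (hMb : ∀ᵐ y, ‖b y‖ ≤ M) (x : Vec d) :
    heatFlow t (fun y => a y - b y) x = heatFlow t a x - heatFlow t b x := by
  rw [heatFlow_eq ht, heatFlow_eq ht, heatFlow_eq ht, ← smul_sub,
    ← integral_sub (integrable_heat_integrand ht ha hMa x) (integrable_heat_integrand ht hb hMb x)]
  simp_rw [smul_sub]

lemma wt_sub_smul_le {d : ℕ} {ϑ : ℝ} (hϑ : 0 ≤ ϑ) {t T : ℝ} (htT : t ≤ T) (x z : Vec d) :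
    wt ϑ (x - √t • z) ≤ (1 + √T) ^ ϑ * (1 + ‖z‖) ^ ϑ * wt ϑ x := by
  rw [sub_eq_add_neg]
  refine (wt_add_le hϑ x _).trans ?_
  have := (wt_pos ϑ x).le
  rw [← Real.mul_rpow (by positivity) (by positivity)]
  gcongr
  rw [norm_neg, norm_smul, Real.norm_of_nonneg (Real.sqrt_nonneg t)]
  have := Real.sqrt_le_sqrt htT
  nlinarith [norm_nonneg z, Real.sqrt_nonneg T]

/-- The heat flow is bounded on `L^∞_ϑ`, uniformly on bounded time intervals. -/
theorem exists_norm_heatFlow_le {d : ℕ} {ϑ : ℝ} (hϑ : 0 ≤ ϑ) (T : ℝ) :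
    ∃ C, 0 ≤ C ∧ ∀ t, 0 < t → t ≤ T → ∀ (a : Vec d → Vec d) (M : ℝ),
      (∀ᵐ y, ‖a y‖ ≤ M * wt ϑ y) → ∀ x, ‖heatFlow t a x‖ ≤ C * M * wt ϑ x := by
  set I := ∫ z : Vec d, Real.exp (-‖z‖ ^ 2 / 4) * (1 + ‖z‖) ^ ϑ
  have hI : 0 ≤ I := integral_nonneg fun z => by positivity
  refine ⟨(4 * Real.pi) ^ (-(d : ℝ) / 2) * ((1 + √T) ^ ϑ * I), by positivity,
    fun t ht htT a M hM x => ?_⟩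
  have hM0 : 0 ≤ M := by
    obtain ⟨y, hy⟩ := hM.exists
    exact nonneg_of_mul_nonneg_left ((norm_nonneg _).trans hy) (wt_pos ϑ y)
  have hq := quasiMeasurePreserving_sub_sqrt_smul ht x
  rw [heatFlow_eq ht, norm_smul, Real.norm_of_nonneg (by positivity), mul_assoc, mul_assoc]
  gcongr
  calc _ ≤ ∫ z : Vec d, ((1 + √T) ^ ϑ * M * wt ϑ x) *
        (Real.exp (-‖z‖ ^ 2 / 4) * (1 + ‖z‖) ^ ϑ) := by
        refine norm_integral_le_of_norm_le
          ((integrable_gaussian_mul_one_add_norm_rpow ϑ).const_mul _) ?_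
        filter_upwards [hq.ae hM] with z hz
        rw [norm_smul, Real.norm_of_nonneg (by positivity)]
        calc _ ≤ Real.exp (-‖z‖ ^ 2 / 4) * (M * ((1 + √T) ^ ϑ * (1 + ‖z‖) ^ ϑ * wt ϑ x)) := by
              gcongr
              refine hz.trans ?_
              gcongr
              exact wt_sub_smul_le hϑ htT x z
          _ = _ := by ring
    _ = _ := by rw [integral_const_mul]; ring

lemma sqrt_add_sub_sqrt_le {t h : ℝ} (ht : 0 < t) (hh : 0 ≤ h) :
    √(t + h) - √t ≤ h * t ^ (-(1 / 2) : ℝ) := by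
  have hs := Real.sqrt_pos.2 ht
  rw [Real.rpow_neg ht.le, ← Real.sqrt_eq_rpow, ← div_eq_mul_inv, le_div_iff₀ hs]
  have h1 : √t ≤ √(t + h) := Real.sqrt_le_sqrt (by linarith)
  nlinarith [Real.sq_sqrt ht.le, Real.sq_sqrt (by linarith : 0 ≤ t + h)]

/-- For a datum which is Lipschitz with respect to the weight, the heat flow has time increments of
size `h t^{-1/2}`. -/
theorem exists_norm_heatFlow_add_sub_le {d : ℕ} {ϑ : ℝ} (hϑ : 0 ≤ ϑ) (T : ℝ) {a : Vec d → Vec d}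
    (ha : Measurable a) {M : ℝ} (hM : ∀ᵐ y, ‖a y‖ ≤ M) {L : ℝ} (hL : 0 ≤ L)
    (hLip : ∀ v : Vec d, ∀ᵐ x, ‖a (x + v) - a x‖ ≤ L * ‖v‖ * (1 + ‖v‖) ^ ϑ * wt ϑ x) :
    ∃ C, 0 ≤ C ∧ ∀ t h, 0 < t → 0 ≤ h → t + h ≤ T →
      ∀ᵐ x, ‖heatFlow (t + h) a x - heatFlow t a x‖ ≤ C * (h * t ^ (-(1 / 2) : ℝ)) * wt ϑ x := by
  set I := ∫ z : Vec d, Real.exp (-‖z‖ ^ 2 / 4) * (1 + ‖z‖) ^ (1 + ϑ + ϑ)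
  have hI : 0 ≤ I := integral_nonneg fun z => by positivity
  refine ⟨(4 * Real.pi) ^ (-(d : ℝ) / 2) * (L * (1 + √T) ^ ϑ * (1 + √T) ^ ϑ * I), by positivity,
    fun t h ht hh hT => ?_⟩
  have hth : 0 < t + h := by linarith
  have h1 : ∀ᵐ x : Vec d, ∀ᵐ z : Vec d,
      ‖a (x - √(t + h) • z) - a (x - √t • z)‖ ≤
        L * ‖(√(t + h) - √t) • z‖ * (1 + ‖(√(t + h) - √t) • z‖) ^ ϑ * wt ϑ (x - √t • z) := by
    rw [Measure.ae_ae_comm]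
    · refine Filter.Eventually.of_forall fun z => ?_
      have := (measurePreserving_sub_right (volume : Measure (Vec d)) (√t • z)).quasiMeasurePreserving.ae
        (hLip (-((√(t + h) - √t) • z)))
      filter_upwards [this] with x hx
      rw [norm_neg] at hx
      convert hx using 4
      rw [sub_smul]; abel
    · have := measurable_wt (d := d) ϑ
      refine measurableSet_le (by fun_prop) (Measurable.mul (by fun_prop) (this.comp (by fun_prop)))
  filter_upwards [h1] with x hx
  rw [heatFlow_eq hth, heatFlow_eq ht, ← smul_sub,
    ← integral_sub (integrable_heat_integrand hth ha hM x) (integrable_heat_integrand ht ha hM x),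
    norm_smul, Real.norm_of_nonneg (by positivity), mul_assoc, mul_assoc]
  gcongr
  have hw := (wt_pos ϑ x).le
  calc _ ≤ ∫ z : Vec d, (L * (1 + √T) ^ ϑ * (1 + √T) ^ ϑ * (h * t ^ (-(1 / 2) : ℝ)) * wt ϑ x) *
        (Real.exp (-‖z‖ ^ 2 / 4) * (1 + ‖z‖) ^ (1 + ϑ + ϑ)) := by
        refine norm_integral_le_of_norm_le
          ((integrable_gaussian_mul_one_add_norm_rpow _).const_mul _) ?_
        filter_upwards [hx] with z hz
        have hd0 : 0 ≤ √(t + h) - √t := sub_nonneg.2 (Real.sqrt_le_sqrt (by linarith))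
        have hd1 := sqrt_add_sub_sqrt_le ht hh
        have hd2 : √(t + h) - √t ≤ √T := by
          have := Real.sqrt_le_sqrt hT
          linarith [Real.sqrt_nonneg t]
        rw [← smul_sub, norm_smul, Real.norm_of_nonneg (by positivity)]
        rw [norm_smul, Real.norm_of_nonneg hd0] at hz
        have hz1 : (√(t + h) - √t) * ‖z‖ ≤ (h * t ^ (-(1 / 2) : ℝ)) * (1 + ‖z‖) := by
          gcongr; linarith
        have hz2 : (1 + (√(t + h) - √t) * ‖z‖) ^ ϑ ≤ (1 + √T) ^ ϑ * (1 + ‖z‖) ^ ϑ := by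
          rw [← Real.mul_rpow (by positivity) (by positivity)]
          refine Real.rpow_le_rpow (by positivity) ?_ hϑ
          nlinarith [norm_nonneg z, Real.sqrt_nonneg T]
        have hz3 := wt_sub_smul_le hϑ (t := t) (T := T) (by linarith) x z
        have hw' := (wt_pos ϑ (x - √t • z)).le
        calc _ ≤ Real.exp (-‖z‖ ^ 2 / 4) * (L * ((h * t ^ (-(1 / 2) : ℝ)) * (1 + ‖z‖)) *
              ((1 + √T) ^ ϑ * (1 + ‖z‖) ^ ϑ) * ((1 + √T) ^ ϑ * (1 + ‖z‖) ^ ϑ * wt ϑ x)) := by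
              gcongr
              refine hz.trans ?_
              gcongr
          _ = _ := by
              rw [Real.rpow_add (by positivity) (1 + ϑ), Real.rpow_add (by positivity) 1, Real.rpow_one]
              ring
    _ = _ := by rw [integral_const_mul]; ring

lemma measurable_heatFlow {d : ℕ} {a : Vec d → Vec d} (ha : Measurable a) :
    Measurable fun q : ℝ × Vec d => heatFlow q.1 a q.2 := by
  unfold heatFlow
  have h1 : Measurable fun z : (ℝ × Vec d) × Vec d =>
      Real.exp (-‖z.1.2 - z.2‖ ^ 2 / (4 * z.1.1)) • a z.2 := by
    fun_prop
  have h2 : Measurable fun q : ℝ × Vec d => (4 * Real.pi * q.1) ^ (-(d : ℝ) / 2) := by fun_prop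
  exact h2.smul h1.stronglyMeasurable.integral_prod_right'.measurable

/-! ### Weak compactness of dominated sequences -/

/-- Weak compactness of balls, along an ultrafilter on the indices chosen beforehand; this avoids
extracting subsequences. -/
lemma exists_weak_limit_of_bounded {H : Type*} [NormedAddCommGroup H] [InnerProductSpace ℝ H]
    [CompleteSpace H] (x : ℕ → H) {B : ℝ} (hB : ∀ n, ‖x n‖ ≤ B) :
    ∃ y : H, ∀ g : H, Tendsto (fun n => inner ℝ (x n) g) (hyperfilter ℕ) (𝓝 (inner ℝ y g)) := by
  have hc := WeakDual.isCompact_closedBall (𝕜 := ℝ) (E := H) 0 B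
  set Λ : ℕ → WeakDual ℝ H := fun n => StrongDual.toWeakDual (InnerProductSpace.toDual ℝ H (x n))
  have hmem : ∀ n, Λ n ∈ WeakDual.toStrongDual ⁻¹' Metric.closedBall (0 : StrongDual ℝ H) B := by
    intro n
    simp only [Λ, Set.mem_preimage, mem_closedBall_zero_iff]
    change ‖InnerProductSpace.toDual ℝ H (x n)‖ ≤ B
    rw [LinearIsometryEquiv.norm_map]; exact hB n
  obtain ⟨L, _, hL⟩ := hc.ultrafilter_le_nhds ((hyperfilter ℕ : Ultrafilter ℕ).map Λ)
    (by
      rw [Ultrafilter.coe_map, le_principal_iff]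
      exact Filter.mem_map.2 (Filter.univ_mem' hmem))
  refine ⟨(InnerProductSpace.toDual ℝ H).symm (WeakDual.toStrongDual L), fun g => ?_⟩
  have h1 : Tendsto Λ (hyperfilter ℕ) (𝓝 L) := hL
  have h2 := ((WeakDual.eval_continuous g).tendsto L).comp h1
  rw [InnerProductSpace.toDual_symm_apply]
  exact h2

/-- A sequence of `L²` functions dominated by `σ ∈ L²` has a weak limit, and the limit is again
dominated by `σ`. -/
lemma exists_weak_limit_of_dominated {W : Type*} [NormedAddCommGroup W]
    [InnerProductSpace ℝ W] [CompleteSpace W] {X : Type*} [MeasurableSpace X] {μ : Measure X}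
    {σ : X → ℝ} (hσ0 : ∀ z, 0 ≤ σ z) (hσm : Measurable σ) (hσ : MemLp σ 2 μ) {Q : ℕ → X → W}
    (hQm : ∀ n, AEStronglyMeasurable (Q n) μ) (hQ : ∀ n, ∀ᵐ z ∂μ, ‖Q n z‖ ≤ σ z) :
    ∃ q : X → W, StronglyMeasurable q ∧ (∀ᵐ z ∂μ, ‖q z‖ ≤ σ z) ∧ ∀ G : X → W, MemLp G 2 μ →
      Tendsto (fun n => ∫ z, inner ℝ (Q n z) (G z) ∂μ) (hyperfilter ℕ)
        (𝓝 (∫ z, inner ℝ (q z) (G z) ∂μ)) := by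
  have hQL : ∀ n, MemLp (Q n) 2 μ := fun n =>
    hσ.mono (hQm n) ((hQ n).mono fun z hz => hz.trans (le_abs_self _))
  obtain ⟨y, hy⟩ := exists_weak_limit_of_bounded (fun n => (hQL n).toLp (Q n))
    (B := ‖hσ.toLp σ‖) (fun n => by
      refine Lp.norm_le_norm_of_ae_le ?_
      filter_upwards [(hQL n).coeFn_toLp, hσ.coeFn_toLp, hQ n] with z h1 h2 h3
      rw [h1, h2]; exact h3.trans (le_abs_self _))
  have hlim : ∀ G : X → W, MemLp G 2 μ →
      Tendsto (fun n => ∫ z, inner ℝ (Q n z) (G z) ∂μ) (hyperfilter ℕ)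
        (𝓝 (∫ z, inner ℝ (y z) (G z) ∂μ)) := by
    intro G hG
    have h := hy (hG.toLp G)
    have e1 : ∀ n, inner ℝ ((hQL n).toLp (Q n)) (hG.toLp G) = ∫ z, inner ℝ (Q n z) (G z) ∂μ := by
      intro n
      rw [L2.inner_def]
      refine integral_congr_ae ?_
      filter_upwards [(hQL n).coeFn_toLp, hG.coeFn_toLp] with z h1 h2
      rw [h1, h2]
    have e2 : inner ℝ y (hG.toLp G) = ∫ z, inner ℝ (y z) (G z) ∂μ := by
      rw [L2.inner_def]
      refine integral_congr_ae ?_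
      filter_upwards [hG.coeFn_toLp] with z h2
      rw [h2]
    simpa only [e1, e2] using h
  have hys : StronglyMeasurable (y : X → W) := Lp.stronglyMeasurable y
  refine ⟨y, hys, ?_, hlim⟩
  -- test the limit against its own restriction to the set where the bound fails
  have hyL : MemLp (y : X → W) 2 μ := Lp.memLp y
  set A : Set X := {z | σ z < ‖y z‖}
  have hA : MeasurableSet A := measurableSet_lt hσm hys.norm.measurable
  have hG : MemLp (A.indicator (y : X → W)) 2 μ := hyL.indicator hA
  have hσG : Integrable (fun z => σ z * ‖A.indicator (y : X → W) z‖) μ :=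
    hσ.integrable_mul hG.norm
  have hyG : Integrable (fun z => ‖A.indicator (y : X → W) z‖ ^ 2) μ :=
    hG.integrable_norm_pow (by norm_num)
  have h1 : ∫ z, inner ℝ (y z) (A.indicator (y : X → W) z) ∂μ ≤
      ∫ z, σ z * ‖A.indicator (y : X → W) z‖ ∂μ := by
    refine le_of_tendsto (hlim _ hG) (Eventually.of_forall fun n => ?_)
    refine (le_abs_self _).trans ?_
    rw [← Real.norm_eq_abs]
    refine norm_integral_le_of_norm_le hσG ?_
    filter_upwards [hQ n] with z hz
    exact (norm_inner_le_norm _ _).trans (by gcongr)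
  have h2 : ∀ z, inner ℝ (y z) (A.indicator (y : X → W) z) = ‖A.indicator (y : X → W) z‖ ^ 2 := by
    intro z
    by_cases hz : z ∈ A
    · rw [Set.indicator_of_mem hz, real_inner_self_eq_norm_sq]
    · rw [Set.indicator_of_notMem hz]; simp
  simp_rw [h2] at h1
  have h3 : ∀ z, 0 ≤ ‖A.indicator (y : X → W) z‖ ^ 2 - σ z * ‖A.indicator (y : X → W) z‖ := by
    intro z
    by_cases hz : z ∈ A
    · rw [Set.indicator_of_mem hz]
      have : σ z < ‖y z‖ := hz
      nlinarith [norm_nonneg (y z)]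
    · rw [Set.indicator_of_notMem hz]; simp
  have h4 : ∫ z, (‖A.indicator (y : X → W) z‖ ^ 2 - σ z * ‖A.indicator (y : X → W) z‖) ∂μ = 0 := by
    refine le_antisymm ?_ (integral_nonneg h3)
    rw [integral_sub hyG hσG]; linarith
  rw [integral_eq_zero_iff_of_nonneg h3 (hyG.sub hσG)] at h4
  filter_upwards [h4] with z hz
  by_contra hlt
  have hzA : z ∈ A := not_le.1 hlt
  simp only [Set.indicator_of_mem hzA, Pi.zero_apply] at hz
  have : σ z < ‖y z‖ := hzA
  nlinarith [hσ0 z, norm_nonneg (y z)]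

/-! ### Weak derivatives from difference quotients -/

section DifferenceQuotients

set_option linter.unusedSectionVars false

variable {V W : Type*} [NormedAddCommGroup V] [NormedSpace ℝ V] [FiniteDimensional ℝ V]
  [MeasureSpace V] [BorelSpace V] [(volume : Measure V).IsAddHaarMeasure]
  [NormedAddCommGroup W] [InnerProductSpace ℝ W] [CompleteSpace W]

lemma integrable_smul_of_hasCompactSupport {φ : V → ℝ} (hφ : Continuous φ) (hφs : HasCompactSupport φ)
    {f : V → W} (hf : AEStronglyMeasurable f volume) {M : ℝ} (hM : ∀ᵐ z, ‖f z‖ ≤ M) :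
    Integrable fun z => φ z • f z :=
  (hφ.integrable_of_hasCompactSupport hφs).smul_bdd M hf hM

lemma integral_smul_comp_add (φ : V → ℝ) (f : V → W) (w : V) :
    ∫ z, φ z • f (z + w) = ∫ z, φ (z - w) • f z := by
  have := integral_add_right_eq_self (μ := (volume : Measure V)) (fun z => φ (z - w) • f z) w
  simpa using this

lemma hasCompactSupport_comp_sub {φ : V → ℝ} (hφs : HasCompactSupport φ) (w : V) :
    HasCompactSupport fun z => φ (z - w) :=
  hφs.comp_homeomorph (Homeomorph.subRight w)

lemma hasDerivAt_comp_sub_smul {φ : V → ℝ} (hφ : ContDiff ℝ ∞ φ) (z v : V) (r : ℝ) :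
    HasDerivAt (fun s : ℝ => φ (z - s • v)) (-(fderiv ℝ φ (z - r • v) v)) r := by
  have h1 : HasDerivAt (fun s : ℝ => z - s • v) (-v) r := by
    simpa using ((hasDerivAt_id r).smul_const v).const_sub z
  have h2 := ((hφ.differentiable (by simp)) (z - r • v)).hasFDerivAt.comp_hasDerivAt r h1
  rw [map_neg] at h2
  exact h2

/-- Difference quotients of a test function converge against bounded functions. -/
lemma tendsto_integral_diffQuot_smul {φ : V → ℝ} (hφ : ContDiff ℝ ∞ φ) (hφs : HasCompactSupport φ)
    {f : V → W} (hf : AEStronglyMeasurable f volume) {M : ℝ} (hM : ∀ᵐ z, ‖f z‖ ≤ M) (v : V)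
    {τ : ℕ → ℝ} (hτ0 : ∀ n, 0 < τ n) (hτ1 : ∀ n, τ n ≤ 1) (hτ : Tendsto τ atTop (𝓝 0)) :
    Tendsto (fun n => ∫ z, ((τ n)⁻¹ * (φ (z - τ n • v) - φ z)) • f z) atTop
      (𝓝 (-∫ z, (fderiv ℝ φ z v) • f z)) := by
  obtain ⟨K, hK⟩ := (hφ.of_le (by simp : (1 : WithTop ℕ∞) ≤ ∞)).lipschitzWith_of_hasCompactSupport
     hφs (by simp)
  obtain ⟨R, hR⟩ := hφs.isCompact.isBounded.subset_closedBall (0 : V)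
  have hzero : ∀ z, R < ‖z‖ → φ z = 0 := fun z hz => by
    by_contra h
    have := hR (subset_tsupport φ (Function.mem_support.2 h))
    rw [mem_closedBall_zero_iff] at this
    linarith
  rw [← integral_neg]
  refine tendsto_integral_of_dominated_convergence
    (fun z => (Metric.closedBall (0 : V) (R + ‖v‖)).indicator (fun _ => K * ‖v‖ * M) z) ?_ ?_ ?_ ?_
  · intro n
    refine AEStronglyMeasurable.smul ?_ hf
    have := hφ.continuous
    exact Continuous.aestronglyMeasurable (by fun_prop)
  · exact (integrable_indicator_iff measurableSet_closedBall).2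
      (integrableOn_const (measure_closedBall_lt_top).ne)
  · intro n
    filter_upwards [hM] with z hz
    have h0 := hτ0 n
    by_cases hzR : z ∈ Metric.closedBall (0 : V) (R + ‖v‖)
    · rw [Set.indicator_of_mem hzR, norm_smul]
      gcongr
      have h1 := hK.dist_le_mul (z - τ n • v) z
      rw [dist_eq_norm, dist_eq_norm, sub_sub_cancel_left, norm_neg, norm_smul,
        Real.norm_of_nonneg h0.le] at h1
      rw [norm_mul, norm_inv, Real.norm_of_nonneg h0.le, inv_mul_le_iff₀ h0]
      linarith
    · rw [Set.indicator_of_notMem hzR]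
      rw [mem_closedBall_zero_iff, not_le] at hzR
      have h1 : R < ‖z‖ := by linarith [norm_nonneg v]
      have h2 : R < ‖z - τ n • v‖ := by
        have h3 := norm_sub_norm_le z (τ n • v)
        rw [norm_smul, Real.norm_of_nonneg h0.le] at h3
        nlinarith [norm_nonneg v, hτ1 n]
      simp [hzero _ h1, hzero _ h2]
  · refine Eventually.of_forall fun z => ?_
    have h1 := (hasDerivAt_comp_sub_smul hφ z v 0).tendsto_slope_zero
    have h2 : Tendsto τ atTop (𝓝[≠] 0) :=
      tendsto_nhdsWithin_iff.2 ⟨hτ, Eventually.of_forall fun n => (hτ0 n).ne'⟩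
    have h3 := (h1.comp h2).smul_const (f z)
    simpa using h3

/-- A bounded function whose difference quotients in the direction `v` are dominated by `ρ` on `Ω`
has there a weak derivative dominated by `ρ`: the derivative is a weak `L²` limit of the difference
quotients, renormalised by an integrable weight. -/
theorem exists_hasWeakDirDeriv_of_norm_sub_le {Ω : Set V} (hΩ : IsOpen Ω) (v : V) {f : V → W}
    (hf : AEStronglyMeasurable f volume) {M : ℝ} (hM : ∀ᵐ z, ‖f z‖ ≤ M) {ρ : V → ℝ}
    (hρm : Measurable ρ) (hρc : ContinuousOn ρ Ω) (hρ0 : ∀ z ∈ Ω, 0 < ρ z)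
    (hdiff : ∀ τ : ℝ, 0 < τ → τ ≤ 1 → ∀ᵐ z, z ∈ Ω → z + τ • v ∈ Ω → ‖f (z + τ • v) - f z‖ ≤ τ * ρ z) :
    ∃ g : V → W, AEStronglyMeasurable g volume ∧ (∀ z ∉ Ω, g z = 0) ∧
      (∀ᵐ z, z ∈ Ω → ‖g z‖ ≤ ρ z) ∧ HasWeakDirDeriv Ω v f g := by
  -- `σ` is square integrable, and the renormalised quotients `σ ρ⁻¹ (f (z + τ v) - f z) / τ` are
  -- bounded by it
  set D : ℝ := Module.finrank ℝ V + 1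
  set σ : V → ℝ := fun z => (1 + ‖z‖) ^ (-D)
  have hσ0 : ∀ z, 0 < σ z := fun z => by simp only [σ]; positivity
  have hσm : Measurable σ := by simp only [σ]; fun_prop
  have hσL : MemLp σ 2 (volume : Measure V) := by
    rw [memLp_two_iff_integrable_sq hσm.aestronglyMeasurable]
    refine (integrable_one_add_norm (E := V) (μ := volume) (r := D) (by simp [D])).mono'
      (hσm.pow_const 2).aestronglyMeasurable (Eventually.of_forall fun z => ?_)
    rw [Real.norm_of_nonneg (sq_nonneg _)]
    have : σ z ≤ 1 := Real.rpow_le_one_of_one_le_of_nonpos (by linarith [norm_nonneg z])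
      (by simp only [D]; linarith [(Nat.cast_nonneg (Module.finrank ℝ V) : (0 : ℝ) ≤ _)])
    change σ z ^ 2 ≤ σ z
    nlinarith [hσ0 z]
  set τ : ℕ → ℝ := fun n => 1 / ((n : ℝ) + 1)
  have hτ0 : ∀ n, 0 < τ n := fun n => by simp only [τ]; positivity
  have hτ1 : ∀ n, τ n ≤ 1 := fun n => by
    simp only [τ]; rw [div_le_one (by positivity)]; linarith [(Nat.cast_nonneg n : (0 : ℝ) ≤ n)]
  have hτ : Tendsto τ atTop (𝓝 0) := tendsto_one_div_add_atTop_nhds_zero_nat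
  set S : ℕ → Set V := fun n => Ω ∩ {z | z + τ n • v ∈ Ω}
  have hS : ∀ n, MeasurableSet (S n) := fun n =>
    hΩ.measurableSet.inter (hΩ.preimage (by fun_prop : Continuous fun z : V => z + τ n • v)).measurableSet
  have hftr : ∀ w : V, AEStronglyMeasurable (fun z => f (z + w)) volume := fun w =>
    hf.comp_measurePreserving (measurePreserving_add_right volume w)
  have hMtr : ∀ w : V, ∀ᵐ z, ‖f (z + w)‖ ≤ M := fun w =>
    (measurePreserving_add_right volume w).quasiMeasurePreserving.ae hM
  set Q : ℕ → V → W := fun n => (S n).indicator fun z =>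
    (σ z * (ρ z)⁻¹ * (τ n)⁻¹) • (f (z + τ n • v) - f z)
  have hQm : ∀ n, AEStronglyMeasurable (Q n) volume := fun n =>
    AEStronglyMeasurable.indicator (AEStronglyMeasurable.smul
      (((hσm.mul hρm.inv).mul_const _).aestronglyMeasurable) ((hftr _).sub hf)) (hS n)
  have hQ : ∀ n, ∀ᵐ z, ‖Q n z‖ ≤ σ z := by
    intro n
    filter_upwards [hdiff (τ n) (hτ0 n) (hτ1 n)] with z hz
    by_cases hzS : z ∈ S n
    · have h1 := hz hzS.1 hzS.2
      have h2 := hρ0 z hzS.1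
      have h3 := hσ0 z
      have h4 := hτ0 n
      simp only [Q, Set.indicator_of_mem hzS, norm_smul, norm_mul, norm_inv]
      rw [Real.norm_of_nonneg h2.le, Real.norm_of_nonneg h3.le, Real.norm_of_nonneg h4.le]
      calc _ ≤ σ z * (ρ z)⁻¹ * (τ n)⁻¹ * (τ n * ρ z) := by gcongr
        _ = _ := by field_simp
    · simp only [Q, Set.indicator_of_notMem hzS, norm_zero]; exact (hσ0 z).le
  obtain ⟨q, hqm, hqσ, hq⟩ := exists_weak_limit_of_dominated (fun z => (hσ0 z).le) hσm hσL hQm hQ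
  set g : V → W := Ω.indicator fun z => (ρ z * (σ z)⁻¹) • q z
  have hgm : AEStronglyMeasurable g volume :=
    AEStronglyMeasurable.indicator (AEStronglyMeasurable.smul
      ((hρm.mul hσm.inv).aestronglyMeasurable) hqm.aestronglyMeasurable) hΩ.measurableSet
  have hgρ : ∀ᵐ z, z ∈ Ω → ‖g z‖ ≤ ρ z := by
    filter_upwards [hqσ] with z hz hzΩ
    have h2 := hρ0 z hzΩ
    have h3 := hσ0 z
    simp only [g, Set.indicator_of_mem hzΩ, norm_smul, norm_mul, norm_inv]
    rw [Real.norm_of_nonneg h2.le, Real.norm_of_nonneg h3.le]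
    calc _ ≤ ρ z * (σ z)⁻¹ * σ z := by gcongr
      _ = _ := by field_simp
  have hfloc : LocallyIntegrableOn f Ω volume :=
    LocallyIntegrable.locallyIntegrableOn (((locallyIntegrable_const M).mono hf
      (hM.mono fun z hz => hz.trans (le_abs_self M)))) Ω
  have hgloc : LocallyIntegrableOn g Ω volume := by
    have h1 := hρc.locallyIntegrableOn (μ := volume) hΩ.measurableSet
    rw [locallyIntegrableOn_iff hΩ.isLocallyClosed] at h1 ⊢
    intro K hK hKc
    refine Integrable.mono (h1 K hK hKc) hgm.restrict ?_
    filter_upwards [ae_restrict_of_ae hgρ, ae_restrict_mem hKc.measurableSet] with z hz hzK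
    exact (hz (hK hzK)).trans (le_abs_self _)
  refine ⟨g, hgm, fun z hz => Set.indicator_of_notMem hz _, hgρ, hfloc, hgloc, fun φ hφ hφs hφΩ => ?_⟩
  have hφz : ∀ z, z ∉ Ω → φ z = 0 := fun z hz => image_eq_zero_of_notMem_tsupport fun h => hz (hφΩ h)
  have hdφz : ∀ z, z ∉ Ω → fderiv ℝ φ z v = 0 := fun z hz => by
    have : fderiv ℝ φ z = 0 :=
      image_eq_zero_of_notMem_tsupport fun h => hz (hφΩ (tsupport_fderiv_subset ℝ h))
    rw [this]; rfl
  rw [setIntegral_eq_integral_of_forall_compl_eq_zero (fun z hz => by rw [hdφz z hz, zero_smul]),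
    setIntegral_eq_integral_of_forall_compl_eq_zero (fun z hz => by rw [hφz z hz, zero_smul])]
  -- the limit of the difference quotients, computed on the test function
  have hlim1 := tendsto_integral_diffQuot_smul hφ hφs hf hM v hτ0 hτ1 hτ
  obtain ⟨δ, hδ, hδΩ⟩ := hφs.isCompact.exists_thickening_subset_open hΩ hφΩ
  have hev : ∀ᶠ n in atTop, ∀ z, φ z ≠ 0 → z ∈ S n := by
    have h1 : Tendsto (fun n => τ n * ‖v‖) atTop (𝓝 0) := by simpa using hτ.mul_const ‖v‖
    filter_upwards [h1.eventually (gt_mem_nhds hδ)] with n hn z hz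
    have hzK : z ∈ tsupport φ := subset_tsupport φ (Function.mem_support.2 hz)
    refine ⟨hφΩ hzK, hδΩ (Metric.mem_thickening_iff.2 ⟨z, hzK, ?_⟩)⟩
    rw [dist_eq_norm, add_sub_cancel_left, norm_smul, Real.norm_of_nonneg (hτ0 n).le]
    exact hn
  have hφg : Integrable fun z => φ z • g z := by
    have h1 : IntegrableOn g (tsupport φ) volume :=
      (locallyIntegrableOn_iff hΩ.isLocallyClosed).1 hgloc _ hφΩ hφs.isCompact
    obtain ⟨B, hB⟩ := hφ.continuous.bounded_above_of_compact_support hφs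
    have h2 : IntegrableOn (fun z => φ z • g z) (tsupport φ) volume :=
      h1.bdd_smul B hφ.continuous.aestronglyMeasurable (Eventually.of_forall hB)
    refine (integrableOn_iff_integrable_of_support_subset fun z hz => ?_).1 h2
    by_contra h
    exact hz (by simp only [image_eq_zero_of_notMem_tsupport h, zero_smul])
  have hdφf : Integrable fun z => (fderiv ℝ φ z v) • f z :=
    integrable_smul_of_hasCompactSupport
      ((hφ.continuous_fderiv (by simp)).clm_apply continuous_const)
      (hφs.fderiv_apply ℝ v) hf hM
  refine ext_inner_right ℝ fun c => ?_
  set G : V → W := fun z => (φ z * ρ z * (σ z)⁻¹) • c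
  have hG : MemLp G 2 volume := by
    have hcont : ContinuousOn (fun z => φ z * ρ z * (σ z)⁻¹) (tsupport φ) := by
      refine (hφ.continuous.continuousOn.mul (hρc.mono hφΩ)).mul
        (ContinuousOn.inv₀ ?_ fun z _ => (hσ0 z).ne')
      exact Continuous.continuousOn ((continuous_const.add continuous_norm).rpow_const fun z =>
        Or.inl (by linarith [norm_nonneg z] : (0 : ℝ) < 1 + ‖z‖).ne')
    obtain ⟨B, hB⟩ := hφs.isCompact.exists_bound_of_continuousOn hcont
    have hGm : AEStronglyMeasurable G volume :=
      ((hφ.continuous.measurable.mul hρm).mul hσm.inv).aestronglyMeasurable.smul aestronglyMeasurable_const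
    refine MemLp.mono (g := (tsupport φ).indicator fun _ => B * ‖c‖)
      (memLp_indicator_const 2 hφs.isCompact.measurableSet _ (Or.inr hφs.isCompact.measure_lt_top.ne))
      hGm (Eventually.of_forall fun z => ?_)
    by_cases hz : z ∈ tsupport φ
    · rw [Set.indicator_of_mem hz, norm_smul]
      exact (mul_le_mul_of_nonneg_right (hB z hz) (norm_nonneg c)).trans (le_abs_self _)
    · simp [G, image_eq_zero_of_notMem_tsupport hz]
  have hlim2 := hq G hG
  have e2 : ∫ z, inner ℝ (q z) (G z) = inner ℝ (∫ z, φ z • g z) c := by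
    rw [real_inner_comm, ← integral_inner hφg]
    refine integral_congr_ae (Eventually.of_forall fun z => ?_)
    by_cases hz : z ∈ Ω
    · simp only [G, g, Set.indicator_of_mem hz, inner_smul_right]
      rw [real_inner_comm]; ring
    · simp [G, hφz z hz]
  have e1 : ∀ᶠ n in atTop, ∫ z, inner ℝ (Q n z) (G z) =
      inner ℝ (∫ z, ((τ n)⁻¹ * (φ (z - τ n • v) - φ z)) • f z) c := by
    filter_upwards [hev] with n hn
    have i1 := integrable_smul_of_hasCompactSupport hφ.continuous hφs (hftr (τ n • v)) (hMtr (τ n • v))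
    have i2 := integrable_smul_of_hasCompactSupport hφ.continuous hφs hf hM
    have i3 : Integrable fun z => φ (z - τ n • v) • f z := integrable_smul_of_hasCompactSupport
      (hφ.continuous.comp (by fun_prop : Continuous fun z : V => z - τ n • v))
      (hasCompactSupport_comp_sub hφs (τ n • v)) hf hM
    have e3 : ∫ z, ((τ n)⁻¹ * (φ (z - τ n • v) - φ z)) • f z =
        ∫ z, (τ n)⁻¹ • (φ z • f (z + τ n • v) - φ z • f z) := by
      rw [integral_smul, integral_sub i1 i2, integral_smul_comp_add, ← integral_sub i3 i2,
        ← integral_smul]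
      simp only [mul_smul, sub_smul]
    have i4 : Integrable fun z => (τ n)⁻¹ • (φ z • f (z + τ n • v) - φ z • f z) :=
      (i1.sub i2).smul _
    rw [e3, real_inner_comm, ← integral_inner i4]
    refine integral_congr_ae (Eventually.of_forall fun z => ?_)
    by_cases hz : φ z = 0
    · simp [G, hz]
    · have hzS := hn z hz
      have h2 := (hρ0 z hzS.1).ne'
      have h3 := (hσ0 z).ne'
      simp only [Q, G, Set.indicator_of_mem hzS, ← smul_sub, inner_smul_right, inner_smul_left,
        conj_trivial]
      rw [real_inner_comm]
      field_simp
  have hlim3 : Tendsto (fun n => ∫ z, inner ℝ (Q n z) (G z)) (hyperfilter ℕ)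
      (𝓝 (inner ℝ (-∫ z, (fderiv ℝ φ z v) • f z) c)) := by
    have h1 := (hlim1.inner (𝕜 := ℝ) (tendsto_const_nhds (x := c))).congr' (e1.mono fun n h => h.symm)
    exact h1.mono_left Nat.hyperfilter_le_atTop
  have := tendsto_nhds_unique hlim3 hlim2
  rw [e2] at this
  rw [inner_neg_left] at this ⊢
  linarith

end DifferenceQuotients

/-! ### Increments and weak derivatives -/

section Increments

set_option linter.unusedSectionVars false

variable {V W : Type*} [NormedAddCommGroup V] [NormedSpace ℝ V] [FiniteDimensional ℝ V]
  [MeasureSpace V] [BorelSpace V] [(volume : Measure V).IsAddHaarMeasure]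
  [NormedAddCommGroup W] [InnerProductSpace ℝ W] [CompleteSpace W]

lemma locallyIntegrable_of_ae_bdd {f : V → W} (hf : AEStronglyMeasurable f volume) {M : ℝ}
    (hM : ∀ᵐ z, ‖f z‖ ≤ M) : LocallyIntegrable f volume :=
  (locallyIntegrable_const M).mono hf (hM.mono fun _ hz => hz.trans (le_abs_self M))

/-- If a test-function pairing is supported in `Ω`, the set integral over `Ω` is a full integral. -/
lemma hasWeakDirDeriv_integral_eq {Ω : Set V} {v : V} {f g : V → W} (h : HasWeakDirDeriv Ω v f g)
    {φ : V → ℝ} (hφ : ContDiff ℝ ∞ φ) (hφs : HasCompactSupport φ) (hφΩ : tsupport φ ⊆ Ω) :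
    ∫ z, (fderiv ℝ φ z v) • f z = -∫ z, φ z • g z := by
  have hφz : ∀ z, z ∉ Ω → φ z = 0 := fun z hz => image_eq_zero_of_notMem_tsupport fun h => hz (hφΩ h)
  have hdφz : ∀ z, z ∉ Ω → fderiv ℝ φ z v = 0 := fun z hz => by
    have : fderiv ℝ φ z = 0 :=
      image_eq_zero_of_notMem_tsupport fun h => hz (hφΩ (tsupport_fderiv_subset ℝ h))
    rw [this]; rfl
  have h1 := h.2.2 φ hφ hφs hφΩ
  rwa [setIntegral_eq_integral_of_forall_compl_eq_zero (fun z hz => by rw [hdφz z hz, zero_smul]),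
    setIntegral_eq_integral_of_forall_compl_eq_zero (fun z hz => by rw [hφz z hz, zero_smul])] at h1

lemma fderiv_comp_sub_const (φ : V → ℝ) (w z : V) :
    fderiv ℝ (fun y => φ (y - w)) z = fderiv ℝ φ (z - w) := by
  simpa using fderiv_comp_sub (f := φ) (x := z) w

/-- The fundamental theorem of calculus along a direction, for weak derivatives. -/
theorem sub_eq_integral_of_hasWeakDirDeriv {v : V} {f g : V → W}
    (hf : AEStronglyMeasurable f volume) {M : ℝ} (hM : ∀ᵐ z, ‖f z‖ ≤ M)
    (hg : StronglyMeasurable g) {M' : ℝ} (hM' : ∀ᵐ z, ‖g z‖ ≤ M')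
    (h : HasWeakDirDeriv Set.univ v f g) :
    ∀ᵐ x, f (x + v) - f x = ∫ r in (0 : ℝ)..1, g (x + r • v) := by
  have hftr : ∀ w : V, AEStronglyMeasurable (fun z => f (z + w)) volume := fun w =>
    hf.comp_measurePreserving (measurePreserving_add_right volume w)
  have hMtr : ∀ w : V, ∀ᵐ z, ‖f (z + w)‖ ≤ M := fun w =>
    (measurePreserving_add_right volume w).quasiMeasurePreserving.ae hM
  set I : Measure ℝ := volume.restrict (Set.Ioc 0 1)
  have hgj : StronglyMeasurable fun q : V × ℝ => g (q.1 + q.2 • v) :=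
    hg.comp_measurable (by fun_prop)
  have hgb : ∀ᵐ q : V × ℝ ∂((volume : Measure V).prod I), ‖g (q.1 + q.2 • v)‖ ≤ M' := by
    have hset : MeasurableSet {q : V × ℝ | ‖g (q.1 + q.2 • v)‖ ≤ M'} :=
      measurableSet_le hgj.norm.measurable measurable_const
    rw [Measure.ae_prod_iff_ae_ae hset]
    refine (Measure.ae_ae_comm (p := fun x r => ‖g (x + r • v)‖ ≤ M') hset).2 ?_
    exact Eventually.of_forall fun r =>
      (measurePreserving_add_right volume (r • v)).quasiMeasurePreserving.ae hM'
  have hGm : StronglyMeasurable fun x : V => ∫ r, g (x + r • v) ∂I := hgj.integral_prod_right'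
  have hI : I.real Set.univ = 1 := by simp [I, Measure.real]
  have hGb : ∀ᵐ x : V, ‖∫ r, g (x + r • v) ∂I‖ ≤ M' := by
    filter_upwards [Measure.ae_ae_of_ae_prod hgb] with x hx
    simpa [hI] using norm_integral_le_of_norm_le_const hx
  simp_rw [intervalIntegral.integral_of_le zero_le_one]
  refine ae_eq_of_integral_contDiff_smul_eq
    (locallyIntegrable_of_ae_bdd ((hftr v).sub hf) (M := M + M) ?_)
    (locallyIntegrable_of_ae_bdd hGm.aestronglyMeasurable hGb) fun φ hφ hφs => ?_
  · filter_upwards [hM, hMtr v] with z h1 h2 using (norm_sub_le _ _).trans (add_le_add h2 h1)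
  have hφi := hφ.continuous.integrable_of_hasCompactSupport (μ := volume) hφs
  set D : V → ℝ := fun z => fderiv ℝ φ z v
  have hDc : Continuous D := (hφ.continuous_fderiv (by simp)).clm_apply continuous_const
  have hDs : HasCompactSupport D := hφs.fderiv_apply ℝ v
  -- joint integrability for the two applications of Fubini's theorem
  have hint1 : Integrable (fun q : V × ℝ => (-D (q.1 - q.2 • v)) • f q.1)
      ((volume : Measure V).prod I) := by
    obtain ⟨B, hB⟩ := hDc.bounded_above_of_compact_support hDs
    obtain ⟨R, hR⟩ := hDs.isCompact.isBounded.subset_closedBall (0 : V)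
    have hind : Integrable ((Metric.closedBall (0 : V) (R + ‖v‖)).indicator fun _ => B * M) volume :=
      (integrable_indicator_iff measurableSet_closedBall).2
        (integrableOn_const (measure_closedBall_lt_top).ne)
    refine (hind.comp_fst I).mono' ?_ ?_
    · refine AEStronglyMeasurable.smul ?_ hf.comp_fst
      exact Continuous.aestronglyMeasurable (by fun_prop)
    · have h1 : ∀ᵐ q : V × ℝ ∂((volume : Measure V).prod I), ‖f q.1‖ ≤ M :=
        Measure.quasiMeasurePreserving_fst.ae hM
      have h2 : ∀ᵐ q : V × ℝ ∂((volume : Measure V).prod I), q.2 ∈ Set.Ioc (0 : ℝ) 1 :=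
        Measure.quasiMeasurePreserving_snd.ae (ae_restrict_mem measurableSet_Ioc)
      filter_upwards [h1, h2] with q hq1 hq2
      by_cases hq : q.1 ∈ Metric.closedBall (0 : V) (R + ‖v‖)
      · rw [Set.indicator_of_mem hq, norm_smul, norm_neg]
        have := hB (q.1 - q.2 • v)
        gcongr
        exact (norm_nonneg _).trans this
      · rw [Set.indicator_of_notMem hq]
        have : D (q.1 - q.2 • v) = 0 := by
          by_contra hne
          have h3 := hR (subset_tsupport D (Function.mem_support.2 hne))
          rw [mem_closedBall_zero_iff] at h3 hq
          have h4 := norm_sub_norm_le q.1 (q.2 • v)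
          rw [norm_smul, Real.norm_of_nonneg hq2.1.le] at h4
          nlinarith [norm_nonneg v, hq2.2]
        simp [this]
  have hint2 : Integrable (fun q : V × ℝ => φ q.1 • g (q.1 + q.2 • v))
      ((volume : Measure V).prod I) :=
    (hφi.comp_fst I).smul_bdd M' hgj.aestronglyMeasurable hgb
  calc ∫ x, φ x • (f (x + v) - f x) = ∫ x, (φ (x - v) - φ x) • f x := by
        have i1 := integrable_smul_of_hasCompactSupport hφ.continuous hφs (hftr v) (hMtr v)
        have i2 := integrable_smul_of_hasCompactSupport hφ.continuous hφs hf hM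
        have i3 : Integrable fun z => φ (z - v) • f z := integrable_smul_of_hasCompactSupport
          (hφ.continuous.comp (by fun_prop : Continuous fun z : V => z - v))
          (hasCompactSupport_comp_sub hφs v) hf hM
        simp_rw [smul_sub, sub_smul]
        rw [integral_sub i1 i2, integral_sub i3 i2, integral_smul_comp_add]
    _ = ∫ x, ∫ r, (-D (x - r • v)) • f x ∂I := by
        refine integral_congr_ae (Eventually.of_forall fun x => ?_)
        simp only
        rw [integral_smul_const]
        congr 1
        have h1 : ∀ r ∈ Set.uIcc (0 : ℝ) 1,
            HasDerivAt (fun s : ℝ => φ (x - s • v)) (-D (x - r • v)) r :=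
          fun r _ => hasDerivAt_comp_sub_smul hφ x v r
        have h2 := intervalIntegral.integral_eq_sub_of_hasDerivAt h1
          (Continuous.intervalIntegrable (by fun_prop) _ _)
        rw [intervalIntegral.integral_of_le zero_le_one] at h2
        simpa using h2.symm
    _ = ∫ r, (∫ x, (-D (x - r • v)) • f x) ∂I := integral_integral_swap hint1
    _ = ∫ r, (∫ x, φ x • g (x + r • v)) ∂I := by
        refine integral_congr_ae (Eventually.of_forall fun r => ?_)
        simp only
        have h1 := hasWeakDirDeriv_integral_eq h (φ := fun z => φ (z - r • v))
          (hφ.comp (contDiff_id.sub contDiff_const)) (hasCompactSupport_comp_sub hφs _)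
          (Set.subset_univ _)
        simp_rw [fderiv_comp_sub_const] at h1
        simp_rw [neg_smul]
        rw [integral_neg, integral_smul_comp_add φ g (r • v)]
        rw [h1, neg_neg]
    _ = ∫ x, ∫ r, φ x • g (x + r • v) ∂I := (integral_integral_swap hint2).symm
    _ = ∫ x, φ x • ∫ r, g (x + r • v) ∂I := by simp_rw [integral_smul]

/-- Weak differentiation commutes with increments along a direction which leaves `Ω` invariant. -/
theorem weakDirDeriv_increment_ae_eq {Ω : Set V} (hΩ : IsOpen Ω) {v e : V}
    (hΩe : ∀ z, z + e ∈ Ω ↔ z ∈ Ω) {f g G : V → W}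
    (hf : AEStronglyMeasurable f volume) {M : ℝ} (hM : ∀ᵐ z, ‖f z‖ ≤ M)
    (hg : AEStronglyMeasurable g volume) {M' : ℝ} (hM' : ∀ᵐ z, ‖g z‖ ≤ M')
    (hfg : HasWeakDirDeriv Ω v f g) (hG : HasWeakDirDeriv Ω v (fun z => f (z + e) - f z) G) :
    ∀ᵐ z, z ∈ Ω → G z = g (z + e) - g z := by
  have hftr : ∀ w : V, AEStronglyMeasurable (fun z => f (z + w)) volume := fun w =>
    hf.comp_measurePreserving (measurePreserving_add_right volume w)
  have hMtr : ∀ w : V, ∀ᵐ z, ‖f (z + w)‖ ≤ M := fun w =>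
    (measurePreserving_add_right volume w).quasiMeasurePreserving.ae hM
  have hgtr : AEStronglyMeasurable (fun z => g (z + e)) volume :=
    hg.comp_measurePreserving (measurePreserving_add_right volume e)
  have hMtr' : ∀ᵐ z, ‖g (z + e)‖ ≤ M' :=
    (measurePreserving_add_right volume e).quasiMeasurePreserving.ae hM'
  have hdiffb : ∀ᵐ z, ‖g (z + e) - g z‖ ≤ M' + M' := by
    filter_upwards [hM', hMtr'] with z h1 h2 using (norm_sub_le _ _).trans (add_le_add h2 h1)
  have hdiffl := locallyIntegrable_of_ae_bdd (hgtr.sub hg) hdiffb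
  have key := hΩ.ae_eq_zero_of_integral_contDiff_smul_eq_zero (f := fun z => G z - (g (z + e) - g z))
    (μ := volume) (hG.2.1.sub (hdiffl.locallyIntegrableOn Ω)) ?_
  · filter_upwards [key] with z hz hzΩ using sub_eq_zero.1 (hz hzΩ)
  intro φ hφ hφs hφΩ
  have hDc : Continuous fun z => fderiv ℝ φ z v :=
    (hφ.continuous_fderiv (by simp)).clm_apply continuous_const
  have hDs : HasCompactSupport fun z => fderiv ℝ φ z v := hφs.fderiv_apply ℝ v
  have hsub : Continuous fun z : V => z - e := by fun_prop
  have hφΩ' : tsupport (fun z => φ (z - e)) ⊆ Ω := by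
    have h1 : tsupport (fun z => φ (z - e)) ⊆ (fun z => z - e) ⁻¹' tsupport φ :=
      closure_minimal (fun z hz => subset_tsupport φ hz) ((isClosed_tsupport φ).preimage hsub)
    intro z hz
    have := (hΩe (z - e)).2 (hφΩ (h1 hz))
    simpa using this
  have a1 := hasWeakDirDeriv_integral_eq hG hφ hφs hφΩ
  have a2 := hasWeakDirDeriv_integral_eq hfg hφ hφs hφΩ
  have a3 := hasWeakDirDeriv_integral_eq hfg (φ := fun z => φ (z - e))
    (hφ.comp (contDiff_id.sub contDiff_const)) (hasCompactSupport_comp_sub hφs _) hφΩ'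
  simp_rw [fderiv_comp_sub_const] at a3
  have i1 := integrable_smul_of_hasCompactSupport hDc hDs (hftr e) (hMtr e)
  have i2 := integrable_smul_of_hasCompactSupport hDc hDs hf hM
  simp_rw [smul_sub] at a1
  rw [integral_sub i1 i2, integral_smul_comp_add (fun z => fderiv ℝ φ z v), a3, a2] at a1
  have j1 := integrable_smul_of_hasCompactSupport hφ.continuous hφs hgtr hMtr'
  have j2 := integrable_smul_of_hasCompactSupport hφ.continuous hφs hg hM'
  have j3 : Integrable fun z => φ z • G z := by
    have h1 : IntegrableOn G (tsupport φ) volume :=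
      (locallyIntegrableOn_iff hΩ.isLocallyClosed).1 hG.2.1 _ hφΩ hφs.isCompact
    obtain ⟨B, hB⟩ := hφ.continuous.bounded_above_of_compact_support hφs
    have h2 : IntegrableOn (fun z => φ z • G z) (tsupport φ) volume :=
      h1.bdd_smul B hφ.continuous.aestronglyMeasurable (Eventually.of_forall hB)
    refine (integrableOn_iff_integrable_of_support_subset fun z hz => ?_).1 h2
    by_contra h
    exact hz (by simp only [image_eq_zero_of_notMem_tsupport h, zero_smul])
  have j4 : Integrable fun z => φ z • g (z + e) - φ z • g z := j1.sub j2
  simp_rw [smul_sub]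
  rw [integral_sub j3 j4, integral_sub j1 j2, integral_smul_comp_add φ g e]
  have a4 := neg_eq_iff_eq_neg.1 a1.symm
  rw [a4]
  abel

end Increments

/-! ### Weights in time for the Abel kernel -/

lemma integrableOn_rpow_mul_exp {μ : ℝ} (hμ : 0 < μ) :
    IntegrableOn (fun r : ℝ => r ^ (-(1 / 2) : ℝ) * Real.exp (-μ * r)) (Set.Ioi 0) := by
  simpa using integrableOn_rpow_mul_exp_neg_mul_rpow (p := 1) (s := -(1 / 2))
    (by norm_num) (by norm_num) hμ

lemma intervalIntegrable_rpow_mul_exp {μ : ℝ} (hμ : 0 < μ) {t : ℝ} (ht : 0 ≤ t) :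
    IntervalIntegrable (fun r : ℝ => r ^ (-(1 / 2) : ℝ) * Real.exp (-μ * r)) volume 0 t := by
  rw [intervalIntegrable_iff_integrableOn_Ioc_of_le ht]
  exact (integrableOn_rpow_mul_exp hμ).mono_set Set.Ioc_subset_Ioi_self

/-- The Abel kernel `r^{-1/2}` has small mass against `e^{-μr}` for large `μ`. -/
lemma exists_integral_rpow_mul_exp_le {ε : ℝ} (hε : 0 < ε) :
    ∃ μ : ℝ, 0 < μ ∧ ∀ t, 0 ≤ t → ∫ r in (0 : ℝ)..t, r ^ (-(1 / 2) : ℝ) * Real.exp (-μ * r) ≤ ε := by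
  have hval : ∀ μ : ℝ, 0 < μ → ∫ r in Set.Ioi (0 : ℝ), r ^ (-(1 / 2) : ℝ) * Real.exp (-μ * r) =
      (1 / μ) ^ (1 / 2 : ℝ) * Real.Gamma (1 / 2) := by
    intro μ hμ
    rw [← Real.integral_rpow_mul_exp_neg_mul_Ioi (by norm_num) hμ]
    norm_num
  have hG : 0 < Real.Gamma (1 / 2) := Real.Gamma_pos_of_pos (by norm_num)
  refine ⟨(Real.Gamma (1 / 2) / ε) ^ 2, by positivity, fun t ht => ?_⟩
  have hμ : 0 < (Real.Gamma (1 / 2) / ε) ^ 2 := by positivity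
  rw [intervalIntegral.integral_of_le ht]
  calc _ ≤ ∫ r in Set.Ioi (0 : ℝ), r ^ (-(1 / 2) : ℝ) *
        Real.exp (-(Real.Gamma (1 / 2) / ε) ^ 2 * r) := by
        refine setIntegral_mono_set (integrableOn_rpow_mul_exp hμ) ?_
          Set.Ioc_subset_Ioi_self.eventuallyLE
        filter_upwards [ae_restrict_mem measurableSet_Ioi] with r hr
        have : (0 : ℝ) < r := hr
        simp only [Pi.zero_apply]
        positivity
    _ = ε := by
        rw [hval _ hμ, one_div, Real.inv_rpow hμ.le, ← Real.sqrt_eq_rpow, Real.sqrt_sq (by positivity)]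
        field_simp

/-- A weight in time against which the Abel operator `m ↦ ∫₀ᵗ (t-s)^{-1/2} m(s) ds` has norm at
most `ε`. -/
def IsAbelWeight (ε : ℝ) (η : ℝ → ℝ) : Prop :=
  ∀ t, 0 < t → IntervalIntegrable (fun s => (t - s) ^ (-(1 / 2) : ℝ) * η s) volume 0 t ∧
    ∫ s in (0 : ℝ)..t, (t - s) ^ (-(1 / 2) : ℝ) * η s ≤ ε * η t

lemma intervalIntegrable_comp_sub_zero {f : ℝ → ℝ} {t : ℝ} (h : IntervalIntegrable f volume 0 t) :
    IntervalIntegrable (fun s => f (t - s)) volume 0 t := by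
  have := (h.comp_sub_left t).symm
  simpa using this

/-- Exponential weights. -/
lemma exists_isAbelWeight_exp {ε : ℝ} (hε : 0 < ε) :
    ∃ μ : ℝ, 0 < μ ∧ IsAbelWeight ε fun s => Real.exp (μ * s) := by
  obtain ⟨μ, hμ, h⟩ := exists_integral_rpow_mul_exp_le hε
  refine ⟨μ, hμ, fun t ht => ?_⟩
  have e : ∀ s, (t - s) ^ (-(1 / 2) : ℝ) * Real.exp (μ * s) =
      Real.exp (μ * t) * ((t - s) ^ (-(1 / 2) : ℝ) * Real.exp (-μ * (t - s))) := fun s => by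
    rw [mul_left_comm, ← Real.exp_add]; congr 2; ring
  simp_rw [e]
  refine ⟨(intervalIntegrable_comp_sub_zero (intervalIntegrable_rpow_mul_exp hμ ht.le)).const_mul _, ?_⟩
  rw [intervalIntegral.integral_const_mul, mul_comm ε]
  gcongr
  have := intervalIntegral.integral_comp_sub_left (a := 0) (b := t)
    (fun r : ℝ => r ^ (-(1 / 2) : ℝ) * Real.exp (-μ * r)) t
  rw [this]
  simpa using h t ht.le

/-- Exponential weights with the singularity `s^{-1/2}` at the initial time. -/
lemma exists_isAbelWeight_rpow_mul_exp {ε : ℝ} (hε : 0 < ε) :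
    ∃ μ : ℝ, 0 < μ ∧ IsAbelWeight ε fun s => s ^ (-(1 / 2) : ℝ) * Real.exp (μ * s) := by
  obtain ⟨μ, hμ, h⟩ := exists_integral_rpow_mul_exp_le (ε := ε / 3) (by positivity)
  refine ⟨μ, hμ, fun t ht => ?_⟩
  set κ : ℝ → ℝ := fun r => r ^ (-(1 / 2) : ℝ) * Real.exp (-μ * r)
  have hκ := intervalIntegrable_rpow_mul_exp hμ ht.le
  have hκ' := intervalIntegrable_comp_sub_zero hκ
  have hdom : IntervalIntegrable (fun s => t ^ (-(1 / 2) : ℝ) * Real.exp (μ * t) *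
      (2 * κ (t - s) + κ s)) volume 0 t := ((hκ'.const_mul 2).add hκ).const_mul _
  have hpt : ∀ s ∈ Set.Ioo 0 t, (t - s) ^ (-(1 / 2) : ℝ) * (s ^ (-(1 / 2) : ℝ) * Real.exp (μ * s)) ≤
      t ^ (-(1 / 2) : ℝ) * Real.exp (μ * t) * (2 * κ (t - s) + κ s) := by
    rintro s ⟨hs0, hst⟩
    have hr0 : 0 < t - s := sub_pos.2 hst
    have hp : 0 < (t - s) ^ (-(1 / 2) : ℝ) := by positivity
    have hq : 0 < s ^ (-(1 / 2) : ℝ) := by positivity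
    -- `√t ≤ √(t - s) + √s`
    have h1 : (t - s) ^ (-(1 / 2) : ℝ) * s ^ (-(1 / 2) : ℝ) ≤
        t ^ (-(1 / 2) : ℝ) * (s ^ (-(1 / 2) : ℝ) + (t - s) ^ (-(1 / 2) : ℝ)) := by
      rw [Real.rpow_neg hr0.le, Real.rpow_neg hs0.le, Real.rpow_neg ht.le, ← Real.sqrt_eq_rpow,
        ← Real.sqrt_eq_rpow, ← Real.sqrt_eq_rpow]
      have a1 := Real.sqrt_pos.2 hr0
      have a2 := Real.sqrt_pos.2 hs0
      have a3 := Real.sqrt_pos.2 ht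
      have a4 : √t ≤ √(t - s) + √s := by
        refine Real.sqrt_le_iff.2 ⟨by positivity, ?_⟩
        nlinarith [Real.sq_sqrt hr0.le, Real.sq_sqrt hs0.le]
      rw [← mul_inv, inv_add_inv a2.ne' a1.ne', ← div_eq_inv_mul, div_div, ← one_div,
        div_le_div_iff₀ (by positivity) (by positivity)]
      nlinarith [mul_pos a1 a2]
    -- whichever of `s` and `t - s` is smaller carries the singularity
    have h2 : s ^ (-(1 / 2) : ℝ) * Real.exp (-μ * (t - s)) ≤ κ (t - s) + κ s := by
      rcases le_total s (t - s) with hle | hle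
      · have : Real.exp (-μ * (t - s)) ≤ Real.exp (-μ * s) := by
          exact Real.exp_le_exp.2 (by nlinarith)
        have h3 : 0 ≤ κ (t - s) := by simp only [κ]; positivity
        have h4 : s ^ (-(1 / 2) : ℝ) * Real.exp (-μ * (t - s)) ≤ κ s := by
          simp only [κ]; gcongr
        linarith
      · have : s ^ (-(1 / 2) : ℝ) ≤ (t - s) ^ (-(1 / 2) : ℝ) :=
          Real.rpow_le_rpow_of_nonpos hr0 hle (by norm_num)
        have h3 : 0 ≤ κ s := by simp only [κ]; positivity
        have h4 : s ^ (-(1 / 2) : ℝ) * Real.exp (-μ * (t - s)) ≤ κ (t - s) := by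
          simp only [κ]; gcongr
        linarith
    have e : Real.exp (μ * s) = Real.exp (μ * t) * Real.exp (-μ * (t - s)) := by
      rw [← Real.exp_add]; congr 1; ring
    have ht' : 0 < t ^ (-(1 / 2) : ℝ) := by positivity
    calc _ = ((t - s) ^ (-(1 / 2) : ℝ) * s ^ (-(1 / 2) : ℝ)) *
          (Real.exp (μ * t) * Real.exp (-μ * (t - s))) := by rw [e]; ring
      _ ≤ (t ^ (-(1 / 2) : ℝ) * (s ^ (-(1 / 2) : ℝ) + (t - s) ^ (-(1 / 2) : ℝ))) *
          (Real.exp (μ * t) * Real.exp (-μ * (t - s))) := by gcongr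
      _ = t ^ (-(1 / 2) : ℝ) * Real.exp (μ * t) *
          (s ^ (-(1 / 2) : ℝ) * Real.exp (-μ * (t - s)) + κ (t - s)) := by simp only [κ]; ring
      _ ≤ _ := mul_le_mul_of_nonneg_left (by linarith) (by positivity)
  have hae : ∀ᵐ s ∂(volume.restrict (Set.Ioc 0 t)), s ∈ Set.Ioo 0 t := by
    filter_upwards [ae_restrict_mem measurableSet_Ioc, Measure.ae_ne (volume.restrict _) t] with s hs hst
    exact ⟨hs.1, lt_of_le_of_ne hs.2 hst⟩
  have hint : IntervalIntegrable (fun s => (t - s) ^ (-(1 / 2) : ℝ) *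
      (s ^ (-(1 / 2) : ℝ) * Real.exp (μ * s))) volume 0 t := by
    refine hdom.mono_fun' (Measurable.aestronglyMeasurable (by fun_prop)) ?_
    rw [Set.uIoc_of_le ht.le]
    filter_upwards [hae] with s hs
    have h0 : 0 < s := hs.1
    have hr0 : 0 < t - s := sub_pos.2 hs.2
    rw [Real.norm_of_nonneg (by positivity)]
    exact hpt s hs
  refine ⟨hint, ?_⟩
  calc _ ≤ ∫ s in (0 : ℝ)..t, t ^ (-(1 / 2) : ℝ) * Real.exp (μ * t) * (2 * κ (t - s) + κ s) := by
        rw [intervalIntegral.integral_of_le ht.le, intervalIntegral.integral_of_le ht.le]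
        refine setIntegral_mono_ae_restrict ?_ ?_ (hae.mono hpt)
        · exact (intervalIntegrable_iff_integrableOn_Ioc_of_le ht.le).1 hint
        · exact (intervalIntegrable_iff_integrableOn_Ioc_of_le ht.le).1 hdom
    _ = t ^ (-(1 / 2) : ℝ) * Real.exp (μ * t) *
          (2 * (∫ r in (0 : ℝ)..t, κ r) + ∫ r in (0 : ℝ)..t, κ r) := by
        rw [intervalIntegral.integral_const_mul, intervalIntegral.integral_add (hκ'.const_mul 2) hκ,
          intervalIntegral.integral_const_mul, intervalIntegral.integral_comp_sub_left κ t,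
          sub_self, sub_zero]
    _ ≤ t ^ (-(1 / 2) : ℝ) * Real.exp (μ * t) * (2 * (ε / 3) + ε / 3) := by
        gcongr <;> exact h t ht.le
    _ = _ := by ring

/-- A Gronwall argument without measurability of the norms in time: if every bound `M` improves to
`C + M / 2`, then some bound improves to `2 C`. -/
lemma norm_le_two_mul_of_improve {d : ℕ} {I : Set ℝ} {V : ℝ → Vec d → Vec d} {b : ℝ → Vec d → ℝ}
    (hb : ∀ t x, 0 ≤ b t x) {C M : ℝ} (hM : 0 ≤ M) (hC : 0 ≤ C)
    (h0 : ∀ t ∈ I, ∀ᵐ x, ‖V t x‖ ≤ M * b t x)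
    (himp : ∀ M, 0 ≤ M → (∀ t ∈ I, ∀ᵐ x, ‖V t x‖ ≤ M * b t x) →
      ∀ t ∈ I, ∀ᵐ x, ‖V t x‖ ≤ (C + M / 2) * b t x) :
    ∀ t ∈ I, ∀ᵐ x, ‖V t x‖ ≤ 2 * C * b t x := by
  have key : ∀ n : ℕ, ∀ t ∈ I, ∀ᵐ x, ‖V t x‖ ≤ (2 * C + M / 2 ^ n) * b t x := by
    intro n
    induction n with
    | zero =>
      intro t ht
      filter_upwards [h0 t ht] with x hx
      rw [pow_zero, div_one]
      nlinarith [mul_nonneg hC (hb t x)]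
    | succ n ih =>
      intro t ht
      filter_upwards [himp _ (by positivity) ih t ht] with x hx
      convert hx using 2
      rw [pow_succ]; field_simp; ring
  intro t ht
  filter_upwards [ae_all_iff.2 fun n => key n t ht] with x hx
  have hlim : Tendsto (fun n : ℕ => (2 * C + M / 2 ^ n) * b t x) atTop (𝓝 ((2 * C + 0) * b t x)) :=
    ((tendsto_const_nhds.add
      (tendsto_const_nhds.div_atTop (tendsto_pow_atTop_atTop_of_one_lt one_lt_two))).mul_const _)
  rw [add_zero] at hlim
  exact ge_of_tendsto' hlim hx

/-! ### The Duhamel operator and a pointwise representative -/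

/-- The Duhamel term with a general source tensor in place of `u ⊗ u`. -/
def duhamelOf {d : ℕ} (P : Fin d → Fin d → ℝ → Vec d → ℝ) (j : Fin d) (t : ℝ) (x : Vec d) : ℝ :=
  ∑ h : Fin d, ∑ k : Fin d,
    ∫ s in (0 : ℝ)..t, ∫ y : Vec d, oseenKernel j h k (t - s) (x - y) * P h k s y

lemma duhamelOf_comp_add {d : ℕ} (P : Fin d → Fin d → ℝ → Vec d → ℝ) (j : Fin d) (t : ℝ)
    (x e : Vec d) :
    duhamelOf P j t (x + e) = duhamelOf (fun h k s y => P h k s (y + e)) j t x := by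
  unfold duhamelOf
  refine Finset.sum_congr rfl fun h _ => Finset.sum_congr rfl fun k _ => ?_
  refine intervalIntegral.integral_congr fun s _ => ?_
  have := integral_add_right_eq_self (μ := (volume : Measure (Vec d)))
    (fun y => oseenKernel j h k (t - s) (x + e - y) * P h k s y) e
  simpa using this.symm

lemma duhamelOf_sub {d : ℕ} {ϑ : ℝ} (hϑ₀ : 0 ≤ ϑ) (hϑ₁ : ϑ ≤ (d : ℝ) + 1)
    {P Q : Fin d → Fin d → ℝ → Vec d → ℝ} (hP : ∀ h k, Measurable (Function.uncurry (P h k)))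
    (hQ : ∀ h k, Measurable (Function.uncurry (Q h k))) {M : ℝ}
    (hPM : ∀ h k s y, |P h k s y| ≤ M * wt ϑ y ^ 2) (hQM : ∀ h k s y, |Q h k s y| ≤ M * wt ϑ y ^ 2)
    (j : Fin d) {t : ℝ} (ht : 0 ≤ t) (x : Vec d) :
    duhamelOf (fun h k s y => P h k s y - Q h k s y) j t x = duhamelOf P j t x - duhamelOf Q j t x := by
  have hM : 0 ≤ M := nonneg_of_mul_nonneg_left ((abs_nonneg _).trans (hPM j j 0 0))
    (pow_pos (wt_pos ϑ 0) 2)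
  have hb : ∀ y : Vec d, M * wt ϑ y ^ 2 ≤ M := fun y =>
    mul_le_of_le_one_right hM (pow_le_one₀ (wt_pos ϑ y).le (wt_le_one hϑ₀ y))
  unfold duhamelOf
  simp_rw [← Finset.sum_sub_distrib]
  refine Finset.sum_congr rfl fun h _ => Finset.sum_congr rfl fun k _ => ?_
  rw [← intervalIntegral.integral_sub
    (intervalIntegrable_integral_oseenKernel_mul hϑ₀ hϑ₁ j h k ht le_rfl (hP h k)
      (fun s _ y => hPM h k s y) x)
    (intervalIntegrable_integral_oseenKernel_mul hϑ₀ hϑ₁ j h k ht le_rfl (hQ h k)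
      (fun s _ y => hQM h k s y) x)]
  refine intervalIntegral.integral_congr_ae ?_
  filter_upwards [Measure.ae_ne volume t] with s hst hs
  rw [Set.uIoc_of_le ht] at hs
  have hs' : 0 < t - s := sub_pos.2 (lt_of_le_of_ne hs.2 hst)
  have hPs : Measurable (P h k s) := (hP h k).comp (f := fun y : Vec d => (s, y)) (by fun_prop)
  have hQs : Measurable (Q h k s) := (hQ h k).comp (f := fun y : Vec d => (s, y)) (by fun_prop)
  rw [← integral_sub
    (integrable_oseenKernel_mul j h k hs' x hPs.aestronglyMeasurable
      (Eventually.of_forall fun y => (hPM h k s y).trans (hb y)))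
    (integrable_oseenKernel_mul j h k hs' x hQs.aestronglyMeasurable
      (Eventually.of_forall fun y => (hQM h k s y).trans (hb y)))]
  simp_rw [mul_sub]

theorem exists_abs_duhamelOf_le {d : ℕ} {ϑ : ℝ} (hϑ₀ : 0 ≤ ϑ) (hϑ₁ : ϑ ≤ (d : ℝ) + 1) (T : ℝ) :
    ∃ C, 0 ≤ C ∧ ∀ (j : Fin d) (t : ℝ), 0 < t → t ≤ T →
      ∀ (P : Fin d → Fin d → ℝ → Vec d → ℝ) (m : ℝ → ℝ),
      (∀ h k, ∀ s ∈ Set.Ioo 0 t, ∀ᵐ y, |P h k s y| ≤ m s * wt ϑ y ^ 2) →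
      IntervalIntegrable (fun s => (t - s) ^ (-(1 / 2) : ℝ) * m s) volume 0 t → ∀ x : Vec d,
      |duhamelOf P j t x| ≤ C * (∫ s in (0 : ℝ)..t, (t - s) ^ (-(1 / 2) : ℝ) * m s) * wt ϑ x := by
  obtain ⟨C, hC0, hC⟩ := exists_abs_duhamel_le (d := d) hϑ₀ hϑ₁ T
  refine ⟨d * (d * C), by positivity, fun j t ht htT P m hP hm x => ?_⟩
  unfold duhamelOf
  set J := ∫ s in (0 : ℝ)..t, (t - s) ^ (-(1 / 2) : ℝ) * m s
  calc _ ≤ ∑ h : Fin d, ∑ k : Fin d, C * J * wt ϑ x := by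
        refine (Finset.abs_sum_le_sum_abs _ _).trans (Finset.sum_le_sum fun h _ => ?_)
        refine (Finset.abs_sum_le_sum_abs _ _).trans (Finset.sum_le_sum fun k _ => ?_)
        exact hC j h k t 0 t ht.le le_rfl (by linarith) (P h k) m (hP h k) hm x
    _ = _ := by simp; ring

lemma norm_le_of_coord_le {d : ℕ} {v : Vec d} {c : ℝ} (h : ∀ j, |v j| ≤ c) : ‖v‖ ≤ d * c := by
  calc ‖v‖ = ‖∑ j, v j • EuclideanSpace.basisFun (Fin d) ℝ j‖ := by
        congr 1
        simpa using ((EuclideanSpace.basisFun (Fin d) ℝ).sum_repr v).symm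
    _ ≤ ∑ j : Fin d, c := by
        refine norm_sum_le_of_le _ fun j _ => ?_
        rw [norm_smul]
        simpa using h j
    _ = _ := by simp

lemma integral_sub_rpow (t : ℝ) :
    ∫ s in (0 : ℝ)..t, (t - s) ^ (-(1 / 2) : ℝ) = 2 * √t := by
  rw [intervalIntegral.integral_comp_sub_left (fun r : ℝ => r ^ (-(1 / 2) : ℝ)) t, sub_self, sub_zero,
    integral_rpow (Or.inl (by norm_num)), Real.sqrt_eq_rpow]
  norm_num
  ring

lemma measurable_duhamelOf {d : ℕ} {P : Fin d → Fin d → ℝ → Vec d → ℝ}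
    (hP : ∀ h k, Measurable (Function.uncurry (P h k))) (j : Fin d) :
    Measurable fun q : ℝ × Vec d => duhamelOf P j q.1 q.2 := by
  have key : ∀ h k, Measurable fun q : ℝ × Vec d =>
      ∫ s in (0 : ℝ)..q.1, ∫ y : Vec d, oseenKernel j h k (q.1 - s) (q.2 - y) * P h k s y := by
    intro h k
    have h1 := measurable_integral_oseenKernel_mul j h k (hP h k)
    set Φ : (ℝ × Vec d) × ℝ → ℝ := fun q =>
      ∫ y, oseenKernel j h k (q.1.1 - q.2) (q.1.2 - y) * P h k q.2 y
    have hpos : MeasurableSet {z : (ℝ × Vec d) × ℝ | z.2 ∈ Set.Ioc 0 z.1.1} :=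
      (measurableSet_lt measurable_const measurable_snd).inter
        (measurableSet_le measurable_snd measurable_fst.fst)
    have hneg : MeasurableSet {z : (ℝ × Vec d) × ℝ | z.2 ∈ Set.Ioc z.1.1 0} :=
      (measurableSet_lt measurable_fst.fst measurable_snd).inter
        (measurableSet_le measurable_snd measurable_const)
    have e : ∀ q : ℝ × Vec d, ∫ s in (0 : ℝ)..q.1, Φ (q, s) =
        (∫ s, {z : (ℝ × Vec d) × ℝ | z.2 ∈ Set.Ioc 0 z.1.1}.indicator Φ (q, s)) -
        ∫ s, {z : (ℝ × Vec d) × ℝ | z.2 ∈ Set.Ioc z.1.1 0}.indicator Φ (q, s) := by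
      intro q
      rw [intervalIntegral, ← integral_indicator measurableSet_Ioc, ← integral_indicator measurableSet_Ioc]
      rfl
    change Measurable fun q : ℝ × Vec d => ∫ s in (0 : ℝ)..q.1, Φ (q, s)
    simp_rw [e]
    exact ((h1.indicator hpos).stronglyMeasurable.integral_prod_right'.sub
      (h1.indicator hneg).stronglyMeasurable.integral_prod_right').measurable
  unfold duhamelOf
  exact Finset.measurable_sum _ fun h _ => Finset.measurable_sum _ fun k _ => key h k

/-- The quadratic source `u_h u_k`. -/
def tensorSquare {d : ℕ} (u : ℝ → Vec d → Vec d) (h k : Fin d) (s : ℝ) (y : Vec d) : ℝ :=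
  u s y h * u s y k

lemma measurable_tensorSquare {d : ℕ} {u : ℝ → Vec d → Vec d}
    (hu : Measurable (Function.uncurry u)) (h k : Fin d) :
    Measurable (Function.uncurry (tensorSquare u h k)) := by
  have h1 : ∀ l : Fin d, Measurable fun q : ℝ × Vec d => Function.uncurry u q l := fun l =>
    (EuclideanSpace.proj (𝕜 := ℝ) l).continuous.measurable.comp hu
  exact (h1 h).mul (h1 k)

lemma abs_tensorSquare_le {d : ℕ} {ϑ A : ℝ} {u : ℝ → Vec d → Vec d}
    (hu : ∀ t x, ‖u t x‖ ≤ A * wt ϑ x) (h k : Fin d) (s : ℝ) (y : Vec d) :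
    |tensorSquare u h k s y| ≤ A ^ 2 * wt ϑ y ^ 2 := by
  rw [tensorSquare, abs_mul, ← mul_pow, sq]
  have h1 := (coord_le_norm h (u s y)).trans (hu s y)
  have h2 := (coord_le_norm k (u s y)).trans (hu s y)
  gcongr
  exact (abs_nonneg _).trans h1

lemma duhamelTerm_congr_ae {d : ℕ} {u v : ℝ → Vec d → Vec d} {T : ℝ}
    (h : ∀ᵐ s ∂(volume.restrict (Set.Ioo 0 T)), u s =ᵐ[volume] v s) (j : Fin d) {t : ℝ}
    (ht : t ∈ Set.Ioo 0 T) (x : Vec d) : duhamelTerm u j t x = duhamelTerm v j t x := by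
  unfold duhamelTerm
  refine Finset.sum_congr rfl fun i _ => Finset.sum_congr rfl fun k _ => ?_
  refine intervalIntegral.integral_congr_ae ?_
  have h' := (ae_restrict_iff' measurableSet_Ioo).1 h
  filter_upwards [h'] with s hs hst
  rw [Set.uIoc_of_le ht.1.le] at hst
  refine integral_congr_ae ?_
  filter_upwards [hs ⟨hst.1, hst.2.trans_lt ht.2⟩] with y hy
  rw [hy]

/-- A mild solution has a jointly measurable representative which satisfies the pointwise bound and
the integral equation everywhere: the right-hand side of the equation. -/
theorem exists_everywhere_mild_representative {d : ℕ} {T ϑ : ℝ} (hϑ₀ : 0 ≤ ϑ)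
    (hϑ₁ : ϑ ≤ (d : ℝ) + 1) {a : Vec d → Vec d} {u : ℝ → Vec d → Vec d}
    (ha : MemWeighted ϑ a) (hu : MemLinftyWeighted T ϑ u) (hsol : IsMildSolution T a u) :
    ∃ (a' : Vec d → Vec d) (U : ℝ → Vec d → Vec d) (A : ℝ), 0 ≤ A ∧
      Measurable a' ∧ a =ᵐ[volume] a' ∧ (∀ x, ‖a' x‖ ≤ A * wt ϑ x) ∧
      Measurable (Function.uncurry U) ∧ (∀ t x, ‖U t x‖ ≤ A * wt ϑ x) ∧
      (∀ t ∈ Set.Ioo 0 T, ∀ x j, U t x j = heatFlow t a' x j - duhamelOf (tensorSquare U) j t x) ∧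
      Function.uncurry u =ᵐ[(volume.restrict (Set.Ioo 0 T)).prod volume] Function.uncurry U := by
  obtain ⟨hu_m, C, hC⟩ := hu
  obtain ⟨ha_m, C', hC'⟩ := ha
  rw [← restrict_Ioo_eq_restrict_Icc] at hu_m hC
  -- measurable representatives obeying the bounds everywhere
  set B := max 0 (max C C')
  have hB : 0 ≤ B := le_max_left _ _
  set a₁ := ha_m.mk a
  have ha₁ : Measurable a₁ := ha_m.stronglyMeasurable_mk.measurable
  set a' : Vec d → Vec d := {x | ‖a₁ x‖ ≤ B * wt ϑ x}.indicator a₁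
  have ha' : Measurable a' := ha₁.indicator
    (measurableSet_le ha₁.norm ((measurable_wt ϑ).const_mul B))
  have haa' : a =ᵐ[volume] a' := by
    filter_upwards [ha_m.ae_eq_mk, hC'] with x h1 h2
    have h3 : ‖a₁ x‖ ≤ B * wt ϑ x := by
      rw [← weight_mul_le_iff]
      change (1 + ‖x‖) ^ ϑ * ‖ha_m.mk a x‖ ≤ B
      rw [← h1]
      exact h2.trans ((le_max_right _ _).trans (le_max_right _ _))
    rw [h1]
    exact (Set.indicator_of_mem (s := {x | ‖a₁ x‖ ≤ B * wt ϑ x}) h3 a₁).symm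
  have ha'b : ∀ x, ‖a' x‖ ≤ B * wt ϑ x := by
    intro x
    by_cases hx : x ∈ {x | ‖a₁ x‖ ≤ B * wt ϑ x}
    · simp only [a', Set.indicator_of_mem hx]; exact hx
    · simp only [a', Set.indicator_of_notMem hx, norm_zero]
      exact mul_nonneg hB (wt_pos ϑ x).le
  set u₁ := hu_m.mk (Function.uncurry u)
  have hu₁ : Measurable u₁ := hu_m.stronglyMeasurable_mk.measurable
  have hw2 : Measurable fun q : ℝ × Vec d => B * wt ϑ q.2 :=
    ((measurable_wt ϑ).comp measurable_snd).const_mul B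
  set u' : ℝ → Vec d → Vec d := fun t x => {q : ℝ × Vec d | ‖u₁ q‖ ≤ B * wt ϑ q.2}.indicator u₁ (t, x)
  have hu' : Measurable (Function.uncurry u') := hu₁.indicator (measurableSet_le hu₁.norm hw2)
  have hu'b : ∀ t x, ‖u' t x‖ ≤ B * wt ϑ x := by
    intro t x
    by_cases hx : (t, x) ∈ {q : ℝ × Vec d | ‖u₁ q‖ ≤ B * wt ϑ q.2}
    · simp only [u', Set.indicator_of_mem hx]; exact hx
    · simp only [u', Set.indicator_of_notMem hx, norm_zero]
      exact mul_nonneg hB (wt_pos ϑ x).le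
  have hu1ae : ∀ᵐ t ∂(volume.restrict (Set.Ioo 0 T)), ∀ᵐ x, u t x = u₁ (t, x) :=
    Measure.ae_ae_of_ae_prod hu_m.ae_eq_mk
  have huu' : ∀ᵐ t ∂(volume.restrict (Set.Ioo 0 T)), u t =ᵐ[volume] u' t := by
    filter_upwards [hu1ae, hC] with t h1 h2
    filter_upwards [h1, h2] with x h1 h2
    have h3 : ‖u₁ (t, x)‖ ≤ B * wt ϑ x := by
      rw [← weight_mul_le_iff, ← h1]
      exact h2.trans ((le_max_left _ _).trans (le_max_right _ _))
    rw [h1]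
    exact (Set.indicator_of_mem (s := {q : ℝ × Vec d | ‖u₁ q‖ ≤ B * wt ϑ q.2}) h3 u₁).symm
  obtain ⟨K₁, hK₁, hheat⟩ := exists_norm_heatFlow_le (d := d) hϑ₀ T
  obtain ⟨K₂, hK₂, hduh⟩ := exists_abs_duhamelOf_le (d := d) hϑ₀ hϑ₁ T
  -- the right-hand side of the integral equation, which is defined at every point
  set N : ℝ → Vec d → Vec d := fun t x =>
    WithLp.toLp 2 fun j => heatFlow t a' x j - duhamelOf (tensorSquare u') j t x
  have hN : Measurable (Function.uncurry N) := by
    refine (WithLp.measurable_toLp 2 (Fin d → ℝ)).comp (measurable_pi_lambda _ fun j => ?_)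
    refine Measurable.sub ?_ (measurable_duhamelOf (measurable_tensorSquare hu') j)
    exact (EuclideanSpace.proj (𝕜 := ℝ) j).continuous.measurable.comp (measurable_heatFlow ha')
  set A := max B (d * (K₁ * B + K₂ * (2 * √T * B ^ 2)))
  set U : ℝ → Vec d → Vec d := fun t x =>
    {q : ℝ × Vec d | q.1 ∈ Set.Ioo 0 T}.indicator (Function.uncurry N) (t, x)
  have hUt : ∀ t ∈ Set.Ioo 0 T, ∀ x, U t x = N t x := fun t ht x =>
    Set.indicator_of_mem (s := {q : ℝ × Vec d | q.1 ∈ Set.Ioo 0 T}) ht _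
  have hNb : ∀ t ∈ Set.Ioo 0 T, ∀ x, ‖N t x‖ ≤ A * wt ϑ x := by
    intro t ht x
    have hw := (wt_pos ϑ x).le
    have hj : ∀ j, |N t x j| ≤ (K₁ * B + K₂ * (2 * √T * B ^ 2)) * wt ϑ x := by
      intro j
      have h1 : |heatFlow t a' x j| ≤ K₁ * B * wt ϑ x :=
        (coord_le_norm j _).trans (hheat t ht.1 ht.2.le a' B (Eventually.of_forall ha'b) x)
      have h2 := hduh j t ht.1 ht.2.le (tensorSquare u') (fun _ => B ^ 2)
        (fun h k s _ => Eventually.of_forall fun y => abs_tensorSquare_le hu'b h k s y)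
        ((intervalIntegrable_sub_rpow t 0 t).mul_const _) x
      rw [intervalIntegral.integral_mul_const, integral_sub_rpow] at h2
      have h3 : K₂ * (2 * √t * B ^ 2) * wt ϑ x ≤ K₂ * (2 * √T * B ^ 2) * wt ϑ x := by
        have := Real.sqrt_le_sqrt ht.2.le
        gcongr
      change |heatFlow t a' x j - duhamelOf (tensorSquare u') j t x| ≤ _
      rw [add_mul]
      exact (abs_sub _ _).trans (add_le_add h1 (h2.trans h3))
    calc ‖N t x‖ ≤ d * ((K₁ * B + K₂ * (2 * √T * B ^ 2)) * wt ϑ x) := norm_le_of_coord_le hj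
      _ = (d * (K₁ * B + K₂ * (2 * √T * B ^ 2))) * wt ϑ x := by ring
      _ ≤ _ := by gcongr; exact le_max_right _ _
  have hUu : ∀ᵐ t ∂(volume.restrict (Set.Ioo 0 T)), u t =ᵐ[volume] U t := by
    filter_upwards [hsol.2, ae_restrict_mem measurableSet_Ioo] with t h1 ht
    filter_upwards [h1] with x hx
    rw [hUt t ht x]
    ext j
    rw [hx j, duhamelTerm_congr_ae huu' j ht x, heatFlow_congr_ae t haa']
    rfl
  have hUm : Measurable (Function.uncurry U) := hN.indicator (measurable_fst measurableSet_Ioo)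
  have hA : 0 ≤ A := hB.trans (le_max_left _ _)
  refine ⟨a', U, A, hA, ha', haa', fun x => (ha'b x).trans ?_, hUm, fun t x => ?_,
    fun t ht x j => ?_, ?_⟩
  · have := (wt_pos ϑ x).le
    gcongr
    exact le_max_left _ _
  · by_cases ht : t ∈ Set.Ioo 0 T
    · rw [hUt t ht]; exact hNb t ht x
    · have : U t x = 0 := Set.indicator_of_notMem (s := {q : ℝ × Vec d | q.1 ∈ Set.Ioo 0 T}) ht _
      rw [this, norm_zero]
      exact mul_nonneg hA (wt_pos ϑ x).le
  · rw [hUt t ht]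
    have h1 : ∀ᵐ s ∂(volume.restrict (Set.Ioo 0 T)), u' s =ᵐ[volume] U s := by
      filter_upwards [huu', hUu] with s h1 h2 using h1.symm.trans h2
    change _ - duhamelTerm u' j t x = _ - duhamelTerm U j t x
    rw [duhamelTerm_congr_ae h1 j ht x]
  · refine hu_m.ae_eq_mk.trans ?_
    have hset : MeasurableSet {q : ℝ × Vec d | u₁ q = Function.uncurry U q} :=
      measurableSet_eq_fun hu₁ hUm
    refine (Measure.ae_prod_iff_ae_ae hset).2 ?_
    filter_upwards [hu1ae, hUu] with t h1 h2
    filter_upwards [h1, h2] with x h1 h2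
    rw [← h1]; exact h2

/-! ### The a priori estimate -/

/-- `V` is driven by the datum `b` and the source tensor `P` through the linear Duhamel formula. -/
def IsLinMild {d : ℕ} (T : ℝ) (b : Vec d → Vec d) (V : ℝ → Vec d → Vec d)
    (P : Fin d → Fin d → ℝ → Vec d → ℝ) : Prop :=
  ∀ t ∈ Set.Ioo 0 T, ∀ x j, V t x j = heatFlow t b x j - duhamelOf P j t x

lemma abs_comp_add_le {d : ℕ} {ϑ : ℝ} (hϑ₀ : 0 ≤ ϑ) {M : ℝ} (hM : 0 ≤ M) {p : Vec d → ℝ}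
    (hp : ∀ y, |p y| ≤ M * wt ϑ y ^ 2) (e y : Vec d) :
    |p (y + e)| ≤ M * ((1 + ‖e‖) ^ ϑ) ^ 2 * wt ϑ y ^ 2 := by
  refine (hp _).trans ?_
  rw [mul_assoc, ← mul_pow]
  have := (wt_pos ϑ (y + e)).le
  gcongr
  exact wt_add_le hϑ₀ y e

lemma one_le_one_add_norm_rpow_sq {d : ℕ} {ϑ : ℝ} (hϑ₀ : 0 ≤ ϑ) (e : Vec d) :
    1 ≤ ((1 + ‖e‖) ^ ϑ) ^ 2 :=
  one_le_pow₀ (Real.one_le_rpow (by linarith [norm_nonneg e]) hϑ₀)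

/-- The linear Duhamel formula is translation invariant, hence passes to increments in space. -/
lemma IsLinMild.increment {d : ℕ} {T ϑ : ℝ} (hϑ₀ : 0 ≤ ϑ) (hϑ₁ : ϑ ≤ (d : ℝ) + 1)
    {b : Vec d → Vec d} {V : ℝ → Vec d → Vec d} {P : Fin d → Fin d → ℝ → Vec d → ℝ}
    (h : IsLinMild T b V P) (hb : Measurable b) {M : ℝ} (hM : 0 ≤ M) (hbM : ∀ x, ‖b x‖ ≤ M)
    (hP : ∀ h k, Measurable (Function.uncurry (P h k)))
    (hPM : ∀ h k s y, |P h k s y| ≤ M * wt ϑ y ^ 2) (e : Vec d) :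
    IsLinMild T (fun y => b (y + e) - b y) (fun t x => V t (x + e) - V t x)
      (fun h k s y => P h k s (y + e) - P h k s y) := by
  intro t ht x j
  have hPe : ∀ h k, Measurable (Function.uncurry fun s y => P h k s (y + e)) := fun h k =>
    (hP h k).comp (f := fun q : ℝ × Vec d => (q.1, q.2 + e)) (by fun_prop)
  have h1 := duhamelOf_sub hϑ₀ hϑ₁ (P := fun h k s y => P h k s (y + e)) (Q := P)
    (M := M * ((1 + ‖e‖) ^ ϑ) ^ 2) hPe hP
    (fun h k s y => abs_comp_add_le hϑ₀ hM (hPM h k s) e y)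
    (fun h k s y => (hPM h k s y).trans (by
      have := one_le_one_add_norm_rpow_sq hϑ₀ e
      gcongr
      nlinarith)) j ht.1.le x
  have h2 := heatFlow_sub ht.1 (a := fun y => b (y + e)) (hb.comp (by fun_prop)) hb
    (Eventually.of_forall fun y => hbM (y + e)) (Eventually.of_forall hbM) x
  rw [h1, h2, ← duhamelOf_comp_add, ← heatFlow_comp_add ht.1]
  simp only [PiLp.sub_apply]
  rw [h t ht (x + e) j, h t ht x j]
  ring

/-- The a priori estimate behind all three bounds on increments. In a norm weighted in time by `η`
the Duhamel operator is a contraction, so a qualitative bound on `V` improves to one by the size of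
the free part `H` and of the part of the source not controlled by `V`. -/
theorem exists_gronwall_estimate {d : ℕ} {ϑ : ℝ} (hϑ₀ : 0 ≤ ϑ) (hϑ₁ : ϑ ≤ (d : ℝ) + 1) (T : ℝ)
    {A : ℝ} (hA : 0 ≤ A) :
    ∃ ε, 0 < ε ∧ ∀ η : ℝ → ℝ, IsAbelWeight ε η → (∀ t, 0 ≤ η t) →
      ∀ (T₀ : ℝ), T₀ ≤ T → ∀ (V : ℝ → Vec d → Vec d) (H : ℝ → Vec d → Fin d → ℝ)
        (P : Fin d → Fin d → ℝ → Vec d → ℝ) (H₀ B M₀ : ℝ), 0 ≤ H₀ → 0 ≤ B → 0 ≤ M₀ →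
      (∀ t ∈ Set.Ioo 0 T₀, ∀ x j, V t x j = H t x j - duhamelOf P j t x) →
      (∀ t ∈ Set.Ioo 0 T₀, ∀ᵐ x, ∀ j, |H t x j| ≤ H₀ * (η t * wt ϑ x)) →
      (∀ h k, ∀ s ∈ Set.Ioo 0 T₀, ∀ᵐ y, |P h k s y| ≤ wt ϑ y * (A * ‖V s y‖ + B * (η s * wt ϑ y))) →
      (∀ t ∈ Set.Ioo 0 T₀, ∀ᵐ x, ‖V t x‖ ≤ M₀ * (η t * wt ϑ x)) →
      ∀ t ∈ Set.Ioo 0 T₀, ∀ᵐ x, ‖V t x‖ ≤ 2 * (d * H₀ + B) * (η t * wt ϑ x) := by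
  obtain ⟨C, hC0, hC⟩ := exists_abs_duhamelOf_le (d := d) hϑ₀ hϑ₁ T
  -- `ε` makes the Duhamel operator contract by `1 / 2`, including the sum over coordinates
  set ε := 1 / (2 * (d * C + 1) * (A + 1))
  have hε : 0 < ε := by positivity
  have hε1 : d * C * ε ≤ 1 := by
    have h0 : 0 ≤ d * C := by positivity
    simp only [ε]
    rw [mul_one_div, div_le_one (by positivity)]
    nlinarith [mul_nonneg h0 hA]
  have hε2 : d * C * ε * A ≤ 1 / 2 := by
    have h0 : 0 ≤ d * C := by positivity
    simp only [ε]
    rw [mul_one_div, div_mul_eq_mul_div, div_le_iff₀ (by positivity)]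
    nlinarith [mul_nonneg h0 hA]
  refine ⟨ε, hε, fun η hη hη0 T₀ hT₀ V H P H₀ B M₀ hH₀ hB hM₀ heq hH hP hrough => ?_⟩
  refine norm_le_two_mul_of_improve (fun t x => mul_nonneg (hη0 t) (wt_pos ϑ x).le) hM₀
    (by positivity) hrough fun M hM hVM t ht => ?_
  filter_upwards [hH t ht] with x hx
  have hw := wt_pos ϑ x
  obtain ⟨hint, hle⟩ := hη t ht.1
  have hj : ∀ j, |V t x j| ≤ (H₀ * η t + C * ((A * M + B) * (ε * η t))) * wt ϑ x := by
    intro j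
    have h1 := hC j t ht.1 (ht.2.le.trans hT₀) P (fun s => (A * M + B) * η s) (fun h k s hs => by
      have hs' : s ∈ Set.Ioo 0 T₀ := ⟨hs.1, hs.2.trans ht.2⟩
      filter_upwards [hP h k s hs', hVM s hs'] with y h1 h2
      have hwy := (wt_pos ϑ y).le
      calc _ ≤ wt ϑ y * (A * (M * (η s * wt ϑ y)) + B * (η s * wt ϑ y)) := by
            refine h1.trans ?_
            gcongr
        _ = _ := by ring) (by
      refine (hint.const_mul (A * M + B)).congr ?_
      intro s _
      simp only
      ring) x
    have h2 : ∫ s in (0 : ℝ)..t, (t - s) ^ (-(1 / 2) : ℝ) * ((A * M + B) * η s) ≤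
        (A * M + B) * (ε * η t) := by
      simp_rw [mul_left_comm _ (A * M + B)]
      rw [intervalIntegral.integral_const_mul]
      gcongr
    rw [heq t ht x j, add_mul]
    refine (abs_sub _ _).trans (add_le_add ((hx j).trans_eq (by ring)) (h1.trans ?_))
    gcongr
  calc ‖V t x‖ ≤ d * ((H₀ * η t + C * ((A * M + B) * (ε * η t))) * wt ϑ x) :=
        norm_le_of_coord_le hj
    _ = (d * H₀ + d * C * ε * A * M + d * C * ε * B) * (η t * wt ϑ x) := by ring
    _ ≤ (d * H₀ + 1 / 2 * M + 1 * B) * (η t * wt ϑ x) := by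
        have := mul_nonneg (hη0 t) hw.le
        gcongr
    _ = _ := by ring

/-! ### Increments in space of the solution -/

/-- The Gronwall estimate for the linear Duhamel formula with exponential weights in time. -/
lemma exists_norm_le_of_isLinMild {d : ℕ} {ϑ : ℝ} (hϑ₀ : 0 ≤ ϑ) (hϑ₁ : ϑ ≤ (d : ℝ) + 1) (T : ℝ)
    {A : ℝ} (hA : 0 ≤ A) :
    ∃ K, 0 ≤ K ∧ ∀ (b : Vec d → Vec d) (V : ℝ → Vec d → Vec d)
        (P : Fin d → Fin d → ℝ → Vec d → ℝ) (L B M₀ : ℝ), 0 ≤ L → 0 ≤ B → 0 ≤ M₀ →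
      IsLinMild T b V P → (∀ᵐ x, ‖b x‖ ≤ L * wt ϑ x) →
      (∀ h k, ∀ s ∈ Set.Ioo 0 T, ∀ᵐ y, |P h k s y| ≤ wt ϑ y * (A * ‖V s y‖ + B * wt ϑ y)) →
      (∀ t x, ‖V t x‖ ≤ M₀ * wt ϑ x) →
      ∀ t ∈ Set.Ioo 0 T, ∀ᵐ x, ‖V t x‖ ≤ K * (L + B) * wt ϑ x := by
  obtain ⟨ε, hε, hgr⟩ := exists_gronwall_estimate (d := d) hϑ₀ hϑ₁ T hA
  obtain ⟨μ, hμ, hη⟩ := exists_isAbelWeight_exp hε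
  obtain ⟨K₁, hK₁, hheat⟩ := exists_norm_heatFlow_le (d := d) hϑ₀ T
  refine ⟨2 * (d * K₁ + 1) * Real.exp (μ * T), by positivity,
    fun b V P L B M₀ hL hB hM₀ hlin hb hP hrough t ht => ?_⟩
  have one_le : ∀ s ∈ Set.Ioo 0 T, 1 ≤ Real.exp (μ * s) := fun s hs =>
    Real.one_le_exp (mul_nonneg hμ.le hs.1.le)
  have le_mul : ∀ s ∈ Set.Ioo 0 T, ∀ x : Vec d, wt ϑ x ≤ Real.exp (μ * s) * wt ϑ x := fun s hs x =>
    le_mul_of_one_le_left (wt_pos ϑ x).le (one_le s hs)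
  have h := hgr _ hη (fun t => (Real.exp_pos _).le) T le_rfl V (fun t x j => heatFlow t b x j) P
    (K₁ * L) B M₀ (by positivity) hB hM₀ hlin
    (fun t ht => Eventually.of_forall fun x j => (coord_le_norm j _).trans
      ((hheat t ht.1 ht.2.le b L hb x).trans (by
        have := le_mul t ht x
        gcongr)))
    (fun h k s hs => by
      filter_upwards [hP h k s hs] with y hy
      refine hy.trans ?_
      have h1 := le_mul s hs y
      have h2 := (wt_pos ϑ y).le
      gcongr)
    (fun t ht => Eventually.of_forall fun x => (hrough t x).trans (by
      have := le_mul t ht x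
      gcongr)) t ht
  filter_upwards [h] with x hx
  refine hx.trans ?_
  have hw := (wt_pos ϑ x).le
  have he : Real.exp (μ * t) ≤ Real.exp (μ * T) := Real.exp_le_exp.2 (by nlinarith [ht.2])
  have hd : (0 : ℝ) ≤ d := by positivity
  calc 2 * (d * (K₁ * L) + B) * (Real.exp (μ * t) * wt ϑ x)
      ≤ 2 * ((d * K₁ + 1) * (L + B)) * (Real.exp (μ * T) * wt ϑ x) := by
        gcongr
        nlinarith [mul_nonneg (mul_nonneg hd hK₁) hB]
    _ = _ := by ring

/-- A mild solution whose datum, integral equation and pointwise bound hold everywhere. -/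
structure IsBoundedMild {d : ℕ} (T ϑ A : ℝ) (a : Vec d → Vec d) (U : ℝ → Vec d → Vec d) : Prop where
  measurable_datum : Measurable a
  norm_datum_le : ∀ x, ‖a x‖ ≤ A * wt ϑ x
  measurable : Measurable (Function.uncurry U)
  norm_le : ∀ t x, ‖U t x‖ ≤ A * wt ϑ x
  eq : IsLinMild T a U (tensorSquare U)

lemma wt_add_le_two {d : ℕ} {ϑ : ℝ} (hϑ₀ : 0 ≤ ϑ) (x : Vec d) {e : Vec d} (he : ‖e‖ ≤ 1) :
    wt ϑ (x + e) ≤ 2 ^ ϑ * wt ϑ x := by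
  refine (wt_add_le hϑ₀ x e).trans ?_
  have := (wt_pos ϑ x).le
  gcongr
  linarith

lemma norm_comp_add_le {d : ℕ} {ϑ : ℝ} (hϑ₀ : 0 ≤ ϑ) {A : ℝ} (hA : 0 ≤ A) {W : Type*}
    [SeminormedAddCommGroup W] {f : Vec d → W}
    (hf : ∀ x, ‖f x‖ ≤ A * wt ϑ x) {e : Vec d} (he : ‖e‖ ≤ 1) (x : Vec d) :
    ‖f (x + e)‖ ≤ A * 2 ^ ϑ * wt ϑ x := by
  refine (hf _).trans ?_
  rw [mul_assoc]
  gcongr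
  exact wt_add_le_two hϑ₀ x he

lemma norm_increment_le {d : ℕ} {ϑ : ℝ} (hϑ₀ : 0 ≤ ϑ) {A : ℝ} (hA : 0 ≤ A) {W : Type*}
    [SeminormedAddCommGroup W] {f : Vec d → W}
    (hf : ∀ x, ‖f x‖ ≤ A * wt ϑ x) {e : Vec d} (he : ‖e‖ ≤ 1) (x : Vec d) :
    ‖f (x + e) - f x‖ ≤ A * (2 ^ ϑ + 1) * wt ϑ x := by
  refine (norm_sub_le _ _).trans ((add_le_add (norm_comp_add_le hϑ₀ hA hf he x) (hf x)).trans_eq ?_)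
  ring

lemma ae_comp_add {d : ℕ} {p : Vec d → Prop} (h : ∀ᵐ x, p x) (e : Vec d) : ∀ᵐ x, p (x + e) :=
  (measurePreserving_add_right (volume : Measure (Vec d)) e).quasiMeasurePreserving.ae h

lemma abs_coord_mul_sub_le {d : ℕ} {u v : Vec d} {A₁ A₂ : ℝ} (hu : ‖u‖ ≤ A₁) (hv : ‖v‖ ≤ A₂)
    (h k : Fin d) : |u h * u k - v h * v k| ≤ (A₁ + A₂) * ‖u - v‖ := by
  have d1 := coord_le_norm h (u - v)
  have d2 := coord_le_norm k (u - v)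
  have b1 := (coord_le_norm h u).trans hu
  have b2 := (coord_le_norm k v).trans hv
  simp only [PiLp.sub_apply] at d1 d2
  have e1 : u h * u k - v h * v k = u h * (u k - v k) + (u h - v h) * v k := by ring
  rw [e1]
  refine (abs_add_le _ _).trans ?_
  rw [abs_mul, abs_mul, add_mul, mul_comm A₂]
  gcongr
  exact (abs_nonneg _).trans b1

/-- Spatial increments of the solution are controlled by those of the datum. -/
theorem exists_norm_increment_le {d : ℕ} {ϑ : ℝ} (hϑ₀ : 0 ≤ ϑ) (hϑ₁ : ϑ ≤ (d : ℝ) + 1) (T : ℝ)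
    {A : ℝ} (hA : 0 ≤ A) :
    ∃ K, 0 ≤ K ∧ ∀ (a : Vec d → Vec d) (U : ℝ → Vec d → Vec d), IsBoundedMild T ϑ A a U →
      ∀ (e : Vec d) (L : ℝ), ‖e‖ ≤ 1 → 0 ≤ L → (∀ᵐ x, ‖a (x + e) - a x‖ ≤ L * wt ϑ x) →
      ∀ t ∈ Set.Ioo 0 T, ∀ᵐ x, ‖U t (x + e) - U t x‖ ≤ K * L * wt ϑ x := by
  obtain ⟨K, hK, h⟩ := exists_norm_le_of_isLinMild (d := d) hϑ₀ hϑ₁ T (A := A * (2 ^ ϑ + 1))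
    (by positivity)
  refine ⟨K, hK, fun a U hU e L he hL ha => ?_⟩
  have hlin := hU.eq.increment hϑ₀ hϑ₁ hU.measurable_datum (M := A + A ^ 2) (by positivity)
    (fun x => (hU.norm_datum_le x).trans
      ((mul_le_of_le_one_right hA (wt_le_one hϑ₀ x)).trans (by nlinarith)))
    (measurable_tensorSquare hU.measurable)
    (fun h k s y => (abs_tensorSquare_le hU.norm_le h k s y).trans (by
      have := (wt_pos ϑ y).le
      gcongr
      linarith)) e
  have := h _ _ _ L 0 (A * (2 ^ ϑ + 1)) hL le_rfl (by positivity) hlin ha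
    (fun h k s _ => Eventually.of_forall fun y =>
      (abs_coord_mul_sub_le (norm_comp_add_le hϑ₀ hA (hU.norm_le s) he y)
        (hU.norm_le s y) h k).trans_eq (by ring))
    (fun t x => norm_increment_le hϑ₀ hA (hU.norm_le t) he x)
  simpa using this

/-- The second increment of a product, with the products of first increments isolated. -/
lemma abs_second_increment_mul_le {a₀ a₁ a₂ a₃ b₀ b₁ b₂ b₃ M D E₁ E₂ : ℝ} (hM₀ : |a₀| ≤ M) (hM₃ : |b₃| ≤ M)
    (ha : |a₃ - a₂ - (a₁ - a₀)| ≤ D) (hb : |b₃ - b₂ - (b₁ - b₀)| ≤ D)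
    (ha₁ : |a₁ - a₀| ≤ E₁) (ha₂ : |a₂ - a₀| ≤ E₂) (hb₁ : |b₃ - b₂| ≤ E₁) (hb₂ : |b₃ - b₁| ≤ E₂) :
    |a₃ * b₃ - a₂ * b₂ - (a₁ * b₁ - a₀ * b₀)| ≤ 2 * (M * D) + 2 * (E₁ * E₂) := by
  have e : a₃ * b₃ - a₂ * b₂ - (a₁ * b₁ - a₀ * b₀) =
      b₃ * (a₃ - a₂ - (a₁ - a₀)) + a₀ * (b₃ - b₂ - (b₁ - b₀)) +
      ((b₃ - b₂) * (a₂ - a₀) + (a₁ - a₀) * (b₃ - b₁)) := by ring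
  rw [e]
  have h1 := mul_le_mul hM₃ ha (abs_nonneg _) ((abs_nonneg _).trans hM₃)
  have h2 := mul_le_mul hM₀ hb (abs_nonneg _) ((abs_nonneg _).trans hM₀)
  have h3 := mul_le_mul hb₁ ha₂ (abs_nonneg _) ((abs_nonneg _).trans hb₁)
  have h4 := mul_le_mul ha₁ hb₂ (abs_nonneg _) ((abs_nonneg _).trans ha₁)
  rw [← abs_mul] at h1 h2 h3 h4
  have := abs_add_le (b₃ * (a₃ - a₂ - (a₁ - a₀)) + a₀ * (b₃ - b₂ - (b₁ - b₀)))
    ((b₃ - b₂) * (a₂ - a₀) + (a₁ - a₀) * (b₃ - b₁))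
  have := abs_add_le (b₃ * (a₃ - a₂ - (a₁ - a₀))) (a₀ * (b₃ - b₂ - (b₁ - b₀)))
  have := abs_add_le ((b₃ - b₂) * (a₂ - a₀)) ((a₁ - a₀) * (b₃ - b₁))
  linarith

/-- Second spatial increments of the solution are controlled by the second increments of the datum
and by products of its first increments. -/
theorem exists_norm_second_increment_le {d : ℕ} {ϑ : ℝ} (hϑ₀ : 0 ≤ ϑ) (hϑ₁ : ϑ ≤ (d : ℝ) + 1)
    (T : ℝ) {A : ℝ} (hA : 0 ≤ A) :
    ∃ K, 0 ≤ K ∧ ∀ (a : Vec d → Vec d) (U : ℝ → Vec d → Vec d), IsBoundedMild T ϑ A a U →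
      ∀ (e f : Vec d) (L₁ L₂ L₃ : ℝ), ‖e‖ ≤ 1 → ‖f‖ ≤ 1 → 0 ≤ L₁ → 0 ≤ L₂ → 0 ≤ L₃ →
      (∀ᵐ x, ‖a (x + e) - a x‖ ≤ L₁ * wt ϑ x) → (∀ᵐ x, ‖a (x + f) - a x‖ ≤ L₂ * wt ϑ x) →
      (∀ᵐ x, ‖a (x + f + e) - a (x + f) - (a (x + e) - a x)‖ ≤ L₃ * wt ϑ x) →
      ∀ t ∈ Set.Ioo 0 T, ∀ᵐ x,
        ‖U t (x + f + e) - U t (x + f) - (U t (x + e) - U t x)‖ ≤ K * (L₃ + L₁ * L₂) * wt ϑ x := by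
  obtain ⟨K₁, hK₁, hfirst⟩ := exists_norm_increment_le (d := d) hϑ₀ hϑ₁ T hA
  set c : ℝ := 2 ^ ϑ
  have hc : 1 ≤ c := Real.one_le_rpow one_le_two hϑ₀
  obtain ⟨K, hK, h⟩ := exists_norm_le_of_isLinMild (d := d) hϑ₀ hϑ₁ T (A := 2 * (A * c * c))
    (by positivity)
  refine ⟨K * (1 + 2 * (c * K₁) ^ 2), by positivity,
    fun a U hU e f L₁ L₂ L₃ he hf hL₁ hL₂ hL₃ ha₁ ha₂ ha₃ t ht => ?_⟩
  have hP := measurable_tensorSquare hU.measurable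
  have hPM := fun h k s y => (abs_tensorSquare_le hU.norm_le h k s y).trans
    (mul_le_mul_of_nonneg_right (by linarith : A ^ 2 ≤ A + A ^ 2) (pow_pos (wt_pos ϑ y) 2).le)
  have haM : ∀ x, ‖a x‖ ≤ A + A ^ 2 := fun x => (hU.norm_datum_le x).trans
    ((mul_le_of_le_one_right hA (wt_le_one hϑ₀ x)).trans (by nlinarith))
  have hlin₁ := hU.eq.increment hϑ₀ hϑ₁ hU.measurable_datum (M := A + A ^ 2) (by positivity)
    haM hP hPM e
  set r := ((1 + ‖e‖) ^ ϑ) ^ 2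
  have hr : 1 ≤ r := one_le_one_add_norm_rpow_sq hϑ₀ e
  have hM : 0 ≤ A + A ^ 2 := by positivity
  have hlin := hlin₁.increment hϑ₀ hϑ₁
    ((hU.measurable_datum.comp (by fun_prop)).sub hU.measurable_datum)
    (M := (A + A ^ 2) * r + (A + A ^ 2)) (by positivity)
    (fun x => (norm_sub_le _ _).trans (add_le_add
      ((haM _).trans (le_mul_of_one_le_right hM hr)) (haM x)))
    (fun h k => ((hP h k).comp (f := fun q : ℝ × Vec d => (q.1, q.2 + e)) (by fun_prop)).sub (hP h k))
    (fun h k s y => by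
      rw [add_mul]
      exact (abs_sub _ _).trans (add_le_add (abs_comp_add_le hϑ₀ hM (hPM h k s) e y) (hPM h k s y)))
    f
  have := h _ _ _ L₃ (2 * (c * K₁) ^ 2 * (L₁ * L₂)) (A * (c + 1) * (c + 1)) hL₃ (by positivity)
    (by positivity) hlin ha₃ (fun h k s hs => by
      have h1 := hfirst a U hU e L₁ he hL₁ ha₁ s hs
      have h2 := hfirst a U hU f L₂ hf hL₂ ha₂ s hs
      filter_upwards [h1, h2, ae_comp_add h1 f, ae_comp_add h2 e] with y h1 h2 h3 h4
      have hw := wt_pos ϑ y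
      have hK₁w : ∀ L, 0 ≤ L → ∀ m, m ≤ c * wt ϑ y → K₁ * L * m ≤ c * K₁ * L * wt ϑ y :=
        fun L hL m hm => by
          calc K₁ * L * m ≤ K₁ * L * (c * wt ϑ y) := by gcongr
            _ = _ := by ring
      have hwc : wt ϑ y ≤ c * wt ϑ y := le_mul_of_one_le_left hw.le hc
      have hcoord : ∀ {v : Vec d} {m : ℝ}, ‖v‖ ≤ m → ∀ l, |v l| ≤ m := fun hv l =>
        (coord_le_norm l _).trans hv
      have := abs_second_increment_mul_le (a₀ := U s y h) (a₁ := U s (y + e) h)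
        (a₂ := U s (y + f) h) (a₃ := U s (y + f + e) h) (b₀ := U s y k) (b₁ := U s (y + e) k)
        (b₂ := U s (y + f) k) (b₃ := U s (y + f + e) k) (M := A * c * c * wt ϑ y)
        (D := ‖U s (y + f + e) - U s (y + f) - (U s (y + e) - U s y)‖)
        (E₁ := c * K₁ * L₁ * wt ϑ y) (E₂ := c * K₁ * L₂ * wt ϑ y)
        (hcoord ((hU.norm_le s y).trans (by
          gcongr
          rw [mul_assoc]
          exact le_mul_of_one_le_right hA (one_le_mul_of_one_le_of_one_le hc hc))) h)
        (hcoord (norm_comp_add_le hϑ₀ (by positivity)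
          (norm_comp_add_le hϑ₀ hA (hU.norm_le s) he) hf y) k)
        (coord_le_norm h (U s (y + f + e) - U s (y + f) - (U s (y + e) - U s y)))
        (coord_le_norm k (U s (y + f + e) - U s (y + f) - (U s (y + e) - U s y)))
        (hcoord (h1.trans (hK₁w L₁ hL₁ _ hwc)) h) (hcoord (h2.trans (hK₁w L₂ hL₂ _ hwc)) h)
        (hcoord (h3.trans (hK₁w L₁ hL₁ _ (wt_add_le_two hϑ₀ y hf))) k)
        (by
          have := hcoord (h4.trans (hK₁w L₂ hL₂ _ (wt_add_le_two hϑ₀ y he))) k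
          rwa [add_right_comm y e f] at this)
      exact this.trans_eq (by ring))
    (fun t x => by
      have := norm_increment_le hϑ₀ (by positivity : 0 ≤ A * (c + 1))
        (norm_increment_le hϑ₀ hA (hU.norm_le t) he) hf x
      exact this) t ht
  filter_upwards [this] with x hx
  refine hx.trans ?_
  have := (wt_pos ϑ x).le
  rw [mul_assoc K (1 + _)]
  refine mul_le_mul_of_nonneg_right (mul_le_mul_of_nonneg_left ?_ hK) this
  nlinarith [mul_nonneg hL₁ hL₂, mul_nonneg (sq_nonneg (c * K₁)) hL₃]

/-! ### Increments in time of the solution -/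

/-- Shifting the time variable in the Duhamel term splits off the contribution of `[-h, 0]`. -/
lemma duhamelOf_add_time {d : ℕ} {ϑ : ℝ} (hϑ₀ : 0 ≤ ϑ) (hϑ₁ : ϑ ≤ (d : ℝ) + 1)
    {P : Fin d → Fin d → ℝ → Vec d → ℝ} (hP : ∀ h k, Measurable (Function.uncurry (P h k)))
    {M : ℝ} (hPM : ∀ h k s y, |P h k s y| ≤ M * wt ϑ y ^ 2) (j : Fin d) {t r : ℝ} (ht : 0 ≤ t)
    (hr : 0 ≤ r) (x : Vec d) :
    duhamelOf P j (t + r) x =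
      (∑ h : Fin d, ∑ k : Fin d,
        ∫ s in (-r)..0, ∫ y : Vec d, oseenKernel j h k (t - s) (x - y) * P h k (s + r) y) +
      duhamelOf (fun h k s y => P h k (s + r) y) j t x := by
  unfold duhamelOf
  simp_rw [← Finset.sum_add_distrib]
  refine Finset.sum_congr rfl fun h _ => Finset.sum_congr rfl fun k _ => ?_
  have hPr : Measurable (Function.uncurry fun s y => P h k (s + r) y) :=
    (hP h k).comp (f := fun q : ℝ × Vec d => (q.1 + r, q.2)) (by fun_prop)
  have hint : IntervalIntegrable
      (fun s => ∫ y, oseenKernel j h k (t - s) (x - y) * P h k (s + r) y) volume (-r) t :=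
    intervalIntegrable_integral_oseenKernel_mul hϑ₀ hϑ₁ j h k (by linarith) le_rfl hPr
      (fun s _ y => hPM h k (s + r) y) x
  rw [intervalIntegral.integral_add_adjacent_intervals
    (hint.mono_set (Set.uIcc_subset_uIcc Set.left_mem_uIcc (by
      rw [Set.mem_uIcc]; left; constructor <;> linarith)))
    (hint.mono_set (Set.uIcc_subset_uIcc (by
      rw [Set.mem_uIcc]; left; constructor <;> linarith) Set.right_mem_uIcc))]
  have := intervalIntegral.integral_comp_add_right (a := -r) (b := t)
    (fun s => ∫ y, oseenKernel j h k (t + r - s) (x - y) * P h k s y) r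
  rw [neg_add_cancel] at this
  rw [← this]
  refine intervalIntegral.integral_congr fun s _ => ?_
  simp only [add_sub_add_right_eq_sub]

lemma rpow_neg_half_nonneg (t : ℝ) : 0 ≤ t ^ (-(1 / 2) : ℝ) := by
  rcases le_or_gt 0 t with ht | ht
  · positivity
  · rw [Real.rpow_def_of_neg ht, neg_mul, Real.cos_neg, one_div_mul_eq_div, Real.cos_pi_div_two,
      mul_zero]

lemma integral_sub_rpow_neg_le {t r : ℝ} (ht : 0 < t) (hr : 0 ≤ r) :
    ∫ s in (-r)..0, (t - s) ^ (-(1 / 2) : ℝ) ≤ r * t ^ (-(1 / 2) : ℝ) := by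
  calc _ ≤ ∫ s in (-r)..0, t ^ (-(1 / 2) : ℝ) := by
        refine intervalIntegral.integral_mono_on (by linarith) (intervalIntegrable_sub_rpow t _ _)
          intervalIntegrable_const fun s hs => ?_
        exact Real.rpow_le_rpow_of_nonpos ht (by linarith [hs.2]) (by norm_num)
    _ = _ := by simp

/-- Increments in time of a solution with Lipschitz datum. -/
theorem exists_norm_time_increment_le {d : ℕ} {ϑ : ℝ} (hϑ₀ : 0 ≤ ϑ) (hϑ₁ : ϑ ≤ (d : ℝ) + 1) {T : ℝ}
    {A : ℝ} (hA : 0 ≤ A) {a : Vec d → Vec d} {U : ℝ → Vec d → Vec d} (hU : IsBoundedMild T ϑ A a U)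
    {L : ℝ} (hL : 0 ≤ L)
    (hLip : ∀ v : Vec d, ∀ᵐ x, ‖a (x + v) - a x‖ ≤ L * ‖v‖ * (1 + ‖v‖) ^ ϑ * wt ϑ x) :
    ∃ K, 0 ≤ K ∧ ∀ r, 0 ≤ r → ∀ t ∈ Set.Ioo 0 (T - r),
      ∀ᵐ x, ‖U (t + r) x - U t x‖ ≤ K * (r * t ^ (-(1 / 2) : ℝ)) * wt ϑ x := by
  obtain ⟨ε, hε, hgr⟩ := exists_gronwall_estimate (d := d) hϑ₀ hϑ₁ T (A := 2 * A) (by positivity)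
  obtain ⟨μ, hμ, hη⟩ := exists_isAbelWeight_rpow_mul_exp hε
  obtain ⟨K₁, hK₁, hheat⟩ := exists_norm_heatFlow_add_sub_le hϑ₀ T hU.measurable_datum (M := A)
    (Eventually.of_forall fun y => (hU.norm_datum_le y).trans
      (mul_le_of_le_one_right hA (wt_le_one hϑ₀ y))) hL hLip
  obtain ⟨C, hC0, hC⟩ := exists_abs_duhamel_le (d := d) hϑ₀ hϑ₁ T
  set K₀ := K₁ + d * (d * (C * A ^ 2))
  have hK₀ : 0 ≤ K₀ := by positivity
  refine ⟨2 * (d * K₀) * Real.exp (μ * T), by positivity, fun r hr t ht => ?_⟩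
  set P := tensorSquare U
  have hP := measurable_tensorSquare hU.measurable
  have hPM := abs_tensorSquare_le hU.norm_le
  have hPr : ∀ h k, Measurable (Function.uncurry fun s y => P h k (s + r) y) := fun h k =>
    (hP h k).comp (f := fun q : ℝ × Vec d => (q.1 + r, q.2)) (by fun_prop)
  -- the contribution of the time interval `[-r, 0]`, part of the free term
  set D : ℝ → Vec d → Fin d → ℝ := fun t x j => ∑ h : Fin d, ∑ k : Fin d,
    ∫ s in (-r)..0, ∫ y : Vec d, oseenKernel j h k (t - s) (x - y) * P h k (s + r) y
  have one_le : ∀ t ∈ Set.Ioo 0 (T - r), 1 ≤ Real.exp (μ * t) := fun s hs =>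
    Real.one_le_exp (mul_nonneg hμ.le hs.1.le)
  have hD : ∀ t ∈ Set.Ioo 0 (T - r), ∀ x j,
      |D t x j| ≤ d * (d * (C * A ^ 2)) * (r * t ^ (-(1 / 2) : ℝ)) * wt ϑ x := by
    intro t ht x j
    have hw := (wt_pos ϑ x).le
    calc |D t x j| ≤ ∑ h : Fin d, ∑ k : Fin d, C * (r * t ^ (-(1 / 2) : ℝ) * A ^ 2) * wt ϑ x := by
          refine (Finset.abs_sum_le_sum_abs _ _).trans (Finset.sum_le_sum fun h _ => ?_)
          refine (Finset.abs_sum_le_sum_abs _ _).trans (Finset.sum_le_sum fun k _ => ?_)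
          refine (hC j h k t (-r) 0 (by linarith) ht.1.le (by linarith [ht.2])
            (fun s y => P h k (s + r) y) (fun _ => A ^ 2)
            (fun s _ => Eventually.of_forall fun y => hPM h k (s + r) y)
            ((intervalIntegrable_sub_rpow t _ _).mul_const _) x).trans ?_
          rw [intervalIntegral.integral_mul_const]
          have := integral_sub_rpow_neg_le ht.1 hr
          gcongr
      _ = _ := by simp; ring
  have := hgr _ hη (fun t => mul_nonneg (rpow_neg_half_nonneg t) (Real.exp_pos _).le) (T - r)
    (by linarith) (fun t x => U (t + r) x - U t x)
    (fun t x j => (heatFlow (t + r) a x - heatFlow t a x) j - D t x j)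
    (fun h k s y => P h k (s + r) y - P h k s y) (K₀ * r) 0 (2 * A * √T) (by positivity) le_rfl
    (by positivity)
    (fun t ht x j => by
      rw [duhamelOf_sub hϑ₀ hϑ₁ (P := fun h k s y => P h k (s + r) y) (Q := P) hPr hP
        (fun h k s y => hPM h k (s + r) y) hPM j ht.1.le x]
      simp only [PiLp.sub_apply]
      rw [hU.eq (t + r) ⟨by linarith [ht.1], by linarith [ht.2]⟩ x j,
        hU.eq t ⟨ht.1, by linarith [ht.2]⟩ x j,
        duhamelOf_add_time hϑ₀ hϑ₁ hP hPM j ht.1.le hr x]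
      simp only [D]
      ring)
    (fun t ht => by
      filter_upwards [hheat t r ht.1 hr (by linarith [ht.2])] with x hx j
      have hw := (wt_pos ϑ x).le
      have h0 := rpow_neg_half_nonneg t
      calc _ ≤ K₁ * (r * t ^ (-(1 / 2) : ℝ)) * wt ϑ x +
            d * (d * (C * A ^ 2)) * (r * t ^ (-(1 / 2) : ℝ)) * wt ϑ x :=
            (abs_sub _ _).trans (add_le_add ((coord_le_norm j _).trans hx) (hD t ht x j))
        _ = K₀ * r * (t ^ (-(1 / 2) : ℝ) * 1 * wt ϑ x) := by simp only [K₀]; ring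
        _ ≤ _ := by
          have := one_le t ht
          gcongr)
    (fun h k s _ => Eventually.of_forall fun y =>
      (abs_coord_mul_sub_le (hU.norm_le (s + r) y) (hU.norm_le s y) h k).trans_eq (by ring))
    (fun t ht => Eventually.of_forall fun x => by
      have hw := (wt_pos ϑ x).le
      have h0 := rpow_neg_half_nonneg t
      -- the qualitative bound `‖U‖ ≤ A wt` is also one in the norm with weight `t^{-1/2}`
      have h1 : 1 ≤ √T * t ^ (-(1 / 2) : ℝ) := by
        rw [Real.rpow_neg ht.1.le, ← Real.sqrt_eq_rpow, ← div_eq_mul_inv,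
          one_le_div (Real.sqrt_pos.2 ht.1)]
        exact Real.sqrt_le_sqrt (by linarith [ht.2])
      calc ‖U (t + r) x - U t x‖ ≤ A * wt ϑ x + A * wt ϑ x :=
            (norm_sub_le _ _).trans (add_le_add (hU.norm_le _ _) (hU.norm_le _ _))
        _ = 2 * A * (1 * 1 * wt ϑ x) := by ring
        _ ≤ 2 * A * ((√T * t ^ (-(1 / 2) : ℝ)) * Real.exp (μ * t) * wt ϑ x) := by
          have := one_le t ht
          gcongr
        _ = _ := by ring) t ht
  filter_upwards [this] with x hx
  refine hx.trans ?_
  have hw := (wt_pos ϑ x).le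
  have h0 := rpow_neg_half_nonneg t
  have he : Real.exp (μ * t) ≤ Real.exp (μ * T) := Real.exp_le_exp.2 (by nlinarith [ht.2])
  calc _ = 2 * (d * K₀) * Real.exp (μ * t) * (r * t ^ (-(1 / 2) : ℝ)) * wt ϑ x := by ring
    _ ≤ _ := by gcongr

/-! ### Increments of the datum -/

section WeakDerivatives

set_option linter.unusedSectionVars false

variable {V W : Type*} [NormedAddCommGroup V] [NormedSpace ℝ V] [FiniteDimensional ℝ V]
  [MeasureSpace V] [BorelSpace V] [(volume : Measure V).IsAddHaarMeasure]
  [NormedAddCommGroup W] [InnerProductSpace ℝ W] [CompleteSpace W]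

lemma locallyIntegrableOn_congr_ae_restrict {f f' : V → W} {Ω : Set V}
    (hf : LocallyIntegrableOn f Ω volume) (h : f =ᵐ[volume.restrict Ω] f') :
    LocallyIntegrableOn f' Ω volume := by
  intro x hx
  obtain ⟨s, hs, hi⟩ := hf x hx
  refine ⟨s ∩ Ω, inter_mem hs self_mem_nhdsWithin, ?_⟩
  exact (hi.mono_set Set.inter_subset_left).congr
    (ae_restrict_of_ae_restrict_of_subset Set.inter_subset_right h)

lemma HasWeakDirDeriv.congr_ae {Ω : Set V} {v : V} {f f' g g' : V → W} (h : HasWeakDirDeriv Ω v f g)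
    (hf : f =ᵐ[volume.restrict Ω] f') (hg : g =ᵐ[volume.restrict Ω] g') :
    HasWeakDirDeriv Ω v f' g' := by
  refine ⟨locallyIntegrableOn_congr_ae_restrict h.1 hf,
    locallyIntegrableOn_congr_ae_restrict h.2.1 hg, fun φ hφ hφs hφΩ => ?_⟩
  have h1 := h.2.2 φ hφ hφs hφΩ
  have e1 : ∫ z in Ω, (fderiv ℝ φ z v) • f z = ∫ z in Ω, (fderiv ℝ φ z v) • f' z :=
    integral_congr_ae (hf.mono fun z hz => by simp only [hz])
  have e2 : ∫ z in Ω, φ z • g z = ∫ z in Ω, φ z • g' z :=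
    integral_congr_ae (hg.mono fun z hz => by simp only [hz])
  rwa [e1, e2] at h1

lemma HasWeakDirDeriv.smul_dir {Ω : Set V} {v : V} {f g : V → W} (h : HasWeakDirDeriv Ω v f g)
    (c : ℝ) : HasWeakDirDeriv Ω (c • v) f (fun z => c • g z) := by
  refine ⟨h.1, fun x hx => (h.2.1 x hx).smul c, fun φ hφ hφs hφΩ => ?_⟩
  simp only [map_smul, smul_eq_mul, mul_smul, smul_comm _ c]
  rw [integral_smul, integral_smul, h.2.2 φ hφ hφs hφΩ, smul_neg]

/-- Weak directional derivatives are linear in the direction. -/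
lemma hasWeakDirDeriv_sum {ι : Type*} [Fintype ι] {v : ι → V} {f : V → W} {g : ι → V → W}
    (hf : AEStronglyMeasurable f volume) {M : ℝ} (hM : ∀ᵐ z, ‖f z‖ ≤ M)
    (hg : ∀ i, AEStronglyMeasurable (g i) volume) {M' : ι → ℝ} (hM' : ∀ i, ∀ᵐ z, ‖g i z‖ ≤ M' i)
    (h : ∀ i, HasWeakDirDeriv Set.univ (v i) f (g i)) :
    HasWeakDirDeriv Set.univ (∑ i, v i) f (fun z => ∑ i, g i z) := by
  refine ⟨(locallyIntegrable_of_ae_bdd hf hM).locallyIntegrableOn _,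
    (locallyIntegrable_of_ae_bdd (M := ∑ i, M' i)
      (Finset.univ.aestronglyMeasurable_fun_sum fun i _ => hg i) ?_).locallyIntegrableOn _,
    fun φ hφ hφs _ => ?_⟩
  · filter_upwards [ae_all_iff.2 hM'] with z hz using norm_sum_le_of_le _ fun i _ => hz i
  · simp only [map_sum, Finset.sum_smul, Finset.smul_sum, Measure.restrict_univ]
    rw [integral_finsetSum _ fun i _ => integrable_smul_of_hasCompactSupport
        ((hφ.continuous_fderiv (by simp)).clm_apply continuous_const) (hφs.fderiv_apply ℝ (v i)) hf hM,
      integral_finsetSum _ fun i _ => integrable_smul_of_hasCompactSupport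
        hφ.continuous hφs (hg i) (hM' i), ← Finset.sum_neg_distrib]
    exact Finset.sum_congr rfl fun i _ =>
      hasWeakDirDeriv_integral_eq (h i) hφ hφs (Set.subset_univ _)

lemma HasWeakDirDeriv.increment {v : V} {f g : V → W}
    (hf : AEStronglyMeasurable f volume) {M : ℝ} (hM : ∀ᵐ z, ‖f z‖ ≤ M)
    (hg : AEStronglyMeasurable g volume) {M' : ℝ} (hM' : ∀ᵐ z, ‖g z‖ ≤ M')
    (h : HasWeakDirDeriv Set.univ v f g) (e : V) :
    HasWeakDirDeriv Set.univ v (fun z => f (z + e) - f z) (fun z => g (z + e) - g z) := by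
  have tr : ∀ {f : V → W}, AEStronglyMeasurable f volume →
      AEStronglyMeasurable (fun z => f (z + e)) volume := fun hf =>
    hf.comp_measurePreserving (measurePreserving_add_right volume e)
  have trb : ∀ {f : V → W} {M : ℝ}, (∀ᵐ z, ‖f z‖ ≤ M) → ∀ᵐ z, ‖f (z + e)‖ ≤ M := fun hM =>
    (measurePreserving_add_right volume e).quasiMeasurePreserving.ae hM
  have sub_bdd : ∀ {f : V → W} {M : ℝ}, (∀ᵐ z, ‖f z‖ ≤ M) → ∀ᵐ z, ‖f (z + e) - f z‖ ≤ M + M :=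
    fun hM => by
      filter_upwards [hM, trb hM] with z h1 h2 using (norm_sub_le _ _).trans (add_le_add h2 h1)
  refine ⟨(locallyIntegrable_of_ae_bdd ((tr hf).sub hf) (sub_bdd hM)).locallyIntegrableOn _,
    (locallyIntegrable_of_ae_bdd ((tr hg).sub hg) (sub_bdd hM')).locallyIntegrableOn _,
    fun φ hφ hφs hφΩ => ?_⟩
  have hDc : Continuous fun z => fderiv ℝ φ z v :=
    (hφ.continuous_fderiv (by simp)).clm_apply continuous_const
  have hDs : HasCompactSupport fun z => fderiv ℝ φ z v := hφs.fderiv_apply ℝ v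
  have a2 := hasWeakDirDeriv_integral_eq h hφ hφs hφΩ
  have a3 := hasWeakDirDeriv_integral_eq h (φ := fun z => φ (z - e))
    (hφ.comp (contDiff_id.sub contDiff_const)) (hasCompactSupport_comp_sub hφs _) (Set.subset_univ _)
  simp_rw [fderiv_comp_sub_const] at a3
  simp only [Measure.restrict_univ, smul_sub]
  rw [integral_sub (integrable_smul_of_hasCompactSupport hDc hDs (tr hf) (trb hM))
      (integrable_smul_of_hasCompactSupport hDc hDs hf hM),
    integral_sub (integrable_smul_of_hasCompactSupport hφ.continuous hφs (tr hg) (trb hM'))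
      (integrable_smul_of_hasCompactSupport hφ.continuous hφs hg hM'),
    integral_smul_comp_add (fun z => fderiv ℝ φ z v), integral_smul_comp_add φ g e, a3, a2]
  abel

end WeakDerivatives

lemma ae_norm_le_of_wt {d : ℕ} {ϑ : ℝ} (hϑ : 0 ≤ ϑ) {W : Type*} [SeminormedAddCommGroup W]
    {f : Vec d → W} {C : ℝ} (hC : 0 ≤ C) (h : ∀ᵐ x, ‖f x‖ ≤ C * wt ϑ x) : ∀ᵐ x, ‖f x‖ ≤ C :=
  h.mono fun x hx => hx.trans (mul_le_of_le_one_right hC (wt_le_one hϑ x))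

/-- Increments of a function with weighted weak derivative. -/
lemma norm_increment_le_of_hasWeakDirDeriv {d : ℕ} {ϑ : ℝ} (hϑ : 0 ≤ ϑ) {v : Vec d}
    {f g : Vec d → Vec d} (hf : AEStronglyMeasurable f volume) {M : ℝ} (hM : ∀ᵐ z, ‖f z‖ ≤ M)
    (hg : AEStronglyMeasurable g volume) {C : ℝ} (hC : 0 ≤ C) (hgC : ∀ᵐ x, ‖g x‖ ≤ C * wt ϑ x)
    (h : HasWeakDirDeriv Set.univ v f g) :
    ∀ᵐ x, ‖f (x + v) - f x‖ ≤ C * (1 + ‖v‖) ^ ϑ * wt ϑ x := by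
  have hg' := hg.stronglyMeasurable_mk
  have hgC' : ∀ᵐ x, ‖hg.mk g x‖ ≤ C * wt ϑ x := by
    filter_upwards [hg.ae_eq_mk, hgC] with x h1 h2
    rwa [← h1]
  have h' := h.congr_ae (f' := f) (g' := hg.mk g) ae_eq_rfl (by simpa using hg.ae_eq_mk)
  have hset : MeasurableSet
      {q : Vec d × ℝ | ‖hg.mk g (q.1 + q.2 • v)‖ ≤ C * wt ϑ (q.1 + q.2 • v)} :=
    measurableSet_le (hg'.norm.measurable.comp (by fun_prop))
      (((measurable_wt ϑ).const_mul C).comp (f := fun q : Vec d × ℝ => q.1 + q.2 • v) (by fun_prop))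
  have hae : ∀ᵐ x : Vec d, ∀ᵐ r : ℝ, ‖hg.mk g (x + r • v)‖ ≤ C * wt ϑ (x + r • v) :=
    (Measure.ae_ae_comm
      (p := fun (x : Vec d) (r : ℝ) => ‖hg.mk g (x + r • v)‖ ≤ C * wt ϑ (x + r • v)) hset).2
      (Eventually.of_forall fun r => ae_comp_add hgC' (r • v))
  filter_upwards [sub_eq_integral_of_hasWeakDirDeriv hf hM hg' (ae_norm_le_of_wt hϑ hC hgC') h', hae]
    with x h1 h2
  rw [h1]
  have := intervalIntegral.norm_integral_le_of_norm_le_const_ae (a := 0) (b := 1)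
    (f := fun r : ℝ => hg.mk g (x + r • v)) (C := C * (1 + ‖v‖) ^ ϑ * wt ϑ x) (by
      filter_upwards [h2] with r hr hr01
      rw [Set.uIoc_of_le zero_le_one] at hr01
      refine hr.trans ?_
      rw [mul_assoc]
      gcongr
      refine (wt_add_le hϑ x _).trans ?_
      have hw := (wt_pos ϑ x).le
      gcongr
      rw [norm_smul, Real.norm_of_nonneg hr01.1.le]
      exact mul_le_of_le_one_left (norm_nonneg v) hr01.2)
  simpa using this

lemma norm_stdVec {d : ℕ} (i : Fin d) : ‖stdVec d i‖ = 1 := by simp [stdVec]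

lemma sum_smul_stdVec {d : ℕ} (v : Vec d) : ∑ i, v i • stdVec d i = v := by
  simpa [stdVec] using (EuclideanSpace.basisFun (Fin d) ℝ).sum_repr v

/-- A function all of whose weak partial derivatives are weighted is Lipschitz, with weights. -/
lemma norm_increment_le_of_partials {d : ℕ} {ϑ : ℝ} (hϑ : 0 ≤ ϑ) {f : Vec d → Vec d}
    {g : Fin d → Vec d → Vec d} (hf : AEStronglyMeasurable f volume) {M : ℝ} (hM : ∀ᵐ z, ‖f z‖ ≤ M)
    (hg : ∀ i, AEStronglyMeasurable (g i) volume) {C : ℝ} (hC : 0 ≤ C)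
    (hgC : ∀ i, ∀ᵐ x, ‖g i x‖ ≤ C * wt ϑ x) (h : ∀ i, IsWeakPartial i f (g i)) (v : Vec d) :
    ∀ᵐ x, ‖f (x + v) - f x‖ ≤ d * C * ‖v‖ * (1 + ‖v‖) ^ ϑ * wt ϑ x := by
  have hb : ∀ i, ∀ᵐ z, ‖v i • g i z‖ ≤ ‖v‖ * C := fun i => by
    filter_upwards [ae_norm_le_of_wt hϑ hC (hgC i)] with z hz
    rw [norm_smul]
    exact mul_le_mul (coord_le_norm i v) hz (norm_nonneg _) (norm_nonneg _)
  have hs := hasWeakDirDeriv_sum hf hM (fun i => (hg i).const_smul (v i)) hb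
    (fun i => (h i).smul_dir (v i))
  rw [sum_smul_stdVec] at hs
  refine norm_increment_le_of_hasWeakDirDeriv hϑ hf hM (C := d * C * ‖v‖)
    (Finset.univ.aestronglyMeasurable_fun_sum fun i _ => (hg i).const_smul (v i)) (by positivity)
    ?_ hs
  filter_upwards [ae_all_iff.2 hgC] with x hx
  calc _ ≤ ∑ i : Fin d, ‖v‖ * (C * wt ϑ x) := norm_sum_le_of_le _ fun i _ => by
        rw [Pi.smul_apply, norm_smul]
        exact mul_le_mul (coord_le_norm i v) (hx i) (norm_nonneg _) (norm_nonneg _)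
    _ = _ := by simp; ring

/-- Increments along a coordinate axis, given the weak derivative in that direction. -/
lemma norm_increment_le_of_partial {d : ℕ} {ϑ : ℝ} (hϑ : 0 ≤ ϑ) {i : Fin d} {f g : Vec d → Vec d}
    (hf : AEStronglyMeasurable f volume) {M : ℝ} (hM : ∀ᵐ z, ‖f z‖ ≤ M)
    (hg : AEStronglyMeasurable g volume) {C : ℝ} (hC : 0 ≤ C) (hgC : ∀ᵐ x, ‖g x‖ ≤ C * wt ϑ x)
    (h : IsWeakPartial i f g) {τ : ℝ} (hτ : 0 ≤ τ) (hτ1 : τ ≤ 1) :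
    ∀ᵐ x, ‖f (x + τ • stdVec d i) - f x‖ ≤ τ * (C * 2 ^ ϑ) * wt ϑ x := by
  have := norm_increment_le_of_hasWeakDirDeriv hϑ hf hM (C := τ * C) (hg.const_smul τ)
    (by positivity) (by
      filter_upwards [hgC] with x hx
      rw [Pi.smul_apply, norm_smul, Real.norm_of_nonneg hτ, mul_assoc]
      gcongr) (h.smul_dir τ)
  filter_upwards [this] with x hx
  refine hx.trans ?_
  have hw := (wt_pos ϑ x).le
  rw [norm_smul, norm_stdVec, Real.norm_of_nonneg hτ, mul_one, mul_assoc τ]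
  gcongr
  linarith

/-- Second increments along coordinate axes, given mixed second weak derivatives. -/
lemma norm_second_increment_le_of_partial {d : ℕ} {ϑ : ℝ} (hϑ : 0 ≤ ϑ) {i j : Fin d}
    {f g c : Vec d → Vec d} (hf : AEStronglyMeasurable f volume) {M : ℝ} (hM : ∀ᵐ z, ‖f z‖ ≤ M)
    (hg : AEStronglyMeasurable g volume) {M' : ℝ} (hM' : ∀ᵐ z, ‖g z‖ ≤ M')
    (hc : AEStronglyMeasurable c volume) {C : ℝ} (hC : 0 ≤ C) (hcC : ∀ᵐ x, ‖c x‖ ≤ C * wt ϑ x)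
    (hfg : IsWeakPartial j f g) (hgc : IsWeakPartial i g c) {σ τ : ℝ} (hσ : 0 ≤ σ) (hσ1 : σ ≤ 1)
    (hτ : 0 ≤ τ) (hτ1 : τ ≤ 1) :
    ∀ᵐ x, ‖f (x + σ • stdVec d j + τ • stdVec d i) - f (x + σ • stdVec d j) -
        (f (x + τ • stdVec d i) - f x)‖ ≤ σ * (τ * (C * 2 ^ ϑ) * 2 ^ ϑ) * wt ϑ x := by
  have tr : ∀ {f : Vec d → Vec d}, AEStronglyMeasurable f volume →
      AEStronglyMeasurable (fun z => f (z + τ • stdVec d i) - f z) volume := fun hf =>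
    (hf.comp_measurePreserving (measurePreserving_add_right volume _)).sub hf
  refine norm_increment_le_of_partial hϑ (f := fun x => f (x + τ • stdVec d i) - f x)
    (tr hf) (M := M + M) ?_ (tr hg) (by positivity)
    (norm_increment_le_of_partial hϑ hg hM' hc hC hcC hgc hτ hτ1)
    (hfg.increment hf hM hg hM' _) hσ hσ1
  filter_upwards [hM, ae_comp_add hM (τ • stdVec d i)] with z h1 h2
  exact (norm_sub_le _ _).trans (add_le_add h2 h1)

/-! ### Derivatives of the solution -/

instance isAddHaarMeasure_volume_prod {d : ℕ} : (volume : Measure (ℝ × Vec d)).IsAddHaarMeasure :=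
  inferInstanceAs ((volume : Measure ℝ).prod (volume : Measure (Vec d))).IsAddHaarMeasure

lemma isOpen_cylinder (d : ℕ) (T : ℝ) : IsOpen (cylinder d T) := isOpen_Ioo.prod isOpen_univ

lemma volume_restrict_cylinder (d : ℕ) (T : ℝ) :
    (volume : Measure (ℝ × Vec d)).restrict (cylinder d T) =
      (volume.restrict (Set.Ioo 0 T)).prod volume := by
  rw [_root_.cylinder, Measure.volume_eq_prod, ← Measure.prod_restrict, Measure.restrict_univ]

lemma ae_cylinder_of_forall {d : ℕ} {T : ℝ} {p : ℝ × Vec d → Prop} (hp : MeasurableSet {z | p z})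
    (h : ∀ t ∈ Set.Ioo 0 T, ∀ᵐ x, p (t, x)) : ∀ᵐ z, z ∈ cylinder d T → p z := by
  rw [← ae_restrict_iff' (isOpen_cylinder d T).measurableSet, volume_restrict_cylinder]
  refine (Measure.ae_prod_iff_ae_ae hp).2 ?_
  filter_upwards [ae_restrict_mem measurableSet_Ioo] with t ht using h t ht

lemma memLinftyWeighted_of_ae {d : ℕ} {T ϑ : ℝ} {g : ℝ × Vec d → Vec d}
    (hg : AEStronglyMeasurable g volume) {C : ℝ}
    (h : ∀ᵐ z, z ∈ cylinder d T → ‖g z‖ ≤ C * wt ϑ z.2) :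
    MemLinftyWeighted T ϑ (Function.curry g) := by
  rw [← ae_restrict_iff' (isOpen_cylinder d T).measurableSet, volume_restrict_cylinder] at h
  rw [MemLinftyWeighted, ← restrict_Ioo_eq_restrict_Icc, Function.uncurry_curry,
    ← volume_restrict_cylinder]
  refine ⟨hg.restrict, C, ?_⟩
  filter_upwards [Measure.ae_ae_of_ae_prod h] with t ht
  filter_upwards [ht] with x hx
  rwa [weight_mul_le_iff]

lemma add_smul_space_mem_cylinder {d : ℕ} {T τ : ℝ} {z : ℝ × Vec d} {e : Vec d} :
    z + τ • ((0 : ℝ), e) ∈ cylinder d T ↔ z ∈ cylinder d T := by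
  simp [_root_.cylinder]

/-- Lipschitz bounds in one space direction yield a weak space derivative with the same bound. -/
lemma exists_space_deriv {d : ℕ} {T ϑ : ℝ} (i : Fin d) {F : ℝ × Vec d → Vec d}
    (hF : AEStronglyMeasurable F volume) {M : ℝ} (hM : ∀ᵐ z, ‖F z‖ ≤ M) {C : ℝ} (hC : 0 < C)
    (h : ∀ τ : ℝ, 0 < τ → τ ≤ 1 → ∀ᵐ z, z ∈ cylinder d T →
      ‖F (z + τ • ((0 : ℝ), stdVec d i)) - F z‖ ≤ τ * (C * wt ϑ z.2)) :
    ∃ w : ℝ × Vec d → Vec d, AEStronglyMeasurable w volume ∧ (∀ᵐ z, ‖w z‖ ≤ C * wt ϑ z.2) ∧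
      HasWeakDirDeriv (cylinder d T) ((0 : ℝ), stdVec d i) F w := by
  obtain ⟨w, hw, hw0, hwb, hwd⟩ := exists_hasWeakDirDeriv_of_norm_sub_le (isOpen_cylinder d T)
    ((0 : ℝ), stdVec d i) hF hM (ρ := fun z => C * wt ϑ z.2)
    (((measurable_wt ϑ).comp measurable_snd).const_mul C)
    (((continuous_wt ϑ).comp continuous_snd).const_mul C).continuousOn
    (fun z _ => mul_pos hC (wt_pos ϑ z.2))
    (fun τ hτ hτ1 => (h τ hτ hτ1).mono fun z hz hzΩ _ => hz hzΩ)
  refine ⟨w, hw, ?_, hwd⟩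
  filter_upwards [hwb] with z hz
  by_cases hzΩ : z ∈ cylinder d T
  · exact hz hzΩ
  · rw [hw0 z hzΩ, norm_zero]
    exact (mul_pos hC (wt_pos ϑ z.2)).le

lemma ae_norm_le_of_wt_snd {d : ℕ} {ϑ : ℝ} (hϑ : 0 ≤ ϑ) {F : ℝ × Vec d → Vec d} {C : ℝ} (hC : 0 ≤ C)
    (h : ∀ᵐ z, ‖F z‖ ≤ C * wt ϑ z.2) : ∀ᵐ z, ‖F z‖ ≤ C :=
  h.mono fun z hz => hz.trans (mul_le_of_le_one_right hC (wt_le_one hϑ z.2))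

lemma norm_smul_stdVec_le {d : ℕ} (i : Fin d) {τ : ℝ} (hτ : 0 ≤ τ) (hτ1 : τ ≤ 1) :
    ‖τ • stdVec d i‖ ≤ 1 := by
  rw [norm_smul, norm_stdVec, Real.norm_of_nonneg hτ, mul_one]
  exact hτ1

section

variable {d : ℕ} {T ϑ A : ℝ} {a : Vec d → Vec d} {U : ℝ → Vec d → Vec d}

lemma IsBoundedMild.norm_uncurry_le (hϑ₀ : 0 ≤ ϑ) (hA : 0 ≤ A) (hU : IsBoundedMild T ϑ A a U) :
    ∀ z, ‖Function.uncurry U z‖ ≤ A := fun z =>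
  (hU.norm_le z.1 z.2).trans (mul_le_of_le_one_right hA (wt_le_one hϑ₀ z.2))

lemma IsBoundedMild.ae_norm_datum_le (hϑ₀ : 0 ≤ ϑ) (hA : 0 ≤ A) (hU : IsBoundedMild T ϑ A a U) :
    ∀ᵐ x, ‖a x‖ ≤ A :=
  Eventually.of_forall fun x =>
    (hU.norm_datum_le x).trans (mul_le_of_le_one_right hA (wt_le_one hϑ₀ x))

/-- First space derivatives of the solution. -/
theorem IsBoundedMild.exists_space_deriv (hϑ₀ : 0 ≤ ϑ) (hϑ₁ : ϑ ≤ (d : ℝ) + 1) (hA : 0 ≤ A)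
    (hU : IsBoundedMild T ϑ A a U) {i : Fin d} {b : Vec d → Vec d}
    (hb : AEStronglyMeasurable b volume) {B : ℝ} (hB : 0 ≤ B) (hbB : ∀ᵐ x, ‖b x‖ ≤ B * wt ϑ x)
    (hab : IsWeakPartial i a b) :
    ∃ (w : ℝ × Vec d → Vec d) (C : ℝ), 0 ≤ C ∧ AEStronglyMeasurable w volume ∧
      (∀ᵐ z, ‖w z‖ ≤ C * wt ϑ z.2) ∧
      HasWeakDirDeriv (cylinder d T) ((0 : ℝ), stdVec d i) (Function.uncurry U) w := by
  obtain ⟨K, hK, h⟩ := exists_norm_increment_le (d := d) hϑ₀ hϑ₁ T hA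
  set C := K * (B * 2 ^ ϑ) + 1
  have hC : 0 < C := by positivity
  obtain ⟨w, h1, h2, h3⟩ := _root_.exists_space_deriv (T := T) (ϑ := ϑ) i
    hU.measurable.aestronglyMeasurable (Eventually.of_forall (hU.norm_uncurry_le hϑ₀ hA)) hC
    fun τ hτ hτ1 => by
      refine ae_cylinder_of_forall (measurableSet_le
        ((hU.measurable.comp (by fun_prop)).sub hU.measurable).norm
        ((((measurable_wt ϑ).comp measurable_snd).const_mul C).const_mul τ)) fun t ht => ?_
      filter_upwards [h a U hU (τ • stdVec d i) (τ * (B * 2 ^ ϑ)) (norm_smul_stdVec_le i hτ.le hτ1)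
        (by positivity) (norm_increment_le_of_partial hϑ₀ hU.measurable_datum.aestronglyMeasurable
          (hU.ae_norm_datum_le hϑ₀ hA) hb hB hbB hab hτ.le hτ1) t ht] with x hx
      have hw := (wt_pos ϑ x).le
      simp only [Prod.smul_mk, smul_zero, Prod.mk_add_mk, add_zero, Function.uncurry_apply_pair]
      refine hx.trans ?_
      calc _ = τ * (K * (B * 2 ^ ϑ) * wt ϑ x) := by ring
        _ ≤ _ := by
          gcongr
          simp only [C]
          linarith
  exact ⟨w, C, hC.le, h1, h2, h3⟩

/-- Second space derivatives of the solution: the derivative in one direction of an increment in the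
other is the increment of the derivative, so first derivatives inherit Lipschitz bounds from the
second increments. -/
theorem IsBoundedMild.exists_second_space_deriv (hϑ₀ : 0 ≤ ϑ) (hϑ₁ : ϑ ≤ (d : ℝ) + 1) (hA : 0 ≤ A)
    (hU : IsBoundedMild T ϑ A a U) {i j : Fin d} {b₁ b₂ c : Vec d → Vec d}
    (hb₁ : AEStronglyMeasurable b₁ volume) (hb₂ : AEStronglyMeasurable b₂ volume)
    (hc : AEStronglyMeasurable c volume) {B : ℝ} (hB : 0 ≤ B)
    (hbB₁ : ∀ᵐ x, ‖b₁ x‖ ≤ B * wt ϑ x) (hbB₂ : ∀ᵐ x, ‖b₂ x‖ ≤ B * wt ϑ x)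
    (hcB : ∀ᵐ x, ‖c x‖ ≤ B * wt ϑ x)
    (hab₁ : IsWeakPartial i a b₁) (hab₂ : IsWeakPartial j a b₂) (hbc : IsWeakPartial i b₂ c)
    {w : ℝ × Vec d → Vec d} (hw : AEStronglyMeasurable w volume) {C : ℝ} (hC : 0 ≤ C)
    (hwC : ∀ᵐ z, ‖w z‖ ≤ C * wt ϑ z.2)
    (hUw : HasWeakDirDeriv (cylinder d T) ((0 : ℝ), stdVec d j) (Function.uncurry U) w) :
    ∃ (y : ℝ × Vec d → Vec d) (C' : ℝ), AEStronglyMeasurable y volume ∧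
      (∀ᵐ z, ‖y z‖ ≤ C' * wt ϑ z.2) ∧
      HasWeakDirDeriv (cylinder d T) ((0 : ℝ), stdVec d i) w y := by
  obtain ⟨K, hK, h⟩ := exists_norm_second_increment_le (d := d) hϑ₀ hϑ₁ T hA
  set q : ℝ := 2 ^ ϑ
  have hq : 0 ≤ q := by positivity
  set C' := K * (B * q * q + (B * q) * (B * q)) + 1
  have hC' : 0 < C' := by positivity
  have ham := hU.measurable_datum.aestronglyMeasurable (μ := volume)
  have haA := hU.ae_norm_datum_le hϑ₀ hA
  obtain ⟨y, h1, h2, h3⟩ := _root_.exists_space_deriv (T := T) (ϑ := ϑ) i hw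
    (ae_norm_le_of_wt_snd hϑ₀ hC hwC) hC' fun τ hτ hτ1 => by
      set e : ℝ × Vec d := τ • ((0 : ℝ), stdVec d i)
      have hFe : Measurable fun z => Function.uncurry U (z + e) - Function.uncurry U z :=
        (hU.measurable.comp (by fun_prop)).sub hU.measurable
      -- the `j`-th derivative `G` of an increment in direction `i`, of size `O(τ)`
      obtain ⟨G, -, hGb, hG⟩ := _root_.exists_space_deriv (T := T) (ϑ := ϑ) j
        hFe.aestronglyMeasurable (M := A + A)
        (Eventually.of_forall fun z => (norm_sub_le _ _).trans
          (add_le_add (hU.norm_uncurry_le hϑ₀ hA _) (hU.norm_uncurry_le hϑ₀ hA _)))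
        (mul_pos hτ hC') fun σ hσ hσ1 => by
          refine ae_cylinder_of_forall (measurableSet_le
            ((hFe.comp (by fun_prop)).sub hFe).norm
            ((((measurable_wt ϑ).comp measurable_snd).const_mul _).const_mul σ)) fun t ht => ?_
          filter_upwards [h a U hU (τ • stdVec d i) (σ • stdVec d j) (τ * (B * q)) (σ * (B * q))
            (σ * (τ * (B * q) * q)) (norm_smul_stdVec_le i hτ.le hτ1)
            (norm_smul_stdVec_le j hσ.le hσ1) (by positivity) (by positivity) (by positivity)
            (norm_increment_le_of_partial hϑ₀ ham haA hb₁ hB hbB₁ hab₁ hτ.le hτ1)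
            (norm_increment_le_of_partial hϑ₀ ham haA hb₂ hB hbB₂ hab₂ hσ.le hσ1)
            (norm_second_increment_le_of_partial hϑ₀ ham haA hb₂ (ae_norm_le_of_wt hϑ₀ hB hbB₂)
              hc hB hcB hab₂ hbc hσ.le hσ1 hτ.le hτ1) t ht] with x hx
          have hw := (wt_pos ϑ x).le
          simp only [e, Prod.smul_mk, smul_zero, Prod.mk_add_mk, add_zero,
            Function.uncurry_apply_pair]
          refine hx.trans ?_
          calc _ = σ * (τ * (K * (B * q * q + (B * q) * (B * q))) * wt ϑ x) := by ring
            _ ≤ _ := by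
              gcongr
              simp only [C']
              linarith
      filter_upwards [hGb, weakDirDeriv_increment_ae_eq (isOpen_cylinder d T)
        (fun z => add_smul_space_mem_cylinder) hU.measurable.aestronglyMeasurable
        (Eventually.of_forall (hU.norm_uncurry_le hϑ₀ hA)) hw (ae_norm_le_of_wt_snd hϑ₀ hC hwC)
        hUw hG] with z hz1 hz2 hzΩ
      rw [← hz2 hzΩ, ← mul_assoc]
      exact hz1
  exact ⟨y, C', h1, h2, h3⟩

/-- The time derivative of the solution. -/
theorem IsBoundedMild.exists_time_deriv (hϑ₀ : 0 ≤ ϑ) (hϑ₁ : ϑ ≤ (d : ℝ) + 1) (hA : 0 ≤ A)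
    (hU : IsBoundedMild T ϑ A a U) {b : Fin d → Vec d → Vec d}
    (hb : ∀ i, AEStronglyMeasurable (b i) volume) {B : ℝ} (hB : 0 ≤ B)
    (hbB : ∀ i, ∀ᵐ x, ‖b i x‖ ≤ B * wt ϑ x) (hab : ∀ i, IsWeakPartial i a (b i)) :
    ∃ (v : ℝ × Vec d → Vec d) (C : ℝ), AEStronglyMeasurable v volume ∧
      (∀ᵐ z, z ∈ cylinder d T → ‖√z.1 • v z‖ ≤ C * wt ϑ z.2) ∧
      HasWeakDirDeriv (cylinder d T) ((1 : ℝ), (0 : Vec d)) (Function.uncurry U) v := by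
  obtain ⟨K, hK, h⟩ := exists_norm_time_increment_le hϑ₀ hϑ₁ hA hU (L := d * B) (by positivity)
    (norm_increment_le_of_partials hϑ₀ hU.measurable_datum.aestronglyMeasurable
      (hU.ae_norm_datum_le hϑ₀ hA) hb hB hbB hab)
  set ρ : ℝ × Vec d → ℝ := fun z => (K + 1) * (z.1 ^ (-(1 / 2) : ℝ) * wt ϑ z.2)
  have hρm : Measurable ρ :=
    ((measurable_fst.pow_const _).mul ((measurable_wt ϑ).comp measurable_snd)).const_mul _
  have hρ0 : ∀ z ∈ cylinder d T, 0 < ρ z := fun z hz => by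
    have h1 : 0 < z.1 := hz.1.1
    have h2 := wt_pos ϑ z.2
    simp only [ρ]
    positivity
  have hρc : ContinuousOn ρ (cylinder d T) := by
    refine continuousOn_const.mul (ContinuousOn.mul ?_
      ((continuous_wt ϑ).comp continuous_snd).continuousOn)
    exact continuousOn_fst.rpow_const fun z hz => Or.inl hz.1.1.ne'
  obtain ⟨v, hv, -, hvb, hvd⟩ := exists_hasWeakDirDeriv_of_norm_sub_le (isOpen_cylinder d T)
    ((1 : ℝ), (0 : Vec d)) hU.measurable.aestronglyMeasurable
    (Eventually.of_forall (hU.norm_uncurry_le hϑ₀ hA)) hρm hρc hρ0 fun τ hτ _ => by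
      have hF : Measurable fun z : ℝ × Vec d =>
          Function.uncurry U (z + τ • ((1 : ℝ), (0 : Vec d))) - Function.uncurry U z :=
        (hU.measurable.comp (by fun_prop)).sub hU.measurable
      have h1 := ae_cylinder_of_forall (T := T - τ) (measurableSet_le hF.norm (hρm.const_mul τ))
        fun t ht => by
          filter_upwards [h τ hτ.le t ht] with x hx
          have hw := (wt_pos ϑ x).le
          have h0 := rpow_neg_half_nonneg t
          simp only [Prod.smul_mk, smul_zero, smul_eq_mul, mul_one, Prod.mk_add_mk, add_zero,
            Function.uncurry_apply_pair, ρ]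
          refine hx.trans ?_
          calc _ = τ * (K * (t ^ (-(1 / 2) : ℝ) * wt ϑ x)) := by ring
            _ ≤ _ := by
              gcongr
              linarith
      filter_upwards [h1] with z hz hz1 hz2
      refine hz ⟨⟨hz1.1.1, ?_⟩, trivial⟩
      have : z.1 + τ * 1 < T := hz2.1.2
      linarith
  refine ⟨v, K + 1, hv, ?_, hvd⟩
  filter_upwards [hvb] with z hz hzΩ
  have h1 : 0 < z.1 := hzΩ.1.1
  rw [norm_smul, Real.norm_of_nonneg (Real.sqrt_nonneg _)]
  calc √z.1 * ‖v z‖ ≤ √z.1 * ρ z := by gcongr; exact hz hzΩ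
    _ = (√z.1 * z.1 ^ (-(1 / 2) : ℝ)) * ((K + 1) * wt ϑ z.2) := by simp only [ρ]; ring
    _ = _ := by
      rw [Real.rpow_neg h1.le, ← Real.sqrt_eq_rpow, mul_inv_cancel₀ (Real.sqrt_pos.2 h1).ne', one_mul]

end

lemma MemWeighted.exists_norm_le {d : ℕ} {ϑ : ℝ} {f : Vec d → Vec d} (h : MemWeighted ϑ f) :
    ∃ C, 0 ≤ C ∧ ∀ᵐ x, ‖f x‖ ≤ C * wt ϑ x := by
  obtain ⟨-, C, hC⟩ := h
  refine ⟨max C 0, le_max_right _ _, hC.mono fun x hx => ?_⟩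
  rw [← weight_mul_le_iff]
  exact hx.trans (le_max_left _ _)

/-- A finite family of weighted functions obeys a common bound. -/
lemma exists_norm_le_of_memWeighted {d : ℕ} {ϑ : ℝ} {ι : Type*} [Fintype ι] {f : ι → Vec d → Vec d}
    (h : ∀ i, MemWeighted ϑ (f i)) : ∃ C, 0 ≤ C ∧ ∀ i, ∀ᵐ x, ‖f i x‖ ≤ C * wt ϑ x := by
  choose C hC0 hC using fun i => (h i).exists_norm_le
  refine ⟨∑ i, C i, Finset.sum_nonneg fun i _ => hC0 i, fun i => (hC i).mono fun x hx => hx.trans ?_⟩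
  have := (wt_pos ϑ x).le
  gcongr
  exact Finset.single_le_sum (fun i _ => hC0 i) (Finset.mem_univ i)

end

theorem mainTheorem10 (d : ℕ) (hd : 2 ≤ d) (T : ℝ) (hT : 0 < T) (ϑ : ℝ) (hϑ₀ : 0 ≤ ϑ)
    (hϑ₁ : ϑ ≤ (d : ℝ) + 1) (a : Vec d → Vec d) (u : ℝ → Vec d → Vec d)
    (ha : MemWeighted ϑ a) (hu : MemLinftyWeighted T ϑ u) (hsol : IsMildSolution T a u) :
    (∀ i : Fin d,
      (∃ b : Vec d → Vec d, IsWeakPartial i a b ∧ MemWeighted ϑ b) →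
      ∃ w : ℝ → Vec d → Vec d, IsWeakSpaceDeriv T i u w ∧ MemLinftyWeighted T ϑ w) ∧
    ((∃ (b : Fin d → Vec d → Vec d) (c : Fin d → Fin d → Vec d → Vec d),
        (∀ i, IsWeakPartial i a (b i) ∧ MemWeighted ϑ (b i)) ∧
        (∀ i j, IsWeakPartial i (b j) (c i j) ∧ MemWeighted ϑ (c i j))) →
      (∃ (w : Fin d → ℝ → Vec d → Vec d) (z : Fin d → Fin d → ℝ → Vec d → Vec d),
        (∀ i, IsWeakSpaceDeriv T i u (w i) ∧ MemLinftyWeighted T ϑ (w i)) ∧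
        (∀ i j, IsWeakSpaceDeriv T i (w j) (z i j) ∧ MemLinftyWeighted T ϑ (z i j))) ∧
      (∃ v : ℝ → Vec d → Vec d, IsWeakTimeDeriv T u v ∧
        MemLinftyWeighted T ϑ (fun t x => Real.sqrt t • v t x))) := by
  -- pass to the representatives of `a` and `u` for which everything holds pointwise, and transport
  -- weak derivatives between the two
  obtain ⟨a', U, A, hA, ha'm, haa', ha'b, hUm, hUb, hUeq, huU⟩ :=
    exists_everywhere_mild_representative hϑ₀ hϑ₁ ha hu hsol
  have hU : IsBoundedMild T ϑ A a' U := ⟨ha'm, ha'b, hUm, hUb, hUeq⟩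
  rw [← volume_restrict_cylinder] at huU
  have datum : ∀ {i : Fin d} {b : Vec d → Vec d}, IsWeakPartial i a b → IsWeakPartial i a' b :=
    fun h => h.congr_ae (by simpa using haa') ae_eq_rfl
  have sol : ∀ {v : ℝ × Vec d} {g : ℝ × Vec d → Vec d},
      HasWeakDirDeriv (cylinder d T) v (Function.uncurry U) g →
      HasWeakDirDeriv (cylinder d T) v (Function.uncurry u) (Function.uncurry (Function.curry g)) :=
    fun h => h.congr_ae huU.symm (by rw [Function.uncurry_curry])
  refine ⟨fun i ⟨b, hab, hb⟩ => ?_, fun ⟨b, c, hb, hc⟩ => ?_⟩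
  · obtain ⟨B, hB, hbB⟩ := hb.exists_norm_le
    obtain ⟨w, C, -, hw, hwC, hUw⟩ := hU.exists_space_deriv hϑ₀ hϑ₁ hA hb.1 hB hbB (datum hab)
    exact ⟨Function.curry w, sol hUw, memLinftyWeighted_of_ae hw (hwC.mono fun z hz _ => hz)⟩
  · obtain ⟨B₁, hB₁, hbB₁⟩ := exists_norm_le_of_memWeighted fun i => (hb i).2
    obtain ⟨B₂, hB₂, hcB₂⟩ := exists_norm_le_of_memWeighted
      (f := fun p : Fin d × Fin d => c p.1 p.2) fun p => (hc p.1 p.2).2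
    set B := B₁ + B₂
    have hB : 0 ≤ B := add_nonneg hB₁ hB₂
    have hbB : ∀ i, ∀ᵐ x, ‖b i x‖ ≤ B * wt ϑ x := fun i => (hbB₁ i).mono fun x hx =>
      hx.trans (mul_le_mul_of_nonneg_right (by simp only [B]; linarith) (wt_pos ϑ x).le)
    have hcB : ∀ i j, ∀ᵐ x, ‖c i j x‖ ≤ B * wt ϑ x := fun i j => (hcB₂ (i, j)).mono fun x hx =>
      hx.trans (mul_le_mul_of_nonneg_right (by simp only [B]; linarith) (wt_pos ϑ x).le)
    have hab := fun i => datum (hb i).1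
    choose w C hC hw hwC hUw using fun i =>
      hU.exists_space_deriv hϑ₀ hϑ₁ hA (hb i).2.1 hB (hbB i) (hab i)
    choose y C' hy hyC hwy using fun i j =>
      hU.exists_second_space_deriv hϑ₀ hϑ₁ hA (hb i).2.1 (hb j).2.1 (hc i j).2.1 hB (hbB i) (hbB j)
        (hcB i j) (hab i) (hab j) (hc i j).1 (hw j) (hC j) (hwC j) (hUw j)
    obtain ⟨v, Cv, hv, hvC, hUv⟩ := hU.exists_time_deriv hϑ₀ hϑ₁ hA (fun i => (hb i).2.1) hB hbB hab
    refine ⟨⟨fun i => Function.curry (w i), fun i j => Function.curry (y i j), fun i =>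
      ⟨sol (hUw i), memLinftyWeighted_of_ae (hw i) ((hwC i).mono fun z hz _ => hz)⟩, fun i j =>
      ⟨hwy i j, memLinftyWeighted_of_ae (hy i j) ((hyC i j).mono fun z hz _ => hz)⟩⟩,
      ⟨Function.curry v, sol hUv, ?_⟩⟩
    exact memLinftyWeighted_of_ae (g := fun z => √z.1 • v z)
      (AEStronglyMeasurable.smul
        (Real.continuous_sqrt.comp continuous_fst).aestronglyMeasurable hv) hvC
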